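/- Notation. Indices $a,b,c,d\in\{0,\dots,10\}$ are raised and lowered with $\eta=\mathrm{diag}(-1,+1,\dots,+1)$, repeated indices are summed over all values, and $\epsilon_{0\,1\cdots 10}=+1$. Let $\mathbf{32}$ be the real 32-dimensional representation of $\mathrm{Pin}^+(1,10)$, with Clifford generators satisfying $\Gamma_a\Gamma_b+\Gamma_b\Gamma_a=2\eta_{ab}$ and $\Gamma_0\Gamma_1\cdots\Gamma_{10}=1$, equipped with a non-degenerate skew-symmetric pairing $(\overline{\psi}\,\phi)=\psi^\alpha\eta_{\alpha\beta}\phi^\beta$ for which all $\Gamma_a$ are skew self-adjoint; $\Gamma_{a_1\cdots a_p}$ is the skew-symmetrized product (of unit weight). For $s\in\mathbb{R}$ let $\mathrm{CE}(\widehat{\mathfrak M})$ be the free graded-commutative superalgebra on generators $e^a$, $e_{a_1a_2}=e_{[a_1a_2]}$, $e_{a_1\cdots a_5}=e_{[a_1\cdots a_5]}$ of bidegree $(1,\mathrm{evn})$ and $\psi^\alpha$, $\phi^\alpha$ ($1\le\alpha\le 32$) of bidegree $(1,\mathrm{odd})$, with sign rule $v_1v_2=(-1)^{n_1n_2+\sigma_1\sigma_2}v_2v_1$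 in bidegrees $(n_i,\sigma_i)$, and with the graded derivation $\mathrm d$ of bidegree $(1,\mathrm{evn})$ given by $$\mathrm d\psi=0,\quad \mathrm de^a=(\overline\psi\,\Gamma^a\psi),\quad \mathrm de_{a_1a_2}=-(\overline\psi\,\Gamma_{a_1a_2}\psi),\quad \mathrm de_{a_1\cdots a_5}=(\overline\psi\,\Gamma_{a_1\cdots a_5}\psi),$$ $$\mathrm d\phi=\delta\,\Gamma_a\psi\,e^a+\gamma_1\,\Gamma^{a_1a_2}\psi\,e_{a_1a_2}+\gamma_2\,\Gamma^{a_1\cdots a_5}\psi\,e_{a_1\cdots a_5},\qquad \delta=2(1+s),\quad \gamma_1=1,\quad \gamma_2=2\left(\tfrac1{5!}+\tfrac{s}{6!}\right).$$ Let $\phi_{\mathrm{ex}}^*:\mathrm{CE}(\mathbb R^{1,10|\mathbf{32}})=\mathbb R[\psi^\alpha,e^a]\to\mathrm{CE}(\widehat{\mathfrak M})$ be the inclusion $\psi^\alpha\mapsto\psi^\alpha$, $e^a\mapsto e^a$, and let $G_4=\tfrac12(\overline\psi\,\Gamma_{a_1a_2}\psi)\,e^{a_1}e^{a_2}$. Proposition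 (The hidden 3-form). Let $s\in\mathbb R\setminus\{0\}$ and $\alpha_0,\dots,\alpha_4,\beta_1,\beta_2,\beta_3\in\mathbb R$. The element $$\begin{aligned}\widehat P_3:=\;&\alpha_0\,e_{a_1a_2}e^{a_1}e^{a_2}+\alpha_1\,e^{a_1}{}_{a_2}e^{a_2}{}_{a_3}e^{a_3}{}_{a_1}+\alpha_2\,e^{a_1\cdots a_4b_1}e_{b_1}{}^{b_2}e_{b_2a_1\cdots a_4}\\&+\alpha_3\,\epsilon_{a_1\cdots a_5b_1\cdots b_5c}\,e^{a_1\cdots a_5}e^{b_1\cdots b_5}e^c+\alpha_4\,\epsilon_{a_1a_2a_3b_1b_2b_3c_1\cdots c_5}\,e^{a_1a_2a_3d_1d_2}e_{d_1d_2}{}^{b_1b_2b_3}e^{c_1\cdots c_5}\\&+\beta_1(\overline\psi\,\Gamma_a\phi)e^a+\beta_2(\overline\psi\,\Gamma_{a_1a_2}\phi)e^{a_1a_2}+\beta_3(\overline\psi\,\Gamma_{a_1\cdots a_5}\phi)e^{a_1\cdots a_5}\end{aligned}$$ of $\mathrm{CE}(\widehat{\mathfrak M})$ satisfies $\mathrm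 d\widehat P_3=\phi_{\mathrm{ex}}^*G_4$ if and only if $$\alpha_0=\tfrac12\cdot\tfrac{-1}{5}\cdot\tfrac{6+2s+s^2}{s^2},\quad \alpha_1=\tfrac12\cdot\tfrac1{15}\cdot\tfrac{6+2s}{s^2},\quad \alpha_2=\tfrac12\cdot\tfrac1{6!}\cdot\tfrac{(6+s)^2}{s^2},$$ $$\alpha_3=\tfrac12\cdot\tfrac1{5\cdot5!\cdot6!}\cdot\tfrac{(6+s)^2}{s^2},\quad \alpha_4=\tfrac12\cdot\tfrac{-1}{9\cdot5!\cdot6!}\cdot\tfrac{(6+s)^2}{s^2},$$ $$\beta_1=-\tfrac1{10\gamma_1}\cdot\tfrac{3-2s}{s^2},\quad \beta_2=-\tfrac1{20\gamma_1}\cdot\tfrac{3+s}{s^2},\quad \beta_3=-\tfrac3{10\cdot6!\cdot\gamma_1}\cdot\tfrac{6+s}{s^2}.$$ -/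

import Mathlib

open scoped BigOperators Nat

namespace HiddenM

noncomputable section

/-! ## Free graded-commutative superalgebras and their graded derivations -/

/-- The Koszul sign for two bidegrees in `ℤ × ℤ/2` (here only degrees `n ≥ 0` occur):
`(-1) ^ (n₁ n₂ + σ₁ σ₂)`. -/
def koszulSign (d₁ d₂ : ℕ × ZMod 2) : ℝ :=
  (-1) ^ (d₁.1 * d₂.1 + d₁.2.val * d₂.2.val)

/-- The sign rule on generators `vᵢ` of bidegree `(1, σ i)`. -/
inductive SignRule {ι : Type} (σ : ι → ZMod 2) : FreeAlgebra ℝ ι → FreeAlgebra ℝ ι → Prop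
  | swap (i j : ι) : SignRule σ
      (FreeAlgebra.ι ℝ i * FreeAlgebra.ι ℝ j)
      (koszulSign (1, σ i) (1, σ j) • (FreeAlgebra.ι ℝ j * FreeAlgebra.ι ℝ i))

/-- The free graded-commutative superalgebra `ℝ[(vᵢ)]` on generators `vᵢ` of bidegree `(1, σ i)`:
the tensor algebra modulo the sign rule. -/
def GradedPoly {ι : Type} (σ : ι → ZMod 2) : Type := RingQuot (SignRule σ)

instance {ι : Type} (σ : ι → ZMod 2) : Ring (GradedPoly σ) :=
  inferInstanceAs (Ring (RingQuot (SignRule σ)))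

instance {ι : Type} (σ : ι → ZMod 2) : Algebra ℝ (GradedPoly σ) :=
  inferInstanceAs (Algebra ℝ (RingQuot (SignRule σ)))

/-- The quotient map from the tensor algebra. -/
def quotHom {ι : Type} (σ : ι → ZMod 2) : FreeAlgebra ℝ ι →ₐ[ℝ] GradedPoly σ :=
  RingQuot.mkAlgHom ℝ (SignRule σ)

/-- The generator `vᵢ`. -/
def gen {ι : Type} (σ : ι → ZMod 2) (i : ι) : GradedPoly σ :=
  quotHom σ (FreeAlgebra.ι ℝ i)

theorem gen_mul_gen {ι : Type} (σ : ι → ZMod 2) (i j : ι) :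
    gen σ i * gen σ j = koszulSign (1, σ i) (1, σ j) • (gen σ j * gen σ i) := by
  have h : quotHom σ _ = quotHom σ _ :=
    RingQuot.mkAlgHom_rel ℝ (SignRule.swap (σ := σ) i j)
  rw [map_mul, map_smul, map_mul] at h
  exact h

/-- The algebra homomorphism determined by images of the generators that obey the sign rule. -/
def liftHom {ι : Type} (σ : ι → ZMod 2) {B : Type} [Ring B] [Algebra ℝ B] (f : ι → B)
    (hf : ∀ i j, f i * f j = koszulSign (1, σ i) (1, σ j) • (f j * f i)) :
    GradedPoly σ →ₐ[ℝ] B :=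
  RingQuot.liftAlgHom ℝ ⟨FreeAlgebra.lift ℝ f, by
    rintro _ _ ⟨i, j⟩
    simpa only [map_mul, map_smul, FreeAlgebra.lift_ι_apply] using hf i j⟩

theorem liftHom_gen {ι : Type} (σ : ι → ZMod 2) {B : Type} [Ring B] [Algebra ℝ B] (f : ι → B)
    (hf : ∀ i j, f i * f j = koszulSign (1, σ i) (1, σ j) • (f j * f i)) (i : ι) :
    liftHom σ f hf (gen σ i) = f i := by
  exact (RingQuot.liftAlgHom_mkAlgHom_apply ℝ _ _ _).trans (FreeAlgebra.lift_ι_apply _ _)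

/-- The grading automorphism, `x ↦ (-1)ⁿ x` in cohomological degree `n`. -/
def gradeInv {ι : Type} (σ : ι → ZMod 2) : GradedPoly σ →ₐ[ℝ] GradedPoly σ :=
  liftHom σ (fun i => -gen σ i) (fun i j => by
    simpa only [neg_mul_neg] using gen_mul_gen σ i j)

/-- The sign rule between an element `D i` of bidegree `(2, σ i)` and a generator. -/
def DegreeTwo {ι : Type} (σ : ι → ZMod 2) (D : ι → GradedPoly σ) : Prop :=
  ∀ i j, D i * gen σ j = koszulSign (2, σ i) (1, σ j) • (gen σ j * D i)

theorem derivMatrix_rel {ι : Type} (σ : ι → ZMod 2) (D : ι → GradedPoly σ) (hD : DegreeTwo σ D)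
    (i j : ι) :
    (!![-gen σ i, D i; 0, gen σ i] * !![-gen σ j, D j; 0, gen σ j] :
        Matrix (Fin 2) (Fin 2) (GradedPoly σ)) =
      koszulSign (1, σ i) (1, σ j) •
        (!![-gen σ j, D j; 0, gen σ j] * !![-gen σ i, D i; 0, gen σ i]) := by
  have h1 := gen_mul_gen σ i j
  have h2 := hD i j
  have h3 := hD j i
  have hs : koszulSign (2, σ j) (1, σ i) = koszulSign (2, σ i) (1, σ j) := by
    simp [koszulSign, mul_comm, pow_add]
  have hk : koszulSign (1, σ i) (1, σ j) = -koszulSign (2, σ i) (1, σ j) := by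
    simp [koszulSign, pow_add]
  have hq : koszulSign (2, σ i) (1, σ j) * koszulSign (2, σ i) (1, σ j) = 1 := by
    unfold koszulSign
    rw [← pow_add, ← two_mul, pow_mul]
    norm_num
  ext a b
  fin_cases a <;> fin_cases b
  · simp [Matrix.mul_apply, Fin.sum_univ_two, h1]
  · simp only [Matrix.mul_apply, Fin.sum_univ_two, Matrix.smul_apply]
    simp only [Fin.zero_eta, Fin.mk_one, Matrix.of_apply, Matrix.cons_val', Matrix.cons_val_zero,
      Matrix.cons_val_one, Matrix.cons_val_fin_one]
    rw [h2, h3, hk, hs, smul_add, neg_mul, neg_mul, neg_smul, neg_smul, smul_neg, smul_smul, hq,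
      one_smul]
    abel
  · simp [Matrix.mul_apply, Fin.sum_univ_two]
  · simp [Matrix.mul_apply, Fin.sum_univ_two, h1]

/-- `x ↦ !![(-1)ⁿ x, d x; 0, x]`: its multiplicativity is the graded Leibniz rule for `d`. -/
def derivHom {ι : Type} (σ : ι → ZMod 2) (D : ι → GradedPoly σ) (hD : DegreeTwo σ D) :
    GradedPoly σ →ₐ[ℝ] Matrix (Fin 2) (Fin 2) (GradedPoly σ) :=
  liftHom σ (fun i => !![-gen σ i, D i; 0, gen σ i]) (derivMatrix_rel σ D hD)

/-- The graded derivation of bidegree `(1, evn)` with `d vᵢ = D i`; it is characterized by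
`gradedDeriv_gen` and `gradedDeriv_mul`. -/
def gradedDeriv {ι : Type} (σ : ι → ZMod 2) (D : ι → GradedPoly σ) (hD : DegreeTwo σ D) :
    GradedPoly σ →ₗ[ℝ] GradedPoly σ where
  toFun x := derivHom σ D hD x 0 1
  map_add' x y := by simp
  map_smul' c x := by simp

theorem gradedDeriv_gen {ι : Type} (σ : ι → ZMod 2) (D : ι → GradedPoly σ) (hD : DegreeTwo σ D)
    (i : ι) : gradedDeriv σ D hD (gen σ i) = D i := by
  simp [gradedDeriv, derivHom, liftHom_gen]

theorem derivHom_entries {ι : Type} (σ : ι → ZMod 2) (D : ι → GradedPoly σ)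
    (hD : DegreeTwo σ D) (x : GradedPoly σ) :
    derivHom σ D hD x 0 0 = gradeInv σ x ∧ derivHom σ D hD x 1 0 = 0 ∧
      derivHom σ D hD x 1 1 = x := by
  obtain ⟨x, rfl⟩ : ∃ y, quotHom σ y = x := RingQuot.mkAlgHom_surjective ℝ (SignRule σ) x
  induction x using FreeAlgebra.induction with
  | grade0 r =>
    rw [AlgHom.commutes, AlgHom.commutes, AlgHom.commutes]
    simp [Matrix.algebraMap_matrix_apply]
  | grade1 i =>
    have h1 := liftHom_gen σ _ (derivMatrix_rel σ D hD) i
    have h2 : gradeInv σ (gen σ i) = -gen σ i := liftHom_gen σ _ _ i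
    change derivHom σ D hD (gen σ i) 0 0 = gradeInv σ (gen σ i) ∧
      derivHom σ D hD (gen σ i) 1 0 = 0 ∧ derivHom σ D hD (gen σ i) 1 1 = gen σ i
    rw [h2, derivHom, h1]
    simp
  | mul a b ha hb =>
    obtain ⟨a0, a1, a2⟩ := ha
    obtain ⟨b0, b1, b2⟩ := hb
    simp only [map_mul, Matrix.mul_apply, Fin.sum_univ_two, a0, a1, a2, b0, b1, b2]
    simp
  | add a b ha hb =>
    obtain ⟨a0, a1, a2⟩ := ha
    obtain ⟨b0, b1, b2⟩ := hb
    simp only [map_add, Matrix.add_apply, a0, a1, a2, b0, b1, b2]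
    simp

theorem gradedDeriv_mul {ι : Type} (σ : ι → ZMod 2) (D : ι → GradedPoly σ) (hD : DegreeTwo σ D)
    (x y : GradedPoly σ) :
    gradedDeriv σ D hD (x * y) =
      gradedDeriv σ D hD x * y + gradeInv σ x * gradedDeriv σ D hD y := by
  have hx := (derivHom_entries σ D hD x).1
  have hy := (derivHom_entries σ D hD y).2.2
  change derivHom σ D hD (x * y) 0 1 =
    derivHom σ D hD x 0 1 * y + gradeInv σ x * derivHom σ D hD y 0 1
  rw [map_mul, Matrix.mul_apply, Fin.sum_univ_two, hx, hy, add_comm]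

/-! ## Tensor conventions -/

/-- Diagonal entry `η_{aa} = η^{aa}` of the mostly-plus Minkowski metric on `ℝ^{1,10}`. Since the
metric is diagonal, raising or lowering an index `a` is multiplication by `mink a`. -/
def mink (a : Fin 11) : ℝ := if a = 0 then -1 else 1

/-- The factor by which a tensor component changes when all indices `a₁ ⋯ a_p` are raised
(or lowered). -/
def raise {p : ℕ} (a : Fin p → Fin 11) : ℝ := ∏ i, mink (a i)

/-- The Levi-Civita symbol with lower indices, `ε_{0 1 ⋯ 10} = +1`. -/
def levi (a : Fin 11 → Fin 11) : ℝ :=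
  Matrix.det (Matrix.of fun i j : Fin 11 => if a i = j then (1 : ℝ) else 0)

/-- The skew-symmetric family `(x_{a₁ ⋯ a_p})` whose components at increasing indices are `f`. -/
def skewExt {p : ℕ} {M : Type} [AddCommGroup M] (f : (Fin p ↪o Fin 11) → M)
    (a : Fin p → Fin 11) : M :=
  ∑ τ : Equiv.Perm (Fin p), ∑ b : Fin p ↪o Fin 11,
    if a = b ∘ τ then ((Equiv.Perm.sign τ : ℤˣ) : ℤ) • f b else 0

/-! ## Majorana spinors in eleven dimensions -/

/-- The real 32-dimensional representation of `Pin⁺(1,10)` by Clifford generators `Γ_a`, in a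
linear basis, with its skew-symmetric non-degenerate spinor metric `C = (η_{αβ})`, for which the
Clifford generators are skew self-adjoint (hence which is `Spin(1,10)`-invariant). -/
structure MajoranaRep where
  Γ : Fin 11 → Matrix (Fin 32) (Fin 32) ℝ
  C : Matrix (Fin 32) (Fin 32) ℝ
  clifford : ∀ a b, Γ a * Γ b + Γ b * Γ a = (if a = b then 2 * mink a else 0) • 1
  /-- `Γ_0 Γ_1 ⋯ Γ_10 = 1`. -/
  volume : (List.ofFn Γ).prod = 1
  C_skew : C.transpose = -C
  C_nondeg : C.det ≠ 0
  adjoint : ∀ a, (Γ a).transpose * C = -(C * Γ a)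

/-! ### Existence of the representation

The type `MajoranaRep` is inhabited: signed permutation matrices indexed by `(ℤ/2)⁵`. -/

/-- The character of `ℤ/2`. -/
def chi (c : ZMod 2) : ℝ := if c = 0 then 1 else -1

theorem chi_add (c d : ZMod 2) : chi (c + d) = chi c * chi d := by
  have hc : ∀ x : ZMod 2, x = 0 ∨ x = 1 := by decide
  have ht : (1 + 1 : ZMod 2) = 0 := rfl
  rcases hc c with rfl | rfl <;> rcases hc d with rfl | rfl <;> simp [chi, ht]

/-- The matrix `v_x ↦ (-1)^(z·x) v_{x+m}`. -/
def pauli (p : (Fin 5 → ZMod 2) × (Fin 5 → ZMod 2)) :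
    Matrix (Fin 5 → ZMod 2) (Fin 5 → ZMod 2) ℝ :=
  Matrix.of fun y x => if y = x + p.1 then chi (p.2 ⬝ᵥ x) else 0

theorem pauli_mul (p q : (Fin 5 → ZMod 2) × (Fin 5 → ZMod 2)) :
    pauli p * pauli q = chi (p.2 ⬝ᵥ q.1) • pauli (p + q) := by
  ext y x
  simp only [Matrix.mul_apply, pauli, Matrix.of_apply, Matrix.smul_apply, Prod.fst_add,
    Prod.snd_add, smul_eq_mul]
  rw [Finset.sum_eq_single (x + q.1)]
  · have h : x + (p.1 + q.1) = x + q.1 + p.1 := by abel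
    simp only [if_true, h]
    split_ifs
    · rw [dotProduct_add, add_dotProduct, chi_add, chi_add]
      ring
    · simp
  · intro w _ hw
    simp [hw]
  · simp

theorem pauli_zero : pauli 0 = 1 := by
  ext y x
  simp [pauli, Matrix.one_apply, chi]

theorem pauli_transpose (p : (Fin 5 → ZMod 2) × (Fin 5 → ZMod 2)) :
    (pauli p).transpose = chi (p.2 ⬝ᵥ p.1) • pauli p := by
  ext y x
  have hp : p.1 + p.1 = 0 := by
    funext i
    exact CharTwo.add_self_eq_zero _
  have h : x = y + p.1 ↔ y = x + p.1 := by
    constructor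
    · rintro rfl
      rw [add_assoc, hp, add_zero]
    · rintro rfl
      rw [add_assoc, hp, add_zero]
  simp only [Matrix.transpose_apply, pauli, Matrix.of_apply, Matrix.smul_apply, smul_eq_mul, h]
  split_ifs with hy
  · rw [hy, dotProduct_add, chi_add, mul_comm]
  · simp

/-- Sign exponent and label of a product of matrices `pauli p`. -/
def pauliAcc : List ((Fin 5 → ZMod 2) × (Fin 5 → ZMod 2)) →
    ZMod 2 × ((Fin 5 → ZMod 2) × (Fin 5 → ZMod 2))
  | [] => (0, 0)
  | p :: l => ((pauliAcc l).1 + p.2 ⬝ᵥ (pauliAcc l).2.1, p + (pauliAcc l).2)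

theorem pauli_prod (l : List ((Fin 5 → ZMod 2) × (Fin 5 → ZMod 2))) :
    (l.map pauli).prod = chi (pauliAcc l).1 • pauli (pauliAcc l).2 := by
  induction l with
  | nil => simp [pauliAcc, pauli_zero, chi]
  | cons p l ih =>
    rw [List.map_cons, List.prod_cons, ih, mul_smul_comm, pauli_mul, smul_smul, ← chi_add]
    rfl

/-- Labels of the eleven Clifford generators. -/
def pauliLabel : Fin 11 → (Fin 5 → ZMod 2) × (Fin 5 → ZMod 2) :=
  ![(![1, 0, 0, 0, 0], ![1, 0, 0, 0, 0]),
    (![1, 0, 0, 0, 0], ![0, 0, 0, 0, 0]),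
    (![0, 1, 0, 0, 0], ![1, 0, 0, 0, 0]),
    (![0, 0, 0, 0, 0], ![1, 1, 0, 0, 0]),
    (![0, 1, 1, 0, 0], ![1, 1, 1, 0, 0]),
    (![0, 1, 1, 1, 0], ![1, 1, 0, 1, 0]),
    (![0, 1, 0, 1, 1], ![1, 1, 1, 1, 0]),
    (![0, 1, 1, 1, 1], ![1, 1, 0, 0, 1]),
    (![0, 1, 0, 0, 1], ![1, 1, 1, 0, 1]),
    (![0, 1, 1, 0, 1], ![1, 1, 0, 1, 1]),
    (![0, 1, 0, 1, 0], ![1, 1, 1, 1, 1])]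

theorem label_anticomm : ∀ a b : Fin 11, a ≠ b →
    (pauliLabel b).2 ⬝ᵥ (pauliLabel a).1 = (pauliLabel a).2 ⬝ᵥ (pauliLabel b).1 + 1 := by
  decide

theorem label_self : ∀ a : Fin 11,
    (pauliLabel a).2 ⬝ᵥ (pauliLabel a).1 = if a = 0 then 1 else 0 := by
  decide

theorem chi_label (a : Fin 11) : chi ((pauliLabel a).2 ⬝ᵥ (pauliLabel a).1) = mink a := by
  rw [label_self]
  unfold chi mink
  split_ifs <;> simp_all

theorem pauli_sq (a : Fin 11) :
    pauli (pauliLabel a) * pauli (pauliLabel a) = mink a • 1 := by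
  have h : pauliLabel a + pauliLabel a = 0 := by
    ext i <;> exact CharTwo.add_self_eq_zero _
  rw [pauli_mul, chi_label, h, pauli_zero]

theorem pauli_anticomm (a b : Fin 11) (hab : a ≠ b) :
    pauli (pauliLabel a) * pauli (pauliLabel b) = -(pauli (pauliLabel b) * pauli (pauliLabel a)) := by
  have h1 : chi 1 = -1 := by simp [chi]
  rw [pauli_mul, pauli_mul, label_anticomm a b hab, chi_add, h1, add_comm (pauliLabel b)]
  simp

instance : Nonempty MajoranaRep := by
  let ε : (Fin 5 → ZMod 2) ≃ Fin 32 := Fintype.equivFinOfCardEq (by simp [ZMod.card])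
  let F := Matrix.reindexAlgEquiv ℝ ℝ ε
  have hT : ∀ M, (F M).transpose = F M.transpose := fun M => rfl
  have hC : (F (pauli (pauliLabel 0))) * -(F (pauli (pauliLabel 0))) = 1 := by
    rw [mul_neg, ← map_mul, pauli_sq]
    simp [mink]
  refine ⟨⟨fun a => F (pauli (pauliLabel a)), F (pauli (pauliLabel 0)), ?_, ?_, ?_, ?_, ?_⟩⟩
  · intro a b
    rw [← map_mul, ← map_mul, ← map_add]
    split_ifs with h
    · subst h
      rw [pauli_sq, ← add_smul, ← two_mul, map_smul, map_one]
    · rw [pauli_anticomm a b h, neg_add_cancel, map_zero, zero_smul]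
  · have h : (List.ofFn fun a => F (pauli (pauliLabel a))) =
        ((List.ofFn pauliLabel).map pauli).map F := by
      rw [List.map_ofFn, List.map_ofFn]
      rfl
    have h1 : pauliAcc (List.ofFn pauliLabel) = (0, 0) := by decide
    rw [h, ← map_list_prod, pauli_prod, h1, pauli_zero]
    simp [chi]
  · rw [hT, pauli_transpose, chi_label, map_smul]
    simp [mink]
  · have h := Matrix.isUnit_det_of_right_inverse hC
    exact h.ne_zero
  · intro a
    rw [hT, pauli_transpose, chi_label, map_smul, smul_mul_assoc, ← map_mul, ← map_mul]
    by_cases h : a = 0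
    · subst h
      simp [mink]
    · rw [pauli_anticomm a 0 h, map_neg]
      simp [mink, h]

/-- The skew-symmetrized product `Γ_{a₁ ⋯ a_p}`, with lower indices. -/
def MajoranaRep.gam (R : MajoranaRep) {p : ℕ} (a : Fin p → Fin 11) :
    Matrix (Fin 32) (Fin 32) ℝ :=
  ((p ! : ℕ) : ℝ)⁻¹ • ∑ τ : Equiv.Perm (Fin p),
    (((Equiv.Perm.sign τ : ℤˣ) : ℤ) : ℝ) • (List.ofFn fun i => R.Γ (a (τ i))).prod

/-- The spinor pairing `(χ̄ M ξ) = χ^α η_{αβ} (M ξ)^β` for spinors with components in a (super)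
algebra. -/
def MajoranaRep.pair (R : MajoranaRep) {A : Type} [Ring A] [Algebra ℝ A] (χ : Fin 32 → A)
    (M : Matrix (Fin 32) (Fin 32) ℝ) (ξ : Fin 32 → A) : A :=
  ∑ α, ∑ β, R.C α β • (χ α * ∑ κ, M β κ • ξ κ)

/-! ## The super-Minkowski algebra and the 4-flux -/

/-- Generators of `CE(ℝ^{1,10|32})`. -/
inductive MinkGen : Type
  | e (a : Fin 11)
  | psi (α : Fin 32)

/-- Super-degree of the generators of `CE(ℝ^{1,10|32})`. -/
def minkParity : MinkGen → ZMod 2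
  | .e _ => 0
  | .psi _ => 1

/-- The graded algebra `CE(ℝ^{1,10|32})`. -/
abbrev CEMink : Type := GradedPoly minkParity

/-- `G_4 = ½ (ψ̄ Γ_{a₁ a₂} ψ) e^{a₁} e^{a₂}`. -/
def G4 (R : MajoranaRep) : CEMink :=
  (1 / 2 : ℝ) • ∑ a₁ : Fin 11, ∑ a₂ : Fin 11,
    R.pair (fun α => gen minkParity (.psi α)) (R.gam ![a₁, a₂])
      (fun α => gen minkParity (.psi α)) * gen minkParity (.e a₁) * gen minkParity (.e a₂)

/-! ## The hidden M-algebra -/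

/-- Linearly independent generators of the CE-algebra of the hidden M-algebra: `e^a`, `e_{a₁ a₂}`
with `a₁ < a₂`, `e_{a₁ ⋯ a₅}` with `a₁ < ⋯ < a₅`, `ψ^α`, `φ^α`. -/
inductive HidGen : Type
  | e1 (a : Fin 11)
  | e2 (a : Fin 2 ↪o Fin 11)
  | e5 (a : Fin 5 ↪o Fin 11)
  | psi (α : Fin 32)
  | phi (α : Fin 32)

/-- Super-degree of the generators. -/
def hidParity : HidGen → ZMod 2
  | .e1 _ => 0
  | .e2 _ => 0
  | .e5 _ => 0
  | .psi _ => 1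
  | .phi _ => 1

/-- The graded algebra underlying the CE-algebra of the hidden M-algebra. -/
abbrev CEHid : Type := GradedPoly hidParity

/-- `e^a`, with upper index. -/
def e1 (a : Fin 11) : CEHid := gen hidParity (.e1 a)

/-- `e_{a₁ a₂} = e_{[a₁ a₂]}`, with lower indices. -/
def e2 (a : Fin 2 → Fin 11) : CEHid := skewExt (fun b => gen hidParity (.e2 b)) a

/-- `e_{a₁ ⋯ a₅} = e_{[a₁ ⋯ a₅]}`, with lower indices. -/
def e5 (a : Fin 5 → Fin 11) : CEHid := skewExt (fun b => gen hidParity (.e5 b)) a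

/-- `ψ^α`. -/
def psi (α : Fin 32) : CEHid := gen hidParity (.psi α)

/-- `φ^α`. -/
def phi (α : Fin 32) : CEHid := gen hidParity (.phi α)

/-- `δ(s) = 2 (1 + s)`. -/
def delta (s : ℝ) : ℝ := 2 * (1 + s)

/-- `γ₁(s) = 1`. -/
def gamma1 (_s : ℝ) : ℝ := 1

/-- `γ₂(s) = 2 (1/5! + s/6!)`. -/
def gamma2 (s : ℝ) : ℝ := 2 * (1 / ((5 ! : ℕ) : ℝ) + s / ((6 ! : ℕ) : ℝ))

/-- The differential of the hidden M-algebra at parameter `s` on generators: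
`d e^a = (ψ̄ Γ^a ψ)`, `d e_{a₁ a₂} = -(ψ̄ Γ_{a₁ a₂} ψ)`, `d e_{a₁ ⋯ a₅} = (ψ̄ Γ_{a₁ ⋯ a₅} ψ)`,
`d ψ = 0`,
`d φ = δ Γ_a ψ e^a + γ₁ Γ^{a₁ a₂} ψ e_{a₁ a₂} + γ₂ Γ^{a₁ ⋯ a₅} ψ e_{a₁ ⋯ a₅}`. -/
def hidD (R : MajoranaRep) (s : ℝ) : HidGen → CEHid
  | .e1 a => mink a • R.pair psi (R.Γ a) psi
  | .e2 a => -R.pair psi (R.gam a) psi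
  | .e5 a => R.pair psi (R.gam a) psi
  | .psi _ => 0
  | .phi α =>
      delta s • (∑ a : Fin 11, (∑ β, R.Γ a α β • psi β) * e1 a) +
      gamma1 s • (∑ a : Fin 2 → Fin 11, (∑ β, (raise a * R.gam a α β) • psi β) * e2 a) +
      gamma2 s • (∑ a : Fin 5 → Fin 11, (∑ β, (raise a * R.gam a α β) • psi β) * e5 a)

/-- `x` commutes with generators like an element of bidegree `(n, τ)`. -/
def CommLike (n : ℕ) (τ : ZMod 2) (x : CEHid) : Prop :=
  ∀ j, x * gen hidParity j = koszulSign (n, τ) (1, hidParity j) • (gen hidParity j * x)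

theorem CommLike.zero {n : ℕ} {τ : ZMod 2} : CommLike n τ 0 := fun j => by simp

theorem CommLike.smul {n : ℕ} {τ : ZMod 2} {x : CEHid} (h : CommLike n τ x) (c : ℝ) :
    CommLike n τ (c • x) := fun j => by
  rw [smul_mul_assoc, h j, mul_smul_comm, smul_comm]

theorem CommLike.neg {n : ℕ} {τ : ZMod 2} {x : CEHid} (h : CommLike n τ x) :
    CommLike n τ (-x) := fun j => by
  rw [neg_mul, h j, mul_neg, smul_neg]

theorem CommLike.add {n : ℕ} {τ : ZMod 2} {x y : CEHid} (hx : CommLike n τ x)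
    (hy : CommLike n τ y) : CommLike n τ (x + y) := fun j => by
  rw [add_mul, hx j, hy j, mul_add, smul_add]

theorem CommLike.sum {n : ℕ} {τ : ZMod 2} {κ : Type} (t : Finset κ) {x : κ → CEHid}
    (h : ∀ k, CommLike n τ (x k)) : CommLike n τ (∑ k ∈ t, x k) := fun j => by
  rw [Finset.sum_mul, Finset.mul_sum, Finset.smul_sum]
  exact Finset.sum_congr rfl fun k _ => h k j

theorem CommLike.mul {n m : ℕ} {τ υ ω : ZMod 2} {x y : CEHid} (hx : CommLike n τ x)
    (hy : CommLike m υ y) (hω : τ + υ = ω) : CommLike (n + m) ω (x * y) := fun j => by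
  rw [mul_assoc, hy j, mul_smul_comm, ← mul_assoc, hx j, smul_mul_assoc, smul_smul, mul_assoc]
  congr 1
  subst hω
  unfold koszulSign
  generalize hidParity j = ρ
  have key : ∀ τ υ ρ : ZMod 2,
      ((-1 : ℝ) ^ (υ.val * ρ.val)) * (-1) ^ (τ.val * ρ.val) = (-1) ^ ((τ + υ).val * ρ.val) := by
    intro τ υ ρ
    have hz : (0 : ZMod 2).val = 0 := rfl
    have ho : (1 : ZMod 2).val = 1 := rfl
    have ht : (1 + 1 : ZMod 2) = 0 := rfl
    have hc : ∀ x : ZMod 2, x = 0 ∨ x = 1 := by decide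
    rcases hc τ with rfl | rfl <;> rcases hc υ with rfl | rfl <;> rcases hc ρ with rfl | rfl <;>
      simp [hz, ho, ht]
  simp only [mul_one, pow_add, ← key τ υ ρ]
  ring

theorem CommLike.gen (i : HidGen) : CommLike 1 (hidParity i) (gen hidParity i) :=
  fun j => gen_mul_gen hidParity i j

theorem CommLike.skewExt {p n : ℕ} {τ : ZMod 2} {f : (Fin p ↪o Fin 11) → CEHid}
    (h : ∀ b, CommLike n τ (f b)) (a : Fin p → Fin 11) : CommLike n τ (skewExt f a) := by
  refine CommLike.sum _ fun σ => CommLike.sum _ fun b => ?_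
  split_ifs
  · rw [← Int.cast_smul_eq_zsmul ℝ]
    exact (h b).smul _
  · exact CommLike.zero

theorem CommLike.pair (R : MajoranaRep) (M : Matrix (Fin 32) (Fin 32) ℝ) :
    CommLike 2 0 (R.pair psi M psi) := by
  refine CommLike.sum _ fun α => CommLike.sum _ fun β => CommLike.smul ?_ _
  exact CommLike.mul (n := 1) (m := 1) (τ := 1) (υ := 1) (CommLike.gen (.psi α))
    (CommLike.sum _ fun κ => CommLike.smul (CommLike.gen (.psi κ)) _) (by decide)

theorem CommLike.psiMul (c : Fin 32 → ℝ) {y : CEHid} (hy : CommLike 1 0 y) :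
    CommLike 2 1 ((∑ β, c β • psi β) * y) :=
  CommLike.mul (n := 1) (m := 1) (τ := 1) (υ := 0)
    (CommLike.sum _ fun κ => CommLike.smul (CommLike.gen (.psi κ)) _) hy (by decide)

theorem hidD_degreeTwo (R : MajoranaRep) (s : ℝ) : DegreeTwo hidParity (hidD R s) := by
  intro i
  change CommLike 2 (hidParity i) (hidD R s i)
  cases i with
  | e1 a => exact (CommLike.pair R _).smul _
  | e2 a => exact (CommLike.pair R _).neg
  | e5 a => exact CommLike.pair R _
  | psi α => exact CommLike.zero
  | phi α =>
    refine ((CommLike.smul ?_ _).add (CommLike.smul ?_ _)).add (CommLike.smul ?_ _)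
    · exact CommLike.sum _ fun a => CommLike.psiMul _ (CommLike.gen (.e1 a))
    · exact CommLike.sum _ fun a =>
        CommLike.psiMul _ (CommLike.skewExt (fun b => CommLike.gen (.e2 b)) a)
    · exact CommLike.sum _ fun a =>
        CommLike.psiMul _ (CommLike.skewExt (fun b => CommLike.gen (.e5 b)) a)

/-- The Chevalley-Eilenberg differential of the hidden M-algebra at parameter `s`. -/
def hidDiff (R : MajoranaRep) (s : ℝ) : CEHid →ₗ[ℝ] CEHid :=
  gradedDeriv hidParity (hidD R s) (hidD_degreeTwo R s)

/-- The inclusion of generators of `CE(ℝ^{1,10|32})`. -/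
def inclGen : MinkGen → HidGen
  | .e a => .e1 a
  | .psi α => .psi α

/-- The pullback `φ_ex^* : CE(ℝ^{1,10|32}) → CE(hidden M-algebra)`, `e^a ↦ e^a`, `ψ^α ↦ ψ^α`. -/
def phiEx : CEMink →ₐ[ℝ] CEHid :=
  liftHom minkParity (fun i => gen hidParity (inclGen i)) (fun i j => by
    have h : ∀ k, hidParity (inclGen k) = minkParity k := by rintro (a | α) <;> rfl
    rw [← h i, ← h j]
    exact gen_mul_gen hidParity _ _)

/-- The ansatz
`α₀ e_{a₁a₂} e^{a₁} e^{a₂}`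
`+ α₁ e^{a₁}_{a₂} e^{a₂}_{a₃} e^{a₃}_{a₁}`
`+ α₂ e^{a₁⋯a₄b₁} e_{b₁}^{b₂} e_{b₂a₁⋯a₄}`
`+ α₃ ε_{a₁⋯a₅b₁⋯b₅c} e^{a₁⋯a₅} e^{b₁⋯b₅} e^c`
`+ α₄ ε_{a₁a₂a₃b₁b₂b₃c₁⋯c₅} e^{a₁a₂a₃d₁d₂} e_{d₁d₂}^{b₁b₂b₃} e^{c₁⋯c₅}`
`+ β₁ (ψ̄ Γ_a φ) e^a + β₂ (ψ̄ Γ_{a₁a₂} φ) e^{a₁a₂} + β₃ (ψ̄ Γ_{a₁⋯a₅} φ) e^{a₁⋯a₅}`. -/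
def P3 (R : MajoranaRep) (α₀ α₁ α₂ α₃ α₄ β₁ β₂ β₃ : ℝ) : CEHid :=
  α₀ • (∑ a₁ : Fin 11, ∑ a₂ : Fin 11, e2 ![a₁, a₂] * e1 a₁ * e1 a₂) +
  α₁ • (∑ a₁ : Fin 11, ∑ a₂ : Fin 11, ∑ a₃ : Fin 11,
    (mink a₁ • e2 ![a₁, a₂]) * (mink a₂ • e2 ![a₂, a₃]) * (mink a₃ • e2 ![a₃, a₁])) +
  α₂ • (∑ a : Fin 4 → Fin 11, ∑ b₁ : Fin 11, ∑ b₂ : Fin 11,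
    (raise (Fin.append a ![b₁]) • e5 (Fin.append a ![b₁])) *
      (mink b₂ • e2 ![b₁, b₂]) * e5 (Fin.append ![b₂] a)) +
  α₃ • (∑ a : Fin 5 → Fin 11, ∑ b : Fin 5 → Fin 11, ∑ c : Fin 11,
    levi (Fin.append (Fin.append a b) ![c]) •
      ((raise a • e5 a) * (raise b • e5 b) * e1 c)) +
  α₄ • (∑ a : Fin 3 → Fin 11, ∑ b : Fin 3 → Fin 11, ∑ c : Fin 5 → Fin 11,
    ∑ d : Fin 2 → Fin 11,
      levi (Fin.append (Fin.append a b) c) •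
        ((raise (Fin.append a d) • e5 (Fin.append a d)) *
          (raise b • e5 (Fin.append d b)) * (raise c • e5 c))) +
  β₁ • (∑ a : Fin 11, R.pair psi (R.Γ a) phi * e1 a) +
  β₂ • (∑ a : Fin 2 → Fin 11, R.pair psi (R.gam a) phi * (raise a • e2 a)) +
  β₃ • (∑ a : Fin 5 → Fin 11, R.pair psi (R.gam a) phi * (raise a • e5 a))

end

end HiddenM

open HiddenM

namespace HiddenM

/-! ## Products of Clifford generators -/

/-! Everything reduces to traces in the Clifford algebra. The products `R.gam x` of degree at most 5
form a trace-orthogonal basis of the 32 by 32 matrices (`completeness`). Since the components of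
`psi` commute, `(ψ̄ M ψ)` sees only the part of `M` for which `C M` is symmetric, that is degrees 1,
2 and 5. These are exactly the degrees of the bosonic generators, and the signs in their
differentials match the signs in the completeness relation. So every `(ψ̄ M ψ)` is a combination of
the `d X^x`, with coefficients `tr (M Γ_x)` (`bil_completeness`).

The five bosonic terms of the ansatz are, up to explicit factors, cubic invariants `tr(Γ_x Γ_y Γ_z)
X^x Y^y Z^z` (`P3_eq`); the Levi-Civita terms are of this kind because the product of all eleven
generators is 1. By cyclicity of the trace their differentials are sums of invariants `dcubic`, and
by completeness so are the terms `(ψ̄ Γ_x Γ_y ψ) X^x Y^y` produced by `d φ` and by the 4-flux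
(`quad_eq_dcubic`). The remaining terms `(ψ̄ Γ_x φ) d X^x` are all proportional to the one of degree
1 by two Fierz identities (`dmixed_form2`, `dmixed_form5`). Selection rules for traces of three
Clifford products leave nine invariants in `hidDiff_P3_sub`.

Vanishing coefficients suffice for the equation. Conversely, eight of the coefficients are forced to
vanish: an evaluation homomorphism into 4 by 4 matrices turns a linear relation between the
invariants into relations between real numbers, and generators whose index sets overlap in a
well-chosen number of places isolate one coefficient at a time. The coefficient of `dcubic R s form5
form1 form5` need not be isolated, because its vanishing follows from the other eight equations.
What remains is a linear system in eight unknowns; it reduces to two equations for `β₂` and `β₃`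
with determinant `-1200 s²`, which is where `s ≠ 0` enters. -/

theorem mink_mul_self (a : Fin 11) : mink a * mink a = 1 := by
  unfold mink; split_ifs <;> norm_num

theorem mink_ne_zero (a : Fin 11) : mink a ≠ 0 := by
  unfold mink; split_ifs <;> norm_num

theorem raise_mul_self {p : ℕ} (x : Fin p → Fin 11) : raise x * raise x = 1 := by
  simp [raise, ← Finset.prod_mul_distrib, mink_mul_self]

theorem raise_ne_zero {p : ℕ} (x : Fin p → Fin 11) : raise x ≠ 0 :=
  left_ne_zero_of_mul (b := raise x) (by rw [raise_mul_self]; exact one_ne_zero)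

theorem raise_comp {p : ℕ} (x : Fin p → Fin 11) (τ : Equiv.Perm (Fin p)) :
    raise (x ∘ τ) = raise x := Equiv.prod_comp τ fun i => mink (x i)

theorem raise_append {p q : ℕ} (x : Fin p → Fin 11) (y : Fin q → Fin 11) :
    raise (Fin.append x y) = raise x * raise y := by
  simp [raise, Fin.prod_univ_add]

theorem raise_one (a : Fin 11) : raise ![a] = mink a := by simp [raise]

theorem raise_two (a b : Fin 11) : raise ![a, b] = mink a * mink b := by
  simp [raise, Fin.prod_univ_two]

namespace MajoranaRep

variable (R : MajoranaRep)

theorem Γ_sq (a : Fin 11) : R.Γ a * R.Γ a = mink a • 1 := by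
  have h := R.clifford a a
  rw [if_pos rfl, ← two_smul ℝ, mul_smul] at h
  exact smul_right_injective _ (two_ne_zero' ℝ) h

theorem Γ_anticomm {a b : Fin 11} (h : a ≠ b) : R.Γ a * R.Γ b = -(R.Γ b * R.Γ a) := by
  have h' := R.clifford a b
  rw [if_neg h, zero_smul] at h'
  exact eq_neg_of_add_eq_zero_left h'

/-- The product `Γ_{a₁} ⋯ Γ_{a_p}`. -/
noncomputable def word (l : List (Fin 11)) : Matrix (Fin 32) (Fin 32) ℝ := (l.map R.Γ).prod

@[simp] theorem word_nil : R.word [] = 1 := rfl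

@[simp] theorem word_cons (a : Fin 11) (l : List (Fin 11)) :
    R.word (a :: l) = R.Γ a * R.word l := by simp [word]

theorem word_append (l m : List (Fin 11)) : R.word (l ++ m) = R.word l * R.word m := by
  simp [word]

/-- The sign picked up on moving `Γ_j` through `Γ_{a₁} ⋯ Γ_{a_p}`. -/
noncomputable def moveSign (j : Fin 11) (l : List (Fin 11)) : ℝ :=
  (l.map fun a => if a = j then (1 : ℝ) else -1).prod

theorem moveSign_nil (j : Fin 11) : moveSign j [] = 1 := rfl

theorem moveSign_cons (j a : Fin 11) (l : List (Fin 11)) :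
    moveSign j (a :: l) = (if a = j then 1 else -1) * moveSign j l := by simp [moveSign]

theorem Γ_mul_word (j : Fin 11) (l : List (Fin 11)) :
    R.Γ j * R.word l = moveSign j l • (R.word l * R.Γ j) := by
  induction l with
  | nil => simp [moveSign_nil]
  | cons a l ih =>
    have h : R.Γ j * R.Γ a = (if a = j then (1 : ℝ) else -1) • (R.Γ a * R.Γ j) := by
      split_ifs with h
      · rw [h, one_smul]
      · rw [R.Γ_anticomm (Ne.symm h), neg_one_smul]
    rw [word_cons, moveSign_cons, ← mul_assoc, h, smul_mul_assoc, mul_assoc, ih, mul_smul_comm,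
      smul_smul, mul_assoc]

theorem moveSign_of_nodup (j : Fin 11) {l : List (Fin 11)} (hl : l.Nodup) :
    moveSign j l = (-1) ^ l.length * if j ∈ l then -1 else 1 := by
  induction l with
  | nil => simp [moveSign_nil]
  | cons a l ih =>
    rw [List.nodup_cons] at hl
    rw [moveSign_cons, ih hl.2, List.length_cons, pow_succ]
    by_cases h : a = j
    · subst h
      simp [hl.1]
    · simp [h, Ne.symm h]

theorem word_mul_Γ (a : Fin 11) {l : List (Fin 11)} (h : a ∉ l) (hl : l.Nodup) :
    R.word l * R.Γ a = (-1 : ℝ) ^ l.length • (R.Γ a * R.word l) := by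
  rw [Γ_mul_word, moveSign_of_nodup a hl, if_neg h, mul_one, smul_smul, ← mul_pow]
  norm_num

theorem word_reverse {l : List (Fin 11)} (hl : l.Nodup) :
    R.word l.reverse = (-1 : ℝ) ^ (l.length * (l.length - 1) / 2) • R.word l := by
  induction l with
  | nil => simp
  | cons a l ih =>
    rw [List.nodup_cons] at hl
    rw [List.reverse_cons, word_append, ih hl.2, word_cons, word_nil, mul_one, smul_mul_assoc,
      R.word_mul_Γ a hl.1 hl.2, smul_smul, ← pow_add, List.length_cons, word_cons]
    congr 2
    rw [Nat.triangle_succ, add_comm]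

theorem word_mul_reverse (l : List (Fin 11)) :
    R.word l * R.word l.reverse = (l.map mink).prod • 1 := by
  induction l with
  | nil => simp
  | cons a l ih =>
    rw [List.reverse_cons, word_append, word_cons, ← mul_assoc, mul_assoc (R.Γ a), ih]
    simp [Γ_sq, smul_smul, mul_comm]

theorem word_transpose (l : List (Fin 11)) :
    (R.word l).transpose * R.C = (-1 : ℝ) ^ l.length • (R.C * R.word l.reverse) := by
  induction l with
  | nil => simp
  | cons a l ih =>
    rw [word_cons, Matrix.transpose_mul, mul_assoc, R.adjoint, mul_neg, ← mul_assoc, ih,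
      List.reverse_cons, word_append, List.length_cons, pow_succ]
    simp [mul_assoc]

/-- Injectivity makes the two neighbouring indices distinct, so the two adjacent generators
anticommute. The induction strips the first letter until the swap is at the front. -/
theorem word_swap {n : ℕ} (i : Fin n) (x : Fin (n + 1) → Fin 11) (hx : Function.Injective x) :
    R.word (List.ofFn (x ∘ Equiv.swap i.castSucc i.succ)) = -R.word (List.ofFn x) := by
  induction n with
  | zero => exact i.elim0
  | succ n ih =>
    refine Fin.cases ?_ (fun j => ?_) i
    · have h1 : (fun k : Fin n => (x ∘ Equiv.swap (Fin.castSucc 0) (Fin.succ (0 : Fin (n + 1))))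
          k.succ.succ) = fun k => x k.succ.succ := by
        funext k
        simp only [Function.comp]
        rw [Equiv.swap_apply_of_ne_of_ne]
        · simp [Fin.ext_iff]
        · simp [Fin.ext_iff]
      have h0 : (x ∘ Equiv.swap (Fin.castSucc 0) (Fin.succ (0 : Fin (n + 1)))) 0 = x 1 := by
        simp [Function.comp]
      have h2 : (x ∘ Equiv.swap (Fin.castSucc 0) (Fin.succ (0 : Fin (n + 1)))) (Fin.succ 0) = x 0 := by
        simp [Function.comp]
      rw [List.ofFn_succ, List.ofFn_succ, h1, h0, h2, List.ofFn_succ, List.ofFn_succ]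
      simp only [word_cons, ← mul_assoc]
      rw [R.Γ_anticomm (a := x 1) (b := x 0) (by
        intro h; have := hx h; simp at this), neg_mul]
      simp
    · have h0 : (x ∘ Equiv.swap j.succ.castSucc j.succ.succ) 0 = x 0 := by
        simp only [Function.comp]
        rw [Equiv.swap_apply_of_ne_of_ne]
        · simp [Fin.ext_iff]
        · simp [Fin.ext_iff]
      have h1 : (fun k => (x ∘ Equiv.swap j.succ.castSucc j.succ.succ) k.succ) =
          (fun k => x k.succ) ∘ Equiv.swap j.castSucc j.succ := by
        funext k
        simp only [Function.comp, Fin.castSucc_succ]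
        rw [Fin.succ_injective _ |>.swap_apply]
      rw [List.ofFn_succ (n := n + 1), List.ofFn_succ (f := x), h1, h0, word_cons, word_cons,
        ih j (fun k => x k.succ) (hx.comp (Fin.succ_injective _)), mul_neg]

/-- Adjacent transpositions generate the symmetric group, and each costs one sign. -/
theorem word_comp_perm {p : ℕ} (x : Fin p → Fin 11) (hx : Function.Injective x)
    (τ : Equiv.Perm (Fin p)) :
    R.word (List.ofFn (x ∘ τ)) = ((Equiv.Perm.sign τ : ℤ) : ℝ) • R.word (List.ofFn x) := by
  cases p with
  | zero =>
    have : τ = 1 := Subsingleton.elim _ _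
    simp [this]
  | succ n =>
    have hτ : τ ∈ Submonoid.closure
        (Set.range fun i : Fin n => Equiv.swap i.castSucc i.succ) := by
      rw [Equiv.Perm.mclosure_swap_castSucc_succ]; trivial
    induction hτ using Submonoid.closure_induction_left generalizing x with
    | one => simp
    | mul_left a ha b hb ih =>
      obtain ⟨i, rfl⟩ := ha
      rw [Equiv.Perm.coe_mul, ← Function.comp_assoc, ih _ (hx.comp (Equiv.injective _)),
        R.word_swap i x hx, map_mul, Equiv.Perm.sign_swap (by simp [Fin.ext_iff])]
      simp

end MajoranaRep
end HiddenM

namespace HiddenM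

/-! ## Skew-symmetrized products of Clifford generators -/

/-- The set of values of a multi-index. -/
def rng {p : ℕ} (x : Fin p → Fin 11) : Finset (Fin 11) := Finset.univ.image x

theorem mem_rng {p : ℕ} {x : Fin p → Fin 11} {j : Fin 11} : j ∈ rng x ↔ ∃ i, x i = j := by
  simp [rng]

theorem card_rng {p : ℕ} {x : Fin p → Fin 11} (hx : Function.Injective x) :
    (rng x).card = p := by
  rw [rng, Finset.card_image_of_injective _ hx, Finset.card_fin]

theorem rng_comp_perm {p : ℕ} (x : Fin p → Fin 11) (τ : Equiv.Perm (Fin p)) :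
    rng (x ∘ τ) = rng x := by
  ext j
  simp only [mem_rng, Function.comp]
  exact τ.exists_congr_left.trans (by simp)

theorem exists_perm_of_rng_subset {p : ℕ} {x w : Fin p → Fin 11} (hx : Function.Injective x)
    (h : rng x ⊆ rng w) : Function.Injective w ∧ ∃ τ : Equiv.Perm (Fin p), x = w ∘ τ := by
  have hc : p ≤ (rng w).card := (card_rng hx).symm.trans_le (Finset.card_le_card h)
  have hw : Function.Injective w := by
    have : (rng w).card = (Finset.univ : Finset (Fin p)).card :=
      le_antisymm Finset.card_image_le (by simpa using hc)
    exact fun a b hab => Finset.card_image_iff.1 this (Finset.mem_univ a) (Finset.mem_univ b) hab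
  have h' : ∀ i, ∃ k, w k = x i := fun i => mem_rng.1 (h (mem_rng.2 ⟨i, rfl⟩))
  choose f hf using h'
  have hfi : Function.Injective f := fun a b hab => hx (by rw [← hf, ← hf, hab])
  exact ⟨hw, Equiv.ofBijective f (Finite.injective_iff_bijective.1 hfi), funext fun i => (hf i).symm⟩

namespace MajoranaRep

variable (R : MajoranaRep)

theorem gam_of_injective {p : ℕ} {x : Fin p → Fin 11} (hx : Function.Injective x) :
    R.gam x = R.word (List.ofFn x) := by
  have h : ∀ τ : Equiv.Perm (Fin p), (((Equiv.Perm.sign τ : ℤˣ) : ℤ) : ℝ) •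
      (List.ofFn fun i => R.Γ (x (τ i))).prod = R.word (List.ofFn x) := by
    intro τ
    have h1 : (List.ofFn fun i => R.Γ (x (τ i))).prod = R.word (List.ofFn (x ∘ τ)) := by
      rw [word, List.map_ofFn]; rfl
    rw [h1, R.word_comp_perm x hx, smul_smul, ← Int.cast_mul, Int.units_coe_mul_self]
    simp
  rw [gam, Finset.sum_congr rfl fun τ _ => h τ, Finset.sum_const, Finset.card_univ,
    Fintype.card_perm, Fintype.card_fin, ← Nat.cast_smul_eq_nsmul ℝ, smul_smul,
    inv_mul_cancel₀ (by positivity), one_smul]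

theorem gam_comp_perm {p : ℕ} (x : Fin p → Fin 11) (σ : Equiv.Perm (Fin p)) :
    R.gam (x ∘ σ) = (((Equiv.Perm.sign σ : ℤˣ) : ℤ) : ℝ) • R.gam x := by
  rw [gam, gam, smul_comm _ ((p ! : ℕ) : ℝ)⁻¹]
  congr 1
  rw [Finset.smul_sum, ← Equiv.sum_comp (Equiv.mulLeft σ) fun τ => (((Equiv.Perm.sign σ : ℤˣ) : ℤ) : ℝ) •
    (((Equiv.Perm.sign τ : ℤˣ) : ℤ) : ℝ) • (List.ofFn fun i => R.Γ (x (τ i))).prod]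
  refine Finset.sum_congr rfl fun τ _ => ?_
  rw [smul_smul, Equiv.coe_mulLeft, Equiv.Perm.sign_mul, Units.val_mul, Int.cast_mul, ← mul_assoc,
    ← Int.cast_mul, Int.units_coe_mul_self]
  simp [Equiv.Perm.mul_apply]

theorem gam_of_not_injective {p : ℕ} {x : Fin p → Fin 11} (hx : ¬ Function.Injective x) :
    R.gam x = 0 := by
  obtain ⟨i, j, hij, hne⟩ := Function.not_injective_iff.1 hx
  have h := R.gam_comp_perm x (Equiv.swap i j)
  have hx' : x ∘ Equiv.swap i j = x := by
    funext k
    rw [Function.comp, Equiv.swap_apply_def]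
    split_ifs <;> simp_all
  rw [hx', Equiv.Perm.sign_swap hne] at h
  have h2 : (2 : ℝ) • R.gam x = 0 := by
    rw [two_smul]; nth_rewrite 1 [h]; simp
  simpa using h2

theorem gam_zero (x : Fin 0 → Fin 11) : R.gam x = 1 := by
  rw [R.gam_of_injective (Function.injective_of_subsingleton x)]; simp

theorem gam_one (x : Fin 1 → Fin 11) : R.gam x = R.Γ (x 0) := by
  rw [R.gam_of_injective (Function.injective_of_subsingleton x)]; simp

theorem gam_transpose {p : ℕ} (x : Fin p → Fin 11) :
    (R.gam x).transpose * R.C = (-1 : ℝ) ^ (p + p * (p - 1) / 2) • (R.C * R.gam x) := by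
  by_cases hx : Function.Injective x
  · rw [R.gam_of_injective hx, word_transpose, word_reverse _ (List.nodup_ofFn.2 hx),
      List.length_ofFn, mul_smul_comm, smul_smul, pow_add]
  · simp [R.gam_of_not_injective hx]

theorem gam_mul_self {p : ℕ} {x : Fin p → Fin 11} (hx : Function.Injective x) :
    R.gam x * R.gam x = ((-1 : ℝ) ^ (p * (p - 1) / 2) * raise x) • 1 := by
  have h := R.word_mul_reverse (List.ofFn x)
  rw [word_reverse _ (List.nodup_ofFn.2 hx), ← R.gam_of_injective hx, List.length_ofFn,
    mul_smul_comm, List.map_ofFn, List.prod_ofFn] at h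
  have h2 := congrArg (fun M => ((-1 : ℝ) ^ (p * (p - 1) / 2)) • M) h
  simp only [smul_smul, ← mul_pow] at h2
  rw [show (-1 : ℝ) * -1 = 1 by norm_num, one_pow, one_smul] at h2
  exact h2

theorem Γ_mul_gam (j : Fin 11) {p : ℕ} {x : Fin p → Fin 11} (hx : Function.Injective x) :
    R.Γ j * R.gam x = ((-1 : ℝ) ^ p * if j ∈ rng x then -1 else 1) • (R.gam x * R.Γ j) := by
  rw [R.gam_of_injective hx, Γ_mul_word, moveSign_of_nodup j (List.nodup_ofFn.2 hx),
    List.length_ofFn]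
  simp [mem_rng, List.mem_ofFn]

/-- Each conjugation by `Γ_a` is `±1` on `R.gam x`, with opposite signs for the `p` indices in `x`
and the `11 - p` others. The eigenvalues -9, 7, -1 in degrees 1, 2, 5 give the coefficients of the
vector Fierz identity. -/
theorem sum_conj_gam {p : ℕ} (x : Fin p → Fin 11) :
    ∑ a, mink a • (R.Γ a * R.gam x * R.Γ a) = ((-1 : ℝ) ^ p * (11 - 2 * p)) • R.gam x := by
  by_cases hx : Function.Injective x
  · have h : ∀ a, mink a • (R.Γ a * R.gam x * R.Γ a) =
        ((-1 : ℝ) ^ p * (1 - 2 * if a ∈ rng x then 1 else 0)) • R.gam x := by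
      intro a
      rw [R.Γ_mul_gam a hx, smul_mul_assoc, mul_assoc, Γ_sq, mul_smul_comm, mul_one, smul_smul,
        smul_smul, mul_comm (mink a), mul_assoc, mul_assoc, mink_mul_self, mul_one]
      congr 2
      split_ifs <;> norm_num
    rw [Finset.sum_congr rfl fun a _ => h a, ← Finset.sum_smul, ← Finset.mul_sum,
      Finset.sum_sub_distrib, ← Finset.mul_sum]
    simp [card_rng hx]
  · simp [R.gam_of_not_injective hx]

/-- The trace of `Γ_j M Γ_j` is `mink j * tr M` by cyclicity and `c` times that by the commutation
rule. -/
theorem trace_eq_zero_of_move {j : Fin 11} {M : Matrix (Fin 32) (Fin 32) ℝ} {c : ℝ}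
    (h : R.Γ j * M = c • (M * R.Γ j)) (hc : c ≠ 1) : M.trace = 0 := by
  have h1 : (R.Γ j * M * R.Γ j).trace = c * (M * (R.Γ j * R.Γ j)).trace := by
    rw [h, smul_mul_assoc, Matrix.trace_smul, mul_assoc, smul_eq_mul]
  rw [Matrix.trace_mul_comm, ← mul_assoc, Γ_sq, mul_smul_comm, smul_mul_assoc, one_mul, mul_one,
    Matrix.trace_smul, smul_eq_mul] at h1
  have h2 : (c - 1) * (mink j * M.trace) = 0 := by linear_combination -h1
  simpa [sub_eq_zero, hc, mink_ne_zero] using h2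

/-- `tr(Γ_x Γ_y Γ_z)`. -/
noncomputable def tri {p q r : ℕ} (x : Fin p → Fin 11) (y : Fin q → Fin 11) (z : Fin r → Fin 11) :
    ℝ := (R.gam x * R.gam y * R.gam z).trace

variable {R} {p q r : ℕ} {x : Fin p → Fin 11} {y : Fin q → Fin 11} {z : Fin r → Fin 11}

theorem tri_cyclic : R.tri x y z = R.tri y z x := by
  rw [tri, tri, mul_assoc, Matrix.trace_mul_comm]

theorem tri_injective (h : R.tri x y z ≠ 0) :
    Function.Injective x ∧ Function.Injective y ∧ Function.Injective z := by
  refine ⟨?_, ?_, ?_⟩ <;> by_contra hn <;> exact h (by simp [tri, R.gam_of_not_injective hn])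

/-- If the trace is non-zero, the total sign picked up by `Γ_j` on its way through all three factors
must be 1. This is the source of all selection rules below. -/
theorem tri_move (h : R.tri x y z ≠ 0) (j : Fin 11) :
    (-1 : ℝ) ^ (p + q + r) * ((if j ∈ rng x then -1 else 1) * (if j ∈ rng y then -1 else 1) *
      (if j ∈ rng z then -1 else 1)) = 1 := by
  obtain ⟨hx, hy, hz⟩ := tri_injective h
  by_contra hc
  refine h (R.trace_eq_zero_of_move (j := j) ?_ hc)
  rw [← mul_assoc, ← mul_assoc, R.Γ_mul_gam j hx, smul_mul_assoc, smul_mul_assoc, mul_assoc (R.gam x),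
    R.Γ_mul_gam j hy, mul_smul_comm, smul_mul_assoc, mul_assoc (R.gam x), mul_assoc (R.gam y),
    R.Γ_mul_gam j hz]
  simp only [mul_smul_comm, smul_smul, mul_assoc]
  congr 1
  ring

/-- For even total degree every `j` lies in an even number of the three index sets, so the third set
is the symmetric difference of the other two. -/
theorem mem_rng_of_tri_even (h : R.tri x y z ≠ 0) (hN : Even (p + q + r)) (j : Fin 11) :
    j ∈ rng z ↔ ¬ (j ∈ rng x ↔ j ∈ rng y) := by
  have := tri_move h j
  rw [hN.neg_one_pow, one_mul] at this
  by_cases hx : j ∈ rng x <;> by_cases hy : j ∈ rng y <;> by_cases hz : j ∈ rng z <;>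
    simp_all <;> norm_num at this

/-- For odd total degree every `j` lies in an odd number of the three index sets, so the third is
the complement of the symmetric difference. -/
theorem mem_rng_of_tri_odd (h : R.tri x y z ≠ 0) (hN : Odd (p + q + r)) (j : Fin 11) :
    j ∈ rng z ↔ (j ∈ rng x ↔ j ∈ rng y) := by
  have := tri_move h j
  rw [hN.neg_one_pow] at this
  by_cases hx : j ∈ rng x <;> by_cases hy : j ∈ rng y <;> by_cases hz : j ∈ rng z <;>
    simp_all <;> norm_num at this

/-- The number of common values of two multi-indices. -/
def overlap (x : Fin p → Fin 11) (y : Fin q → Fin 11) : ℕ := (rng x ∩ rng y).card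

theorem overlap_of_tri_even (h : R.tri x y z ≠ 0) (hN : Even (p + q + r)) :
    r + 2 * overlap x y = p + q := by
  obtain ⟨hx, hy, hz⟩ := tri_injective h
  have hs : rng z = (rng x \ rng y) ∪ (rng y \ rng x) := by
    ext j
    rw [mem_rng_of_tri_even h hN j, Finset.mem_union, Finset.mem_sdiff, Finset.mem_sdiff]
    tauto
  have hc := congrArg Finset.card hs
  rw [Finset.card_union_of_disjoint disjoint_sdiff_sdiff, card_rng hz] at hc
  have h1 := Finset.card_sdiff_add_card_inter (rng x) (rng y)
  have h2 := Finset.card_sdiff_add_card_inter (rng y) (rng x)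
  rw [Finset.inter_comm] at h2
  rw [card_rng hx] at h1
  rw [card_rng hy] at h2
  unfold overlap
  omega

theorem overlap_of_tri_odd (h : R.tri x y z ≠ 0) (hN : Odd (p + q + r)) :
    p + q + r = 11 + 2 * overlap x y := by
  obtain ⟨hx, hy, hz⟩ := tri_injective h
  have hs : (rng z)ᶜ = (rng x \ rng y) ∪ (rng y \ rng x) := by
    ext j
    rw [Finset.mem_compl, mem_rng_of_tri_odd h hN j, Finset.mem_union, Finset.mem_sdiff,
      Finset.mem_sdiff]
    tauto
  have hc := congrArg Finset.card hs
  rw [Finset.card_union_of_disjoint disjoint_sdiff_sdiff, Finset.card_compl, card_rng hz,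
    Fintype.card_fin] at hc
  have h0 : r ≤ 11 := by
    have := Finset.card_le_univ (rng z)
    rwa [card_rng hz, Fintype.card_fin] at this
  have h1 := Finset.card_sdiff_add_card_inter (rng x) (rng y)
  have h2 := Finset.card_sdiff_add_card_inter (rng y) (rng x)
  rw [Finset.inter_comm] at h2
  rw [card_rng hx] at h1
  rw [card_rng hy] at h2
  unfold overlap
  omega

end MajoranaRep
end HiddenM

/-! ### Completeness of the Clifford products of degree at most 5 -/

namespace HiddenM

/-- The support consists of rearrangements of `w`, all with the same value; if `w` has a repeated
entry, the support is empty. -/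
theorem sum_eq_factorial_nsmul {M : Type*} [AddCommMonoid M] {q : ℕ}
    (F : (Fin q → Fin 11) → M) (w : Fin q → Fin 11)
    (hinj : ∀ z, F z ≠ 0 → Function.Injective z)
    (hperm : ∀ z (τ : Equiv.Perm (Fin q)), F (z ∘ τ) = F z)
    (hs : ∀ z, F z ≠ 0 → rng z ⊆ rng w) : ∑ z, F z = (q !) • F w := by
  by_cases hw : Function.Injective w
  · have h1 : ∑ z ∈ Finset.univ.image (fun τ : Equiv.Perm (Fin q) => w ∘ τ), F z = ∑ z, F z := by
      refine Finset.sum_subset (Finset.subset_univ _) fun z _ hz => ?_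
      by_contra hne
      obtain ⟨_, τ, rfl⟩ := exists_perm_of_rng_subset (hinj z hne) (hs z hne)
      exact hz (Finset.mem_image_of_mem _ (Finset.mem_univ τ))
    rw [← h1, Finset.sum_image]
    · simp [hperm, Fintype.card_perm]
    · intro a _ b _ hab
      ext i
      exact congrArg Fin.val (hw (congrFun hab i))
  · have h0 : ∀ z, F z = 0 := fun z => by
      by_contra hne
      exact hw (exists_perm_of_rng_subset (hinj z hne) (hs z hne)).1
    simp [h0]

namespace MajoranaRep

variable (R : MajoranaRep)

/-- The sign in `Γ_x Γ_x = ± η^{x₁x₁} ⋯ η^{x_px_p}` for a multi-index of length `p`. -/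
def revSign (p : ℕ) : ℝ := (-1) ^ (p * (p - 1) / 2)

theorem revSign_mul_self (p : ℕ) : revSign p * revSign p = 1 := by
  rw [revSign, ← mul_pow]; norm_num

/-- The selection rules with an empty third index. The bound on `p + q` excludes the odd case, in
which the product of all eleven generators would relate complementary degrees. -/
theorem trace_gam_mul_gam_ne_zero {p q : ℕ} (hpq : p + q < 11) {x : Fin p → Fin 11}
    {y : Fin q → Fin 11} (h : (R.gam x * R.gam y).trace ≠ 0) :
    Function.Injective x ∧ Function.Injective y ∧ rng x = rng y := by
  have ht : R.tri x y Fin.elim0 ≠ 0 := by rwa [tri, gam_zero, mul_one]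
  obtain ⟨hx, hy, -⟩ := tri_injective ht
  refine ⟨hx, hy, ?_⟩
  rcases Nat.even_or_odd (p + q + 0) with hN | hN
  · ext j
    have := mem_rng_of_tri_even ht hN j
    have h0 : j ∉ rng (Fin.elim0 : Fin 0 → Fin 11) := by simp [mem_rng]
    tauto
  · have := overlap_of_tri_odd ht hN
    omega

theorem trace_gam_mul_self {p : ℕ} {x : Fin p → Fin 11} (hx : Function.Injective x) :
    (R.gam x * R.gam x).trace = 32 * (revSign p * raise x) := by
  rw [R.gam_mul_self hx, Matrix.trace_smul, Matrix.trace_one, Fintype.card_fin, revSign]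
  simp [mul_comm]

theorem rng_orderEmb_injective {p q : ℕ} (b : Fin p ↪o Fin 11) (c : Fin q ↪o Fin 11)
    (h : rng b = rng c) : (⟨p, b⟩ : Σ p, (Fin p ↪o Fin 11)) = ⟨q, c⟩ := by
  have hpq : p = q := by rw [← card_rng b.injective, h, card_rng c.injective]
  subst hpq
  congr 1
  have hb := Finset.orderEmbOfFin_unique' (card_rng b.injective) (f := b)
    (fun i => mem_rng.2 ⟨i, rfl⟩)
  have hc := Finset.orderEmbOfFin_unique' (card_rng b.injective) (f := c)
    (fun i => h ▸ mem_rng.2 ⟨i, rfl⟩)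
  rw [hb, hc]

theorem card_orderEmb (p n : ℕ) : Fintype.card (Fin p ↪o Fin n) = n.choose p := by
  rw [← Nat.card_eq_fintype_card, Nat.card_congr Set.powersetCard.ofFinEmbEquiv,
    Set.powersetCard.card, Nat.card_eq_fintype_card, Fintype.card_fin]

/-- The products are orthogonal for the trace form, with non-zero squares: two degrees at most 5 add
up to less than 11. -/
theorem linearIndependent_gam :
    LinearIndependent ℝ fun b : Σ p : Fin 6, (Fin p ↪o Fin 11) => R.gam b.2 := by
  rw [Fintype.linearIndependent_iff]
  intro g hg b
  have h1 := congrArg (fun M => (M * R.gam b.2).trace) hg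
  simp only [Finset.sum_mul, Matrix.trace_sum, smul_mul_assoc, Matrix.trace_smul, zero_mul,
    Matrix.trace_zero] at h1
  rw [Finset.sum_eq_single b] at h1
  · rw [R.trace_gam_mul_self b.2.injective] at h1
    simpa [raise_ne_zero, left_ne_zero_of_mul_eq_one (revSign_mul_self b.1)] using h1
  · intro c _ hc
    rw [smul_eq_zero]
    right
    by_contra hne
    have := (R.trace_gam_mul_gam_ne_zero (by omega) hne).2.2
    apply hc
    have h := rng_orderEmb_injective _ _ this
    obtain ⟨⟨p, hp⟩, c⟩ := c
    obtain ⟨⟨q, hq⟩, b⟩ := b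
    simp only [Sigma.mk.injEq] at h
    obtain ⟨rfl, h⟩ := h
    rw [eq_of_heq h]
  · simp

theorem span_gam :
    Submodule.span ℝ (Set.range fun b : Σ p : Fin 6, (Fin p ↪o Fin 11) => R.gam b.2) = ⊤ := by
  have : Nonempty (Σ p : Fin 6, (Fin p ↪o Fin 11)) := ⟨⟨0, Fin.castLEOrderEmb (Nat.zero_le 11)⟩⟩
  refine R.linearIndependent_gam.span_eq_top_of_card_eq_finrank ?_
  rw [Fintype.card_sigma, Module.finrank_matrix]
  simp only [card_orderEmb]
  -- The binomial coefficients add up to 1 + 11 + 55 + 165 + 330 + 462 = 1024 = 32².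
  simp [Fin.sum_univ_succ, Nat.choose]

/-- Both sides are linear in `M`, so it suffices to take `M` in the basis, where only the
rearrangements of one multi-index contribute. The factor `1 / p!` compensates for summing over all
multi-indices instead of increasing ones. -/
theorem completeness (M : Matrix (Fin 32) (Fin 32) ℝ) :
    M = ∑ p ∈ Finset.range 6, (1 / (32 * (p ! : ℕ)) : ℝ) • ∑ z : Fin p → Fin 11,
      (revSign p * raise z * (M * R.gam z).trace) • R.gam z := by
  have hM : M ∈ Submodule.span ℝ
      (Set.range fun b : Σ p : Fin 6, (Fin p ↪o Fin 11) => R.gam b.2) := by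
    rw [span_gam]; trivial
  induction hM using Submodule.span_induction with
  | mem M hM =>
    obtain ⟨⟨⟨p, hp⟩, b⟩, rfl⟩ := hM
    dsimp only at b ⊢
    rw [Finset.sum_eq_single p]
    · rw [sum_eq_factorial_nsmul _ (b : Fin p → Fin 11)]
      · rw [R.trace_gam_mul_self b.injective, ← Nat.cast_smul_eq_nsmul ℝ, smul_smul, smul_smul]
        have h : revSign p * raise b * (32 * (revSign p * raise b)) = 32 := by
          linear_combination 32 * raise b * raise b * revSign_mul_self p + 32 * raise_mul_self b
        rw [h]
        have : ((p ! : ℕ) : ℝ) ≠ 0 := by positivity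
        field_simp
        simp
      · intro z hz
        by_contra hn
        exact hz (by simp [R.gam_of_not_injective hn])
      · intro z τ
        rw [R.gam_comp_perm, raise_comp, mul_smul_comm, Matrix.trace_smul, smul_smul, smul_eq_mul]
        congr 1
        have : (((Equiv.Perm.sign τ : ℤˣ) : ℤ) : ℝ) * (((Equiv.Perm.sign τ : ℤˣ) : ℤ) : ℝ) = 1 := by
          rw [← Int.cast_mul, Int.units_coe_mul_self, Int.cast_one]
        linear_combination (revSign p * raise z * (R.gam b * R.gam z).trace) * this
      · intro z hz
        have hne : (R.gam b * R.gam z).trace ≠ 0 := fun h => hz (by simp [h])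
        exact (R.trace_gam_mul_gam_ne_zero (by omega) hne).2.2.symm.subset
    · intro q hq hqp
      rw [Finset.mem_range] at hq
      rw [Finset.sum_eq_zero, smul_zero]
      intro z _
      by_cases hne : (R.gam b * R.gam z).trace = 0
      · simp [hne]
      · obtain ⟨h1, h2, h3⟩ := R.trace_gam_mul_gam_ne_zero (by omega) hne
        exact absurd (by rw [← card_rng h2, ← h3, card_rng h1]) hqp
    · intro h
      exact absurd (Finset.mem_range.2 hp) h
  | zero => simp
  | add M N _ _ hM hN =>
    nth_rewrite 1 [hM, hN]
    simp only [add_mul, Matrix.trace_add, mul_add, add_smul, Finset.sum_add_distrib, smul_add]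
  | smul c M _ hM =>
    nth_rewrite 1 [hM]
    simp only [smul_mul_assoc, Matrix.trace_smul, Finset.smul_sum, smul_smul, smul_eq_mul]
    refine Finset.sum_congr rfl fun p _ => Finset.sum_congr rfl fun z _ => ?_
    congr 1
    ring

end MajoranaRep
end HiddenM

namespace HiddenM

/-! ## Commutation rules in the CE-algebra -/

theorem psi_mul_psi (α β : Fin 32) : psi α * psi β = psi β * psi α := by
  have h := gen_mul_gen hidParity (.psi α) (.psi β)
  have h1 : (1 : ZMod 2).val = 1 := rfl
  simp only [koszulSign, hidParity, h1] at h
  norm_num at h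
  exact h

/-- The span of the bosonic generators. -/
noncomputable def bosonic : Submodule ℝ CEHid :=
  Submodule.span ℝ (gen hidParity '' {i | hidParity i = 0})

theorem gen_mem_bosonic {i : HidGen} (hi : hidParity i = 0) : gen hidParity i ∈ bosonic :=
  Submodule.subset_span ⟨i, hi, rfl⟩

theorem bosonic_mul_gen {u : CEHid} (hu : u ∈ bosonic) (j : HidGen) :
    u * gen hidParity j = -(gen hidParity j * u) := by
  induction hu using Submodule.span_induction with
  | mem u hu =>
    obtain ⟨i, hi, rfl⟩ := hu
    have h := gen_mul_gen hidParity i j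
    rw [Set.mem_ofPred_eq] at hi
    simpa [koszulSign, hi] using h
  | zero => simp
  | add u v _ _ hu hv => rw [add_mul, hu, hv, mul_add, neg_add]
  | smul c u _ hu => rw [smul_mul_assoc, hu, mul_smul_comm, smul_neg]

theorem bosonic_mul_comm {u v : CEHid} (hu : u ∈ bosonic) (hv : v ∈ bosonic) :
    u * v = -(v * u) := by
  induction hv using Submodule.span_induction with
  | mem v hv =>
    obtain ⟨i, _, rfl⟩ := hv
    exact bosonic_mul_gen hu i
  | zero => simp
  | add v w _ _ hv hw => rw [mul_add, hv, hw, add_mul, neg_add]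
  | smul c v _ hv => rw [mul_smul_comm, hv, smul_mul_assoc, smul_neg]

theorem gradeInv_gen (i : HidGen) : gradeInv hidParity (gen hidParity i) = -gen hidParity i :=
  liftHom_gen hidParity _ _ i

theorem gradeInv_bosonic {u : CEHid} (hu : u ∈ bosonic) : gradeInv hidParity u = -u := by
  induction hu using Submodule.span_induction with
  | mem u hu =>
    obtain ⟨i, _, rfl⟩ := hu
    exact gradeInv_gen i
  | zero => simp
  | add u v _ _ hu hv => rw [map_add, hu, hv, neg_add]
  | smul c u _ hu => rw [map_smul, hu, smul_neg]

theorem CommLike.commute {x : CEHid} (hx : CommLike 2 0 x) (y : CEHid) : x * y = y * x := by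
  obtain ⟨y, rfl⟩ : ∃ z, quotHom hidParity z = y := RingQuot.mkAlgHom_surjective ℝ _ y
  induction y using FreeAlgebra.induction with
  | grade0 r => rw [AlgHom.commutes, Algebra.commutes]
  | grade1 i =>
    have h := hx i
    simp only [koszulSign, ZMod.val_zero] at h
    norm_num at h
    exact h
  | mul a b ha hb => rw [map_mul, ← mul_assoc, ha, mul_assoc, hb, mul_assoc]
  | add a b ha hb => rw [map_add, mul_add, ha, hb, add_mul]

/-! ### The spinor pairing and its symmetries -/

namespace MajoranaRep

variable (R : MajoranaRep)

theorem pair_eq {A : Type} [Ring A] [Algebra ℝ A] (χ ξ : Fin 32 → A)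
    (M : Matrix (Fin 32) (Fin 32) ℝ) :
    R.pair χ M ξ = ∑ α, ∑ κ, (R.C * M) α κ • (χ α * ξ κ) := by
  unfold pair
  refine Finset.sum_congr rfl fun α _ => ?_
  simp only [Finset.mul_sum, Finset.smul_sum, mul_smul_comm, smul_smul, Matrix.mul_apply,
    Finset.sum_smul]
  rw [Finset.sum_comm]

/-- The pairing `(χ̄ M ξ)` as a linear function of `M`. -/
noncomputable def pairLin (χ ξ : Fin 32 → CEHid) : Matrix (Fin 32) (Fin 32) ℝ →ₗ[ℝ] CEHid where
  toFun M := R.pair χ M ξ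
  map_add' M N := by
    simp only [pair_eq, mul_add, Matrix.add_apply, add_smul, Finset.sum_add_distrib]
  map_smul' c M := by
    simp only [pair_eq, mul_smul_comm, Matrix.smul_apply, smul_eq_mul, mul_smul, Finset.smul_sum,
      RingHom.id_apply]

theorem pairLin_apply (χ ξ : Fin 32 → CEHid) (M : Matrix (Fin 32) (Fin 32) ℝ) :
    R.pairLin χ ξ M = R.pair χ M ξ := rfl

/-- The quadratic form `(ψ̄ M ψ)`, linear in `M`. -/
noncomputable def bil : Matrix (Fin 32) (Fin 32) ℝ →ₗ[ℝ] CEHid := R.pairLin psi psi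

theorem bil_apply (M : Matrix (Fin 32) (Fin 32) ℝ) : R.bil M = R.pair psi M psi := rfl

theorem bil_commute (M : Matrix (Fin 32) (Fin 32) ℝ) (y : CEHid) :
    R.bil M * y = y * R.bil M := (CommLike.pair R M).commute y

/-- The components of `psi` commute with each other, so a skew coefficient matrix contributes
nothing. -/
theorem bil_eq_zero {M : Matrix (Fin 32) (Fin 32) ℝ}
    (h : (R.C * M).transpose = -(R.C * M)) : R.bil M = 0 := by
  have h1 : R.bil M = -R.bil M := by
    nth_rewrite 1 [bil_apply, pair_eq]
    rw [bil_apply, pair_eq, ← Finset.sum_neg_distrib]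
    conv_lhs => rw [Finset.sum_comm]
    refine Finset.sum_congr rfl fun α _ => ?_
    rw [← Finset.sum_neg_distrib]
    refine Finset.sum_congr rfl fun β _ => ?_
    have h' : (R.C * M) β α = -(R.C * M) α β := congrFun (congrFun h α) β
    rw [psi_mul_psi, h', neg_smul]
  have h2 : (2 : ℝ) • R.bil M = 0 := by
    rw [two_smul]; nth_rewrite 1 [h1]; simp
  simpa using h2

theorem C_mul_gam_transpose {p : ℕ} (x : Fin p → Fin 11) :
    (R.C * R.gam x).transpose = -((-1 : ℝ) ^ (p + p * (p - 1) / 2) • (R.C * R.gam x)) := by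
  rw [Matrix.transpose_mul, R.C_skew, mul_neg, gam_transpose]

/-- The condition on `p` for `C Γ_{a₁ ⋯ a_p}` to be symmetric. -/
def SymDegree (p : ℕ) : Prop := Odd (p + p * (p - 1) / 2)

theorem symDegree_one : SymDegree 1 := by unfold SymDegree; decide
theorem symDegree_two : SymDegree 2 := by unfold SymDegree; decide
theorem symDegree_five : SymDegree 5 := by unfold SymDegree; decide

variable {R} in
theorem bil_gam_eq_zero {p : ℕ} (hp : Even (p + p * (p - 1) / 2)) (x : Fin p → Fin 11) :
    R.bil (R.gam x) = 0 := by
  apply bil_eq_zero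
  rw [C_mul_gam_transpose, hp.neg_one_pow, one_smul]

theorem isUnit_C : IsUnit R.C.det := isUnit_iff_ne_zero.2 R.C_nondeg

/-- In these degrees transposition is conjugation by `C` with a minus sign. Transposing the triple
product reverses the order and gives three minus signs. -/
theorem tri_reverse {p q r : ℕ} (hp : SymDegree p) (hq : SymDegree q) (hr : SymDegree r)
    (x : Fin p → Fin 11) (y : Fin q → Fin 11) (z : Fin r → Fin 11) :
    R.tri x y z = -R.tri x z y := by
  have h : ∀ {n : ℕ} (_ : SymDegree n) (w : Fin n → Fin 11),
      (R.gam w).transpose * R.C = -(R.C * R.gam w) := fun hn w => by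
    rw [gam_transpose, hn.neg_one_pow, neg_one_smul]
  have h1 : (R.gam x * R.gam y * R.gam z).transpose * R.C =
      -(R.C * (R.gam z * R.gam y * R.gam x)) := by
    simp only [Matrix.transpose_mul, mul_assoc]
    rw [h hp, mul_neg, mul_neg, ← mul_assoc _ R.C, h hq, neg_mul, mul_neg, ← mul_assoc, ← mul_assoc,
      h hr]
    simp [mul_assoc]
  have h2 : (R.gam x * R.gam y * R.gam z).transpose =
      -(R.C * (R.gam z * R.gam y * R.gam x)) * R.C⁻¹ := by
    rw [← h1, Matrix.mul_nonsing_inv_cancel_right _ _ R.isUnit_C]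
  rw [tri, ← Matrix.trace_transpose, h2, neg_mul, Matrix.trace_neg, Matrix.trace_mul_comm,
    Matrix.nonsing_inv_mul_cancel_left _ _ R.isUnit_C, tri, Matrix.trace_mul_comm, mul_assoc]

end MajoranaRep

/-! ## Skew-symmetric families -/

theorem sign_mul_self {p : ℕ} (τ : Equiv.Perm (Fin p)) :
    (((Equiv.Perm.sign τ : ℤˣ) : ℤ) : ℝ) * (((Equiv.Perm.sign τ : ℤˣ) : ℤ) : ℝ) = 1 := by
  rw [← Int.cast_mul, Int.units_coe_mul_self, Int.cast_one]

/-- A family of elements indexed by multi-indices, skew-symmetric under permutations. -/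
def IsSkew {p : ℕ} {M : Type*} [AddCommGroup M] [Module ℝ M] (f : (Fin p → Fin 11) → M) : Prop :=
  ∀ x (τ : Equiv.Perm (Fin p)), f (x ∘ τ) = (((Equiv.Perm.sign τ : ℤˣ) : ℤ) : ℝ) • f x

theorem IsSkew.injective_of_ne_zero {p : ℕ} {M : Type*} [AddCommGroup M] [Module ℝ M]
    {f : (Fin p → Fin 11) → M} (hf : IsSkew f) {x : Fin p → Fin 11} (hx : f x ≠ 0) :
    Function.Injective x := by
  by_contra hn
  obtain ⟨i, j, hij, hne⟩ := Function.not_injective_iff.1 hn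
  have h := hf x (Equiv.swap i j)
  have hx' : x ∘ Equiv.swap i j = x := by
    funext k
    rw [Function.comp, Equiv.swap_apply_def]
    split_ifs <;> simp_all
  rw [hx', Equiv.Perm.sign_swap hne] at h
  have h2 : (2 : ℝ) • f x = 0 := by
    rw [two_smul]; nth_rewrite 1 [h]; simp
  exact hx (by simpa using h2)

theorem skewExt_isSkew {p : ℕ} {M : Type} [AddCommGroup M] [Module ℝ M]
    (f : (Fin p ↪o Fin 11) → M) : IsSkew (skewExt f) := by
  intro x σ
  simp only [skewExt, Finset.smul_sum]
  rw [← Equiv.sum_comp (Equiv.mulRight σ)]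
  refine Finset.sum_congr rfl fun τ _ => Finset.sum_congr rfl fun b _ => ?_
  have h : x ∘ σ = b ∘ (τ * σ) ↔ x = b ∘ τ := by
    rw [Equiv.Perm.coe_mul, ← Function.comp_assoc]
    exact σ.surjective.injective_comp_right.eq_iff
  simp only [Equiv.coe_mulRight, h]
  split_ifs
  · rw [← Int.cast_smul_eq_zsmul ℝ, ← Int.cast_smul_eq_zsmul ℝ, smul_smul, map_mul, Units.val_mul,
      mul_comm, Int.cast_mul]
  · simp

/-- An injective multi-index is a permutation of exactly one increasing one. This identifies the
differential of a skew extension with the Clifford family at every multi-index. -/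
theorem IsSkew.skewExt_eq {p : ℕ} {M : Type} [AddCommGroup M] [Module ℝ M]
    {f : (Fin p → Fin 11) → M} (hf : IsSkew f) : skewExt (fun b => f b) = f := by
  funext x
  by_cases hx : Function.Injective x
  · let b := (rng x).orderEmbOfFin (card_rng hx)
    have hb : rng x ⊆ rng b := by
      intro j hj
      have h : j ∈ Set.range b := by
        rw [Finset.range_orderEmbOfFin]; exact hj
      exact mem_rng.2 h
    obtain ⟨_, τ, hτ⟩ := exists_perm_of_rng_subset hx hb
    unfold skewExt
    rw [Finset.sum_eq_single τ, Finset.sum_eq_single b]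
    · rw [if_pos hτ]
      rw [hτ, hf, Int.cast_smul_eq_zsmul ℝ]
    · intro c _ hc
      rw [if_neg]
      rintro h
      refine hc (DFunLike.coe_injective ?_)
      exact τ.surjective.injective_comp_right (h.symm.trans hτ)
    · simp
    · intro σ _ hσ
      refine Finset.sum_eq_zero fun c _ => if_neg fun h => hσ ?_
      have hr : rng c = rng b := by
        rw [← rng_comp_perm c σ, ← h, hτ, rng_comp_perm]
      have hcb := MajoranaRep.rng_orderEmb_injective _ _ hr
      simp only [Sigma.mk.injEq, heq_eq_eq, true_and] at hcb
      ext i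
      rw [hcb, hτ] at h
      exact congrArg Fin.val (b.injective (congrFun h i)).symm
    · simp
  · have h1 := (skewExt_isSkew fun b : Fin p ↪o Fin 11 => f b).injective_of_ne_zero (x := x)
    have h2 := hf.injective_of_ne_zero (x := x)
    by_contra hne
    by_cases h : f x = 0
    · exact hx (h1 (h ▸ hne))
    · exact hx (h2 h)

theorem MajoranaRep.gam_isSkew (R : MajoranaRep) (p : ℕ) :
    IsSkew (fun x : Fin p → Fin 11 => R.gam x) := R.gam_comp_perm

end HiddenM

namespace HiddenM

/-! ## Sums over multi-indices -/

section Sums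
variable {M : Type*} [AddCommMonoid M]

theorem sum_multi_one (g : (Fin 1 → Fin 11) → M) : ∑ x, g x = ∑ a, g ![a] := by
  refine Fintype.sum_equiv (Equiv.funUnique (Fin 1) (Fin 11)) _ _ fun x => ?_
  congr 1
  funext i
  fin_cases i
  rfl

theorem sum_multi_append (p q : ℕ) (g : (Fin (p + q) → Fin 11) → M) :
    ∑ x, g x = ∑ a : Fin p → Fin 11, ∑ b : Fin q → Fin 11, g (Fin.append a b) := by
  rw [← Fintype.sum_prod_type']
  exact (Fintype.sum_equiv (Fin.appendEquiv p q) _ _ fun x => rfl).symm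

theorem sum_rotate {α β γ : Type*} [Fintype α] [Fintype β] [Fintype γ] (f : α → β → γ → M) :
    ∑ a, ∑ b, ∑ c, f a b c = ∑ b, ∑ c, ∑ a, f a b c := by
  rw [Finset.sum_comm]
  exact Finset.sum_congr rfl fun b _ => Finset.sum_comm

end Sums

/-! ## Bosonic one-forms with upper indices -/

noncomputable def form1 (x : Fin 1 → Fin 11) : CEHid := e1 (x 0)
noncomputable def form2 (x : Fin 2 → Fin 11) : CEHid := raise x • e2 x
noncomputable def form5 (x : Fin 5 → Fin 11) : CEHid := raise x • e5 x

/-- A skew-symmetric family of bosonic one-forms `X^{a₁ ⋯ a_p}` whose differential is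
`± (ψ̄ Γ^{a₁ ⋯ a_p} ψ)`. -/
structure IsForm (R : MajoranaRep) (s : ℝ) {p : ℕ} (X : (Fin p → Fin 11) → CEHid) : Prop where
  mem : ∀ x, X x ∈ bosonic
  skew : IsSkew X
  diff : ∀ x, hidDiff R s (X x) = (MajoranaRep.revSign p * raise x) • R.bil (R.gam x)

theorem skewExt_mem {p : ℕ} {f : (Fin p ↪o Fin 11) → CEHid} (hf : ∀ b, f b ∈ bosonic)
    (x : Fin p → Fin 11) : skewExt f x ∈ bosonic := by
  refine Submodule.sum_mem _ fun τ _ => Submodule.sum_mem _ fun b _ => ?_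
  split_ifs
  · rw [← Int.cast_smul_eq_zsmul ℝ]
    exact Submodule.smul_mem _ _ (hf b)
  · exact Submodule.zero_mem _

theorem map_skewExt {p : ℕ} {M N : Type} [AddCommGroup M] [AddCommGroup N] [Module ℝ M]
    [Module ℝ N] (L : M →ₗ[ℝ] N) (f : (Fin p ↪o Fin 11) → M) (x : Fin p → Fin 11) :
    L (skewExt f x) = skewExt (fun b => L (f b)) x := by
  simp only [skewExt, map_sum]
  refine Finset.sum_congr rfl fun τ _ => Finset.sum_congr rfl fun b _ => ?_
  split_ifs
  · rw [map_zsmul]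
  · rw [map_zero]

theorem IsSkew.raise_smul {p : ℕ} {M : Type*} [AddCommGroup M] [Module ℝ M]
    {f : (Fin p → Fin 11) → M} (hf : IsSkew f) : IsSkew fun x => raise x • f x := fun x τ => by
  change raise (x ∘ τ) • f (x ∘ τ) = _
  rw [hf x τ, raise_comp, smul_comm]

theorem IsSkew.map {p : ℕ} {M N : Type*} [AddCommGroup M] [AddCommGroup N] [Module ℝ M]
    [Module ℝ N] (L : M →ₗ[ℝ] N) {f : (Fin p → Fin 11) → M} (hf : IsSkew f) :
    IsSkew fun x => L (f x) := fun x τ => by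
  simp only [hf x τ, map_smul]

theorem isSkew_of_one {M : Type*} [AddCommGroup M] [Module ℝ M] (f : (Fin 1 → Fin 11) → M) :
    IsSkew f := fun x τ => by
  have : τ = 1 := Subsingleton.elim _ _
  simp [this]

variable (R : MajoranaRep) (s : ℝ)

theorem hidDiff_gen (i : HidGen) : hidDiff R s (gen hidParity i) = hidD R s i :=
  gradedDeriv_gen _ _ _ i

theorem hidDiff_mul (x y : CEHid) :
    hidDiff R s (x * y) = hidDiff R s x * y + gradeInv hidParity x * hidDiff R s y :=
  gradedDeriv_mul _ _ _ x y

theorem isForm_form1 : IsForm R s form1 where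
  mem x := gen_mem_bosonic rfl
  skew := isSkew_of_one _
  diff x := by
    have h := hidDiff_gen R s (.e1 (x 0))
    simp only [hidD] at h
    rw [form1, e1, h, R.gam_one, MajoranaRep.bil_apply]
    simp [MajoranaRep.revSign, raise]

/-- The minus sign in the differential of `e_{a₁a₂}` is precisely `revSign 2`; in degrees 1 and 5
that sign is +1. -/
theorem isForm_form2 : IsForm R s form2 where
  mem x := Submodule.smul_mem _ _ (skewExt_mem (fun b => gen_mem_bosonic rfl) x)
  skew := (skewExt_isSkew _).raise_smul
  diff x := by
    have h := map_skewExt (hidDiff R s) (fun b => gen hidParity (.e2 b)) x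
    simp only [hidDiff_gen, hidD] at h
    have h2 := ((R.gam_isSkew 2).map (-R.bil)).skewExt_eq
    rw [form2, map_smul, e2, h]
    have h3 := congrFun h2 x
    simp only [LinearMap.neg_apply, MajoranaRep.bil_apply] at h3
    rw [h3, MajoranaRep.bil_apply, smul_neg, ← neg_smul]
    congr 1
    norm_num [MajoranaRep.revSign]

theorem isForm_form5 : IsForm R s form5 where
  mem x := Submodule.smul_mem _ _ (skewExt_mem (fun b => gen_mem_bosonic rfl) x)
  skew := (skewExt_isSkew _).raise_smul
  diff x := by
    have h := map_skewExt (hidDiff R s) (fun b => gen hidParity (.e5 b)) x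
    simp only [hidDiff_gen, hidD] at h
    have h2 := ((R.gam_isSkew 5).map R.bil).skewExt_eq
    rw [form5, map_smul, e5, h]
    have h3 := congrFun h2 x
    simp only [MajoranaRep.bil_apply] at h3
    rw [h3, MajoranaRep.bil_apply]
    simp [MajoranaRep.revSign, show ((-1 : ℝ)) ^ (5 * 4 / 2) = 1 by norm_num]

/-! ## Invariant quadratic and cubic expressions -/

variable {p q r : ℕ} (X : (Fin p → Fin 11) → CEHid) (Y : (Fin q → Fin 11) → CEHid)
  (Z : (Fin r → Fin 11) → CEHid)

/-- `(ψ̄ Γ_x Γ_y ψ) X^x Y^y`. -/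
noncomputable def quad : CEHid := ∑ x, ∑ y, R.bil (R.gam x * R.gam y) * (X x * Y y)

/-- `tr(Γ_x Γ_y Γ_z) X^x Y^y Z^z`. -/
noncomputable def cubic : CEHid := ∑ x, ∑ y, ∑ z, R.tri x y z • (X x * (Y y * Z z))

/-- `tr(Γ_x Γ_y Γ_z) dX^x Y^y Z^z`. -/
noncomputable def dcubic : CEHid :=
  ∑ x, ∑ y, ∑ z, R.tri x y z • (hidDiff R s (X x) * (Y y * Z z))

/-- `(ψ̄ Γ_x φ) X^x`. -/
noncomputable def mixed : CEHid := ∑ x, R.pair psi (R.gam x) phi * X x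

/-- `(ψ̄ Γ_x φ) dX^x`. -/
noncomputable def dmixed : CEHid := ∑ x, R.pair psi (R.gam x) phi * hidDiff R s (X x)

variable {R s X Y Z}

theorem IsForm.commute (hX : IsForm R s X) (x : Fin p → Fin 11) (y : CEHid) :
    hidDiff R s (X x) * y = y * hidDiff R s (X x) := by
  rw [hX.diff, smul_mul_assoc, R.bil_commute, mul_smul_comm]

/-- Differentials of bosonic one-forms commute with everything, so each can be moved to the front.
The signs from the Leibniz rule and from reordering the one-forms combine to a cyclic rotation,
which the trace absorbs. -/
theorem hidDiff_cubic (hX : IsForm R s X) (hY : IsForm R s Y) (hZ : IsForm R s Z) :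
    hidDiff R s (cubic R X Y Z) = dcubic R s X Y Z + dcubic R s Y Z X + dcubic R s Z X Y := by
  have h : ∀ x y z, hidDiff R s (X x * (Y y * Z z)) = hidDiff R s (X x) * (Y y * Z z) +
      hidDiff R s (Y y) * (Z z * X x) + hidDiff R s (Z z) * (X x * Y y) := by
    intro x y z
    have e1 : X x * (hidDiff R s (Y y) * Z z) = -(hidDiff R s (Y y) * (Z z * X x)) := by
      rw [← mul_assoc, ← hY.commute, mul_assoc, bosonic_mul_comm (hX.mem x) (hZ.mem z), mul_neg]
    have e2 : X x * (Y y * hidDiff R s (Z z)) = hidDiff R s (Z z) * (X x * Y y) := by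
      rw [← mul_assoc, hZ.commute]
    rw [hidDiff_mul, hidDiff_mul, gradeInv_bosonic (hX.mem x), gradeInv_bosonic (hY.mem y), mul_add,
      neg_mul, neg_mul, neg_mul, mul_neg, e1, e2, neg_neg, neg_neg, add_assoc]
  have h1 : dcubic R s Y Z X =
      ∑ x, ∑ y, ∑ z, R.tri x y z • (hidDiff R s (Y y) * (Z z * X x)) := by
    rw [sum_rotate]
    simp only [dcubic, MajoranaRep.tri_cyclic (R := R) (p := p)]
  have h2 : dcubic R s Z X Y =
      ∑ x, ∑ y, ∑ z, R.tri x y z • (hidDiff R s (Z z) * (X x * Y y)) := by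
    rw [dcubic, sum_rotate]
    simp only [MajoranaRep.tri_cyclic (R := R) (p := r)]
  rw [h1, h2, dcubic]
  simp only [cubic, map_sum, map_smul, h, smul_add, Finset.sum_add_distrib]

/-- The sign from reversing the trace cancels the sign from exchanging two one-forms. -/
theorem dcubic_comm (hp : MajoranaRep.SymDegree p) (hq : MajoranaRep.SymDegree q)
    (hr : MajoranaRep.SymDegree r) (hY : IsForm R s Y) (hZ : IsForm R s Z) :
    dcubic R s X Z Y = dcubic R s X Y Z := by
  unfold dcubic
  refine Finset.sum_congr rfl fun x _ => ?_
  rw [Finset.sum_comm]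
  refine Finset.sum_congr rfl fun y _ => Finset.sum_congr rfl fun z _ => ?_
  rw [R.tri_reverse hp hr hq, bosonic_mul_comm (hZ.mem z) (hY.mem y), mul_neg, neg_smul_neg]

theorem dcubic_eq_zero (h : ∀ x y z, R.tri (p := p) (q := q) (r := r) x y z = 0) :
    dcubic R s X Y Z = 0 := by simp [dcubic, h]

theorem dcubic_eq_zero_of_odd (hN : Odd (p + q + r)) (hlt : p + q + r < 11) :
    dcubic R s X Y Z = 0 := by
  refine dcubic_eq_zero fun x y z => ?_
  by_contra h
  have := MajoranaRep.overlap_of_tri_odd h hN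
  omega

theorem dcubic_eq_zero_of_lt (hN : Even (p + q + r)) (hlt : q + r < p) :
    dcubic R s X Y Z = 0 := by
  refine dcubic_eq_zero fun x y z => ?_
  by_contra h
  rw [MajoranaRep.tri_cyclic] at h
  have := MajoranaRep.overlap_of_tri_even h (by rwa [add_comm, ← add_assoc])
  omega

/-- The completeness relation read inside `(ψ̄ · ψ)`: its coefficients `revSign p * raise z` are the
ones in the differentials of the one-forms, and the denominators are `32 * p!` for `p = 1, 2, 5`. -/
theorem bil_completeness (s : ℝ) (M : Matrix (Fin 32) (Fin 32) ℝ) :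
    R.bil M = (1 / 32 : ℝ) • ∑ x, (M * R.gam x).trace • hidDiff R s (form1 x) +
      (1 / 64 : ℝ) • ∑ x, (M * R.gam x).trace • hidDiff R s (form2 x) +
      (1 / 3840 : ℝ) • ∑ x, (M * R.gam x).trace • hidDiff R s (form5 x) := by
  nth_rewrite 1 [R.completeness M]
  simp only [Finset.sum_range_succ, Finset.sum_range_zero, map_add, map_smul, map_sum,
    (isForm_form1 R s).diff, (isForm_form2 R s).diff, (isForm_form5 R s).diff]
  -- Degrees 0, 3 and 4 drop out because `C Γ_z` is skew there.
  rw [show (∑ z : Fin 0 → Fin 11, (MajoranaRep.revSign 0 * raise z * (M * R.gam z).trace) •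
      R.bil (R.gam z)) = 0 from Finset.sum_eq_zero fun z _ => by
        rw [MajoranaRep.bil_gam_eq_zero (by decide), smul_zero],
    show (∑ z : Fin 3 → Fin 11, (MajoranaRep.revSign 3 * raise z * (M * R.gam z).trace) •
      R.bil (R.gam z)) = 0 from Finset.sum_eq_zero fun z _ => by
        rw [MajoranaRep.bil_gam_eq_zero (by decide), smul_zero],
    show (∑ z : Fin 4 → Fin 11, (MajoranaRep.revSign 4 * raise z * (M * R.gam z).trace) •
      R.bil (R.gam z)) = 0 from Finset.sum_eq_zero fun z _ => by
        rw [MajoranaRep.bil_gam_eq_zero (by decide), smul_zero]]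
  simp only [smul_smul, mul_comm (_ * raise _), Nat.factorial]
  norm_num

/-- `bil_completeness` for `M = Γ_y Γ_z`: the coefficient of `d X^x` is the cyclically rotated
triple trace. -/
theorem quad_eq_dcubic (R : MajoranaRep) (s : ℝ) (Y : (Fin q → Fin 11) → CEHid)
    (Z : (Fin r → Fin 11) → CEHid) :
    quad R Y Z = (1 / 32 : ℝ) • dcubic R s form1 Y Z + (1 / 64 : ℝ) • dcubic R s form2 Y Z +
      (1 / 3840 : ℝ) • dcubic R s form5 Y Z := by
  have h : ∀ {p : ℕ} (X : (Fin p → Fin 11) → CEHid), dcubic R s X Y Z =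
      ∑ y, ∑ z, (∑ x, (R.gam y * R.gam z * R.gam x).trace • hidDiff R s (X x)) * (Y y * Z z) := by
    intro p X
    rw [dcubic, sum_rotate]
    refine Finset.sum_congr rfl fun y _ => Finset.sum_congr rfl fun z _ => ?_
    rw [Finset.sum_mul]
    refine Finset.sum_congr rfl fun x _ => ?_
    rw [MajoranaRep.tri_cyclic, smul_mul_assoc]
    rfl
  rw [h form1, h form2, h form5]
  simp only [quad, Finset.smul_sum, ← Finset.sum_add_distrib, ← smul_mul_assoc, ← add_mul]
  refine Finset.sum_congr rfl fun y _ => Finset.sum_congr rfl fun z _ => ?_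
  rw [bil_completeness s]
  simp only [Finset.smul_sum]

theorem quad_comm (hq : MajoranaRep.SymDegree q) (hr : MajoranaRep.SymDegree r)
    (hY : IsForm R s Y) (hZ : IsForm R s Z) : quad R Z Y = quad R Y Z := by
  rw [quad_eq_dcubic R s, quad_eq_dcubic R s, dcubic_comm MajoranaRep.symDegree_one hq hr hY hZ,
    dcubic_comm MajoranaRep.symDegree_two hq hr hY hZ,
    dcubic_comm MajoranaRep.symDegree_five hq hr hY hZ]

end HiddenM

/-! ### Differentials of the mixed fermionic terms, and the 4-flux -/

namespace HiddenM

variable {R : MajoranaRep} {s : ℝ}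

theorem gradeInv_psi (α : Fin 32) : gradeInv hidParity (psi α) = -psi α := gradeInv_gen _

theorem gradeInv_phi (α : Fin 32) : gradeInv hidParity (phi α) = -phi α := gradeInv_gen _

variable (R) in
/-- `(Γ_x ψ)^κ X^x`. -/
noncomputable def spinor {p : ℕ} (X : (Fin p → Fin 11) → CEHid) (κ : Fin 32) : CEHid :=
  ∑ x, ∑ β, R.gam x κ β • (psi β * X x)

theorem hidDiff_phi (κ : Fin 32) : hidDiff R s (phi κ) =
    delta s • spinor R form1 κ + gamma1 s • spinor R form2 κ + gamma2 s • spinor R form5 κ := by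
  have h := hidDiff_gen R s (.phi κ)
  simp only [hidD] at h
  rw [phi, h]
  simp only [spinor]
  rw [sum_multi_one]
  simp only [R.gam_one, form1, form2, form5, Finset.sum_mul, smul_mul_assoc, mul_smul_comm,
    smul_smul, mul_comm (raise _)]
  rfl

/-- The sign arises from moving `u` in front of the one-form inside the spinor. It cancels the sign
in `hidDiff_pair`, so `quad` enters `hidDiff_mixed` positively. -/
theorem pair_mul_spinor {p : ℕ} {X : (Fin p → Fin 11) → CEHid} (hX : ∀ x, X x ∈ bosonic)
    (M : Matrix (Fin 32) (Fin 32) ℝ) {u : CEHid} (hu : u ∈ bosonic) :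
    R.pair psi M (spinor R X) * u = -∑ x, R.bil (M * R.gam x) * (u * X x) := by
  have h1 : ∀ x, R.bil (M * R.gam x) * (u * X x) =
      -∑ α, ∑ κ, ∑ β, ((R.C * M) α κ * R.gam x κ β) • (psi α * (psi β * X x) * u) := by
    intro x
    rw [R.bil_apply, R.pair_eq, bosonic_mul_comm hu (hX x), mul_neg, Finset.sum_mul]
    congr 1
    refine Finset.sum_congr rfl fun α _ => ?_
    rw [Finset.sum_comm, Finset.sum_mul]
    refine Finset.sum_congr rfl fun β _ => ?_
    rw [← mul_assoc R.C, Matrix.mul_apply, Finset.sum_smul, Finset.sum_mul]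
    refine Finset.sum_congr rfl fun κ _ => ?_
    rw [smul_mul_assoc]
    simp only [mul_assoc]
  rw [Finset.sum_congr rfl fun x _ => h1 x, Finset.sum_neg_distrib, neg_neg, R.pair_eq]
  simp only [spinor, Finset.sum_mul, Finset.mul_sum, Finset.smul_sum, smul_mul_assoc,
    mul_smul_comm, smul_smul]
  rw [sum_rotate]
  rw [sum_rotate, sum_rotate]

theorem pair_add_right {χ ξ ζ : Fin 32 → CEHid} (M : Matrix (Fin 32) (Fin 32) ℝ) :
    R.pair χ M (fun κ => ξ κ + ζ κ) = R.pair χ M ξ + R.pair χ M ζ := by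
  simp only [R.pair_eq, mul_add, smul_add, Finset.sum_add_distrib]

theorem pair_smul_right {χ ξ : Fin 32 → CEHid} (c : ℝ) (M : Matrix (Fin 32) (Fin 32) ℝ) :
    R.pair χ M (fun κ => c • ξ κ) = c • R.pair χ M ξ := by
  simp only [R.pair_eq, mul_smul_comm, Finset.smul_sum, smul_comm c]

theorem hidDiff_pair (M : Matrix (Fin 32) (Fin 32) ℝ) :
    hidDiff R s (R.pair psi M phi) = -R.pair psi M fun κ => hidDiff R s (phi κ) := by
  have h0 : ∀ α, hidDiff R s (psi α) = 0 := fun α => hidDiff_gen R s (.psi α)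
  simp only [R.pair_eq, map_sum, map_smul, hidDiff_mul, h0, gradeInv_psi, zero_mul, zero_add,
    neg_mul, smul_neg, Finset.sum_neg_distrib]

theorem gradeInv_pair (M : Matrix (Fin 32) (Fin 32) ℝ) :
    gradeInv hidParity (R.pair psi M phi) = R.pair psi M phi := by
  simp only [R.pair_eq, map_sum, map_smul, map_mul, gradeInv_psi, gradeInv_phi, neg_mul_neg]

theorem hidDiff_mixed {p : ℕ} {X : (Fin p → Fin 11) → CEHid} (hX : ∀ x, X x ∈ bosonic) :
    hidDiff R s (mixed R X) = delta s • quad R X form1 + gamma1 s • quad R X form2 +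
      gamma2 s • quad R X form5 + dmixed R s X := by
  simp only [mixed, map_sum, hidDiff_mul, hidDiff_pair, gradeInv_pair, hidDiff_phi, pair_add_right,
    pair_smul_right, neg_mul, add_mul, smul_mul_assoc]
  simp only [pair_mul_spinor (isForm_form1 R s).mem _ (hX _),
    pair_mul_spinor (isForm_form2 R s).mem _ (hX _),
    pair_mul_spinor (isForm_form5 R s).mem _ (hX _), smul_neg, ← neg_add, neg_neg,
    Finset.sum_add_distrib, ← Finset.smul_sum, quad, dmixed]

theorem gam_two {a b : Fin 11} (h : a ≠ b) : R.gam ![a, b] = R.Γ a * R.Γ b := by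
  have hi : Function.Injective ![a, b] := by
    intro i j
    fin_cases i <;> fin_cases j <;> simp [h, h.symm]
  rw [R.gam_of_injective hi]
  simp [List.ofFn_succ]

theorem bosonic_mul_self {u : CEHid} (hu : u ∈ bosonic) : u * u = 0 := by
  have h := bosonic_mul_comm hu hu
  have h2 : (2 : ℝ) • (u * u) = 0 := by
    rw [two_smul]; nth_rewrite 1 [h]; simp
  simpa using h2

theorem e1_mem (a : Fin 11) : e1 a ∈ bosonic := gen_mem_bosonic rfl

theorem phiEx_G4 : phiEx (G4 R) = (1 / 2 : ℝ) • quad R form1 form1 := by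
  have h1 : ∀ i, phiEx (gen minkParity i) = gen hidParity (inclGen i) := liftHom_gen _ _ _
  have h2 : ∀ M, phiEx (R.pair (fun α => gen minkParity (.psi α)) M
      (fun α => gen minkParity (.psi α))) = R.bil M := fun M => by
    simp only [R.pair_eq, R.bil_apply, map_sum, map_smul, map_mul, h1]
    rfl
  unfold G4 quad
  rw [map_smul]
  refine congrArg (fun x => (1 / 2 : ℝ) • x) ?_
  rw [map_sum]
  conv_rhs => rw [sum_multi_one]
  refine Finset.sum_congr rfl fun a _ => ?_
  rw [map_sum]
  conv_rhs => rw [sum_multi_one]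
  refine Finset.sum_congr rfl fun b _ => ?_
  rw [map_mul, map_mul, h1, h1, h2, R.gam_one, R.gam_one]
  change R.bil (R.gam ![a, b]) * e1 a * e1 b = R.bil (R.Γ a * R.Γ b) * (e1 a * e1 b)
  -- `Γ_{ab}` and `Γ_a Γ_b` differ only on the diagonal, where `e^a e^a = 0`.
  by_cases h : a = b
  · subst h
    rw [mul_assoc, bosonic_mul_self (e1_mem a), mul_zero, mul_zero]
  · rw [gam_two h, mul_assoc]

/-! ## The Fierz identity -/

theorem mul_single_mul_apply (A B : Matrix (Fin 32) (Fin 32) ℝ) (α β δ γ : Fin 32) :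
    (A * (Matrix.single β δ (1 : ℝ) * B) : Matrix (Fin 32) (Fin 32) ℝ) α γ = A α β * B δ γ := by
  rw [← mul_assoc, Matrix.mul_apply, Finset.sum_eq_single δ]
  · rw [Matrix.mul_single_apply_same, mul_one]
  · intro κ _ hκ
    rw [Matrix.mul_single_apply_of_ne _ _ _ _ _ hκ, zero_mul]
  · simp

/-- The two factors exchange one commuting `psi` each. The elementary matrix records the indices of
the `psi` and `phi` taken out, so that the rest is again of the form `(ψ̄ M ψ)` and completeness
applies. -/
theorem pair_mul_comm (K L : Matrix (Fin 32) (Fin 32) ℝ) :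
    R.bil K * R.pair psi L phi = ∑ β, ∑ δ,
      R.bil (K * Matrix.single β δ 1 * (R.C * L).transpose) * (psi β * phi δ) := by
  simp only [R.bil_apply, R.pair_eq, mul_assoc K, ← mul_assoc R.C K, mul_single_mul_apply, Finset.sum_mul,
    Matrix.transpose_apply]
  rw [Finset.sum_comm]
  refine Finset.sum_congr rfl fun β _ => ?_
  rw [sum_rotate]
  refine Finset.sum_congr rfl fun α _ => ?_
  rw [Finset.mul_sum]
  refine Finset.sum_congr rfl fun γ _ => ?_
  rw [Finset.mul_sum]
  refine Finset.sum_congr rfl fun δ _ => ?_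
  rw [smul_mul_smul_comm, smul_mul_assoc, mul_assoc, mul_assoc, ← mul_assoc (psi β), psi_mul_psi β,
    mul_assoc]

/-- Completeness is applied to the rearranged product; the trace against an elementary matrix is a
single matrix entry, and summing over entries rebuilds `(ψ̄ K Γ_x L φ)`. The constant `c` records
the symmetry type of `K`, needed to transpose it past `C`. -/
theorem fierz {K : Matrix (Fin 32) (Fin 32) ℝ} {c : ℝ} (hK : K.transpose * R.C = -(c • (R.C * K)))
    (L : Matrix (Fin 32) (Fin 32) ℝ) :
    R.bil K * R.pair psi L phi = c • (
      (1 / 32 : ℝ) • ∑ x, R.pair psi (K * R.gam x * L) phi * hidDiff R s (form1 x) +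
      (1 / 64 : ℝ) • ∑ x, R.pair psi (K * R.gam x * L) phi * hidDiff R s (form2 x) +
      (1 / 3840 : ℝ) • ∑ x, R.pair psi (K * R.gam x * L) phi * hidDiff R s (form5 x)) := by
  have h : ∀ {p : ℕ} (_ : MajoranaRep.SymDegree p) (x : Fin p → Fin 11) {D : CEHid}
      (_ : ∀ y, D * y = y * D), ∑ β, ∑ δ, ((K * Matrix.single β δ 1 * (R.C * L).transpose *
        R.gam x).trace • D) * (psi β * phi δ) = c • (R.pair psi (K * R.gam x * L) phi * D) := by
    intro p hp x D hD
    rw [R.pair_eq, Finset.sum_mul, Finset.smul_sum]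
    refine Finset.sum_congr rfl fun β _ => ?_
    rw [Finset.sum_mul, Finset.smul_sum]
    refine Finset.sum_congr rfl fun δ _ => ?_
    have h1 : (K * Matrix.single β δ 1 * (R.C * L).transpose * R.gam x).trace =
        c * (R.C * (K * R.gam x * L)) β δ := by
      have h2 : ((R.C * L).transpose * R.gam x * K).transpose = c • (R.C * (K * R.gam x * L)) := by
        have h3 := R.gam_transpose x
        rw [hp.neg_one_pow, neg_one_smul] at h3
        simp only [Matrix.transpose_mul, Matrix.transpose_transpose]
        rw [← mul_assoc (R.gam x).transpose, h3, neg_mul, mul_neg, ← mul_assoc, ← mul_assoc, hK]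
        simp [mul_assoc]
      rw [mul_assoc, mul_assoc, Matrix.trace_mul_comm, mul_assoc, Matrix.trace_single_mul, ← mul_assoc,
        ← Matrix.transpose_apply ((R.C * L).transpose * R.gam x * K), h2]
      simp only [Matrix.smul_apply, smul_eq_mul, one_mul, mul_assoc]
    rw [h1, smul_mul_assoc, smul_mul_assoc, hD, smul_smul]
  rw [pair_mul_comm]
  simp only [bil_completeness s (K * _ * _), add_mul, Finset.sum_add_distrib, smul_mul_assoc,
    ← Finset.smul_sum, Finset.sum_mul, smul_add]
  have h' : ∀ {p : ℕ} (_ : MajoranaRep.SymDegree p) {X : (Fin p → Fin 11) → CEHid}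
      (_ : IsForm R s X), ∑ β, ∑ δ, ∑ x, (K * Matrix.single β δ 1 * (R.C * L).transpose *
        R.gam x).trace • (hidDiff R s (X x) * (psi β * phi δ)) =
        c • ∑ x, R.pair psi (K * R.gam x * L) phi * hidDiff R s (X x) := by
    intro p hp X hX
    rw [← sum_rotate, Finset.smul_sum]
    refine Finset.sum_congr rfl fun x _ => ?_
    rw [← h hp x (hX.commute x)]
    simp only [smul_mul_assoc]
  rw [h' MajoranaRep.symDegree_one (isForm_form1 R s), h' MajoranaRep.symDegree_two (isForm_form2 R s),
    h' MajoranaRep.symDegree_five (isForm_form5 R s), smul_comm _ c, smul_comm _ c, smul_comm _ c]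

/-- The Fierz rearrangement with `K = L = 1`, whose left side vanishes because `C` is skew. -/
theorem fierz_one : (1 / 32 : ℝ) • dmixed R s form1 + (1 / 64 : ℝ) • dmixed R s form2 +
    (1 / 3840 : ℝ) • dmixed R s form5 = 0 := by
  have h := fierz (R := R) (s := s) (K := 1) (c := -1) (by simp) 1
  have h0 : R.bil 1 = 0 := R.bil_eq_zero (by rw [mul_one, R.C_skew])
  rw [h0, zero_mul] at h
  simp only [one_mul, mul_one, neg_one_smul] at h
  exact neg_eq_zero.1 h.symm

theorem sum_pair_conj {p : ℕ} (D : (Fin p → Fin 11) → CEHid) :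
    ∑ a, mink a • ∑ x, R.pair psi (R.Γ a * R.gam x * R.Γ a) phi * D x =
      ((-1 : ℝ) ^ p * (11 - 2 * p)) • ∑ x, R.pair psi (R.gam x) phi * D x := by
  simp only [Finset.smul_sum]
  rw [Finset.sum_comm]
  refine Finset.sum_congr rfl fun x _ => ?_
  have h := congrArg (R.pairLin psi phi) (R.sum_conj_gam x)
  simp only [map_sum, map_smul] at h
  simp only [R.pairLin_apply] at h
  simp only [← smul_mul_assoc, ← Finset.sum_mul, h]

/-- The Fierz rearrangement with `K = L = Γ_a`, contracted over `a`; the coefficients are the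
eigenvalues from `sum_conj_gam`. -/
theorem fierz_vector : dmixed R s form1 = (-9 / 32 : ℝ) • dmixed R s form1 +
    (7 / 64 : ℝ) • dmixed R s form2 + (-1 / 3840 : ℝ) • dmixed R s form5 := by
  have h : dmixed R s form1 = ∑ a, mink a • (R.bil (R.Γ a) * R.pair psi (R.Γ a) phi) := by
    rw [dmixed, sum_multi_one]
    refine Finset.sum_congr rfl fun a _ => ?_
    rw [(isForm_form1 R s).diff, R.gam_one, mul_smul_comm, R.bil_commute, raise_one]
    simp [MajoranaRep.revSign]
  have hK : ∀ a, (R.Γ a).transpose * R.C = -((1 : ℝ) • (R.C * R.Γ a)) := fun a => by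
    rw [one_smul, R.adjoint]
  nth_rewrite 1 [h]
  simp only [fierz (s := s) (hK _), one_smul, smul_add, Finset.sum_add_distrib, smul_comm (mink _),
    ← Finset.smul_sum, sum_pair_conj]
  simp only [smul_smul, dmixed]
  norm_num

/-- Adding the two Fierz relations eliminates degree 5. -/
theorem dmixed_form2 : dmixed R s form2 = (10 : ℝ) • dmixed R s form1 := by
  have h1 := fierz_one (R := R) (s := s)
  have h2 := fierz_vector (R := R) (s := s)
  linear_combination (norm := module) (8 : ℝ) • h1 - (8 : ℝ) • h2

theorem dmixed_form5 : dmixed R s form5 = (-720 : ℝ) • dmixed R s form1 := by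
  have h1 := fierz_one (R := R) (s := s)
  have h2 := dmixed_form2 (R := R) (s := s)
  linear_combination (norm := module) (3840 : ℝ) • h1 - (60 : ℝ) • h2

end HiddenM

namespace HiddenM

/-! ## Contraction of skew-symmetric sums -/

/-- A matching is the same as an injective list of `k` common values, each of which has a unique
position in `x` and in `y`. -/
theorem card_matchings {P Q : ℕ} (k : ℕ) {x : Fin P → Fin 11} {y : Fin Q → Fin 11}
    (hx : Function.Injective x) (hy : Function.Injective y) :
    Fintype.card {uv : (Fin k ↪ Fin P) × (Fin k ↪ Fin Q) // x ∘ uv.1 = y ∘ uv.2} =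
      (MajoranaRep.overlap x y).descFactorial k := by
  have hcard : Fintype.card (Fin k ↪ ↥(rng x ∩ rng y)) =
      (MajoranaRep.overlap x y).descFactorial k := by
    rw [Fintype.card_embedding_eq, Fintype.card_coe, Fintype.card_fin]; rfl
  rw [← hcard]
  let f : {uv : (Fin k ↪ Fin P) × (Fin k ↪ Fin Q) // x ∘ uv.1 = y ∘ uv.2} →
      (Fin k ↪ ↥(rng x ∩ rng y)) := fun uv =>
    ⟨fun i => ⟨x (uv.1.1 i), Finset.mem_inter.2 ⟨mem_rng.2 ⟨_, rfl⟩,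
      mem_rng.2 ⟨uv.1.2 i, (congrFun uv.2 i).symm⟩⟩⟩,
      fun i j hij => uv.1.1.injective (hx (congrArg Subtype.val hij))⟩
  refine Fintype.card_of_bijective (f := f) ⟨?_, ?_⟩
  · rintro ⟨⟨u, v⟩, h⟩ ⟨⟨u', v'⟩, h'⟩ he
    have hu : u = u' := by
      ext i
      have := congrArg Subtype.val (DFunLike.congr_fun he i)
      exact congrArg Fin.val (hx this)
    have hv : v = v' := by
      ext i
      refine congrArg Fin.val (hy ?_)
      have h1 := congrFun h i
      have h2 := congrFun h' i
      simp only [Function.comp] at h1 h2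
      rw [← h1, ← h2, hu]
    subst hu hv
    rfl
  · intro w
    have h1 : ∀ i, ∃ a, x a = (w i).1 := fun i => mem_rng.1 (Finset.mem_inter.1 (w i).2).1
    have h2 : ∀ i, ∃ a, y a = (w i).1 := fun i => mem_rng.1 (Finset.mem_inter.1 (w i).2).2
    choose u hu using h1
    choose v hv using h2
    have hui : Function.Injective u := fun i j h =>
      w.injective (Subtype.ext (by rw [← hu, ← hu, h]))
    have hvi : Function.Injective v := fun i j h =>
      w.injective (Subtype.ext (by rw [← hv, ← hv, h]))
    refine ⟨⟨⟨⟨u, hui⟩, ⟨v, hvi⟩⟩, funext fun i => ?_⟩, ?_⟩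
    · simp [hu, hv]
    · ext i
      exact congrArg Fin.val (hu i)

theorem exists_perm_extending {P k : ℕ} (u v : Fin k ↪ Fin P) :
    ∃ σ : Equiv.Perm (Fin P), ∀ i, σ (u i) = v i := by
  obtain ⟨σ, hσ⟩ := (Equiv.Perm.isMultiplyPretransitive (Fin P) k).exists_smul_eq u v
  exact ⟨σ, fun i => DFunLike.congr_fun hσ i⟩

/-- Double counting: each non-zero term is weighted by the number of ways to match `k` entries of
`x` with `k` entries of `y`, which depends only on the overlap `n`. By permutation symmetry every
choice of positions gives the same sum as matching the last `k` entries of `x` with the first `k` of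
`y`. This turns a full trace sum into one with explicitly contracted indices. -/
theorem sum_contract {M : Type*} [AddCommMonoid M] (p k q n : ℕ)
    (F : (Fin (p + k) → Fin 11) → (Fin (k + q) → Fin 11) → M)
    (hl : ∀ x y (τ : Equiv.Perm (Fin (p + k))), F (x ∘ τ) y = F x y)
    (hr : ∀ x y (τ : Equiv.Perm (Fin (k + q))), F x (y ∘ τ) = F x y)
    (hn : ∀ x y, F x y ≠ 0 →
      Function.Injective x ∧ Function.Injective y ∧ MajoranaRep.overlap x y = n) :
    n.descFactorial k • ∑ x, ∑ y, F x y =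
      ((p + k).descFactorial k * (k + q).descFactorial k) •
        ∑ a : Fin p → Fin 11, ∑ d : Fin k → Fin 11, ∑ b : Fin q → Fin 11,
          F (Fin.append a d) (Fin.append d b) := by
  have h1 : ∀ x y, n.descFactorial k • F x y =
      ∑ uv : (Fin k ↪ Fin (p + k)) × (Fin k ↪ Fin (k + q)),
        if x ∘ uv.1 = y ∘ uv.2 then F x y else 0 := by
    intro x y
    rw [← Finset.sum_filter, Finset.sum_const]
    by_cases h : F x y = 0
    · simp [h]
    · obtain ⟨hx, hy, hxy⟩ := hn x y h
      rw [← hxy, ← card_matchings k hx hy, Fintype.card_subtype]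
  have h2 : ∀ uv : (Fin k ↪ Fin (p + k)) × (Fin k ↪ Fin (k + q)),
      (∑ x, ∑ y, if x ∘ uv.1 = y ∘ uv.2 then F x y else 0) =
      ∑ a : Fin p → Fin 11, ∑ d : Fin k → Fin 11, ∑ b : Fin q → Fin 11,
          F (Fin.append a d) (Fin.append d b) := by
    rintro ⟨u, v⟩
    -- These permutations carry the standard positions to the positions `u` and `v`.
    obtain ⟨σ, hσ⟩ := exists_perm_extending (Fin.natAddEmb p) u
    obtain ⟨ρ, hρ⟩ := exists_perm_extending (Fin.castAddEmb q) v
    have h3 : (∑ x, ∑ y, if x ∘ u = y ∘ v then F x y else 0) =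
        ∑ x, ∑ y, if x ∘ Fin.natAdd p = y ∘ Fin.castAdd q then F x y else 0 := by
      refine Fintype.sum_equiv (Equiv.arrowCongr σ.symm (Equiv.refl _)) _ _ fun x => ?_
      refine Fintype.sum_equiv (Equiv.arrowCongr ρ.symm (Equiv.refl _)) _ _ fun y => ?_
      have hx : (Equiv.arrowCongr σ.symm (Equiv.refl (Fin 11))) x = x ∘ σ := rfl
      have hy : (Equiv.arrowCongr ρ.symm (Equiv.refl (Fin 11))) y = y ∘ ρ := rfl
      have hu : (x ∘ σ) ∘ Fin.natAdd p = x ∘ u := funext fun i => congrArg x (hσ i)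
      have hv : (y ∘ ρ) ∘ Fin.castAdd q = y ∘ v := funext fun i => congrArg y (hρ i)
      rw [hx, hy, hu, hv, hl, hr]
    rw [h3, sum_multi_append p k]
    refine Finset.sum_congr rfl fun a _ => Finset.sum_congr rfl fun d _ => ?_
    rw [sum_multi_append k q]
    have h4 : ∀ (d' : Fin k → Fin 11) (b : Fin q → Fin 11),
        (Fin.append a d ∘ Fin.natAdd p = Fin.append d' b ∘ Fin.castAdd q) ↔ d = d' := by
      intro d' b
      have e1 : Fin.append a d ∘ Fin.natAdd p = d := funext fun i => Fin.append_right a d i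
      have e2 : Fin.append d' b ∘ Fin.castAdd q = d' := funext fun i => Fin.append_left d' b i
      rw [e1, e2]
    simp only [h4]
    rw [Finset.sum_eq_single d]
    · simp
    · intro d' _ hd
      simp [Ne.symm hd]
    · simp
  simp only [Finset.smul_sum, h1]
  rw [← sum_rotate, Finset.sum_congr rfl fun uv _ => h2 uv, Finset.sum_const, Finset.card_univ,
    Fintype.card_prod, Fintype.card_embedding_eq, Fintype.card_embedding_eq]
  simp only [Fintype.card_fin, ← Finset.smul_sum]

section Cubic
variable {R : MajoranaRep} {s : ℝ} {p q r : ℕ}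

theorem MajoranaRep.tri_perm_left (x : Fin p → Fin 11) (y : Fin q → Fin 11) (z : Fin r → Fin 11)
    (τ : Equiv.Perm (Fin p)) :
    R.tri (x ∘ τ) y z = (((Equiv.Perm.sign τ : ℤˣ) : ℤ) : ℝ) * R.tri x y z := by
  simp only [tri, gam_comp_perm, smul_mul_assoc, Matrix.trace_smul, smul_eq_mul]

theorem MajoranaRep.tri_perm_mid (x : Fin p → Fin 11) (y : Fin q → Fin 11) (z : Fin r → Fin 11)
    (τ : Equiv.Perm (Fin q)) :
    R.tri x (y ∘ τ) z = (((Equiv.Perm.sign τ : ℤˣ) : ℤ) : ℝ) * R.tri x y z := by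
  rw [tri_cyclic, tri_perm_left, ← tri_cyclic]

theorem MajoranaRep.tri_perm_right (x : Fin p → Fin 11) (y : Fin q → Fin 11) (z : Fin r → Fin 11)
    (τ : Equiv.Perm (Fin r)) :
    R.tri x y (z ∘ τ) = (((Equiv.Perm.sign τ : ℤˣ) : ℤ) : ℝ) * R.tri x y z := by
  rw [← tri_cyclic, tri_perm_left, tri_cyclic]

theorem smul_smul_sign (τ : Equiv.Perm (Fin p)) (c : ℝ) (u : CEHid) :
    ((((Equiv.Perm.sign τ : ℤˣ) : ℤ) : ℝ) * c) • (((Equiv.Perm.sign τ : ℤˣ) : ℤ) : ℝ) • u =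
      c • u := by
  rw [smul_smul, mul_right_comm, sign_mul_self, one_mul]

theorem cubic_contract (k n : ℕ) {X : (Fin (p + k) → Fin 11) → CEHid}
    {Y : (Fin (k + q) → Fin 11) → CEHid} (hX : IsSkew X) (hY : IsSkew Y)
    (Z : (Fin r → Fin 11) → CEHid)
    (hn : ∀ (x : Fin (p + k) → Fin 11) (y : Fin (k + q) → Fin 11) (z : Fin r → Fin 11),
      R.tri x y z ≠ 0 → MajoranaRep.overlap x y = n) :
    n.descFactorial k • cubic R X Y Z =
      ((p + k).descFactorial k * (k + q).descFactorial k) •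
        ∑ a : Fin p → Fin 11, ∑ d : Fin k → Fin 11, ∑ b : Fin q → Fin 11, ∑ z,
          R.tri (Fin.append a d) (Fin.append d b) z •
            (X (Fin.append a d) * (Y (Fin.append d b) * Z z)) := by
  refine sum_contract p k q n (fun x y => ∑ z, R.tri x y z • (X x * (Y y * Z z))) ?_ ?_ ?_
  · intro x y τ
    refine Finset.sum_congr rfl fun z _ => ?_
    rw [MajoranaRep.tri_perm_left, hX, smul_mul_assoc, smul_smul_sign]
  · intro x y τ
    refine Finset.sum_congr rfl fun z _ => ?_
    rw [MajoranaRep.tri_perm_mid, hY, smul_mul_assoc, mul_smul_comm, smul_smul_sign]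
  · intro x y h
    obtain ⟨z, _, hz⟩ := Finset.exists_ne_zero_of_sum_ne_zero h
    have ht : R.tri x y z ≠ 0 := fun h0 => hz (by rw [h0, zero_smul])
    exact ⟨(MajoranaRep.tri_injective ht).1, (MajoranaRep.tri_injective ht).2.1, hn x y z ht⟩

/-- The selection rules fix `z` up to order once `x` and `y` are given; the signs of the trace and
of `Z` cancel under reordering. -/
theorem sum_tri_right (x : Fin p → Fin 11) (y : Fin q → Fin 11) {Z : (Fin r → Fin 11) → CEHid}
    (hZ : IsSkew Z) (u v : CEHid) (w : Fin r → Fin 11)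
    (hw : ∀ z : Fin r → Fin 11, R.tri x y z ≠ 0 → rng z ⊆ rng w) :
    ∑ z, R.tri x y z • (u * (v * Z z)) = (r ! : ℝ) • (R.tri x y w • (u * (v * Z w))) := by
  rw [Nat.cast_smul_eq_nsmul]
  refine sum_eq_factorial_nsmul (fun z => R.tri x y z • (u * (v * Z z))) w ?_ ?_ ?_
  · intro z hz
    exact (MajoranaRep.tri_injective (R := R) (x := x) (y := y)
      fun h0 => hz (by rw [h0, zero_smul])).2.2
  · intro z τ
    rw [MajoranaRep.tri_perm_right, hZ, mul_smul_comm, mul_smul_comm, smul_smul_sign]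
  · intro z hz
    exact hw z fun h0 => hz (by rw [h0, zero_smul])

end Cubic

end HiddenM

namespace HiddenM

/-! ## The cubic terms as invariant traces -/

theorem injective_append {p q : ℕ} {x : Fin p → Fin 11} {y : Fin q → Fin 11}
    (h : Function.Injective (Fin.append x y)) : Function.Injective x ∧ Function.Injective y :=
  ⟨fun i j hij => by
    have := h (a₁ := Fin.castAdd q i) (a₂ := Fin.castAdd q j) (by simpa using hij)
    simpa using this,
  fun i j hij => by
    have := h (a₁ := Fin.natAdd p i) (a₂ := Fin.natAdd p j) (by simpa using hij)
    simpa using this⟩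

theorem rng_append {p q : ℕ} (x : Fin p → Fin 11) (y : Fin q → Fin 11) :
    rng (Fin.append x y) = rng x ∪ rng y := by
  ext j
  simp only [mem_rng, Finset.mem_union]
  constructor
  · rintro ⟨i, hi⟩
    induction i using Fin.addCases with
    | left i => exact Or.inl ⟨i, by simpa using hi⟩
    | right i => exact Or.inr ⟨i, by simpa using hi⟩
  · rintro (⟨i, hi⟩ | ⟨i, hi⟩)
    · exact ⟨Fin.castAdd q i, by simpa using hi⟩
    · exact ⟨Fin.natAdd p i, by simpa using hi⟩

theorem rng_one (a : Fin 11) : rng ![a] = {a} := by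
  ext j; simp [mem_rng, eq_comm]

theorem rng_two (a b : Fin 11) : rng ![a, b] = {a, b} := by
  ext j; simp [mem_rng, Fin.exists_fin_two, eq_comm]

theorem append_one_one (a b : Fin 11) : Fin.append ![a] ![b] = ![a, b] := by
  funext i; fin_cases i <;> rfl

theorem injective_two {a b : Fin 11} : Function.Injective ![a, b] ↔ a ≠ b := by
  constructor
  · intro h hab
    have := h (a₁ := 0) (a₂ := 1) (by simpa using hab)
    simp at this
  · intro h i j
    fin_cases i <;> fin_cases j <;> simp [h, h.symm]

namespace MajoranaRep

variable {R : MajoranaRep} {p q r : ℕ}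

theorem gam_append {x : Fin p → Fin 11} {y : Fin q → Fin 11}
    (h : Function.Injective (Fin.append x y)) :
    R.gam (Fin.append x y) = R.gam x * R.gam y := by
  obtain ⟨hx, hy⟩ := injective_append h
  rw [R.gam_of_injective h, R.gam_of_injective hx, R.gam_of_injective hy, List.ofFn_fin_append,
    word_append]

theorem levi_perm (τ : Equiv.Perm (Fin 11)) : levi τ = ((Equiv.Perm.sign τ : ℤˣ) : ℤ) := by
  rw [levi, ← Matrix.det_permutation]
  congr 1
  ext i j
  simp [Equiv.toPEquiv_apply, PEquiv.toMatrix_apply, eq_comm]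

/-- The normalisation of the volume element turns the top Clifford product into the Levi-Civita
symbol. -/
theorem gam_eleven (w : Fin 11 → Fin 11) : R.gam w = levi w • 1 := by
  by_cases hw : Function.Injective w
  · obtain ⟨τ, rfl⟩ : ∃ τ : Equiv.Perm (Fin 11), ⇑τ = w :=
      ⟨Equiv.ofBijective w (Finite.injective_iff_bijective.1 hw), rfl⟩
    have h := R.word_comp_perm id Function.injective_id τ
    rw [R.gam_of_injective hw, levi_perm]
    have h1 : R.word (List.ofFn id) = 1 := by
      rw [word, List.map_ofFn]; exact R.volume
    rw [h1] at h
    exact h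
  · rw [R.gam_of_not_injective hw]
    obtain ⟨i, j, hij, hne⟩ := Function.not_injective_iff.1 hw
    rw [levi, Matrix.det_zero_of_row_eq hne (by funext k; simp [hij]), zero_smul]

theorem trace_one_32 : (1 : Matrix (Fin 32) (Fin 32) ℝ).trace = 32 := by
  rw [Matrix.trace_one, Fintype.card_fin]; norm_num

theorem tri_eq_levi (a : Fin 5 → Fin 11) (b : Fin 5 → Fin 11) (c : Fin 1 → Fin 11) :
    R.tri a b c = 32 * levi (Fin.append (Fin.append a b) c) := by
  have h11 := R.gam_eleven (Fin.append (Fin.append a b) c)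
  by_cases hw : Function.Injective (Fin.append (Fin.append a b) c)
  · rw [tri, ← gam_append (injective_append hw).1, ← gam_append hw]
    rw [h11, Matrix.trace_smul, trace_one_32, smul_eq_mul, mul_comm]
  · have hl : levi (Fin.append (Fin.append a b) c) = 0 := by
      rw [R.gam_of_not_injective hw] at h11
      have := congrArg Matrix.trace h11
      rw [Matrix.trace_smul, trace_one_32] at this
      simpa using this
    rw [hl, mul_zero]
    -- A non-zero trace of odd total degree forces every value to occur, and eleven entries covering
    -- eleven values are injective.
    by_contra ht
    apply hw
    rw [Finite.injective_iff_surjective (α := Fin 11)]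
    intro j
    rw [← mem_rng, rng_append, rng_append, Finset.mem_union, Finset.mem_union]
    have := mem_rng_of_tri_odd ht (by decide) j
    tauto

/-- The two adjacent factors `Γ_d` square to `-raise d`, leaving the Levi-Civita symbol of the
eleven free indices. -/
theorem tri_eq_levi_of_common {a : Fin 3 → Fin 11} {d : Fin 2 → Fin 11} {b : Fin 3 → Fin 11}
    (hx : Function.Injective (Fin.append a d)) (hy : Function.Injective (Fin.append d b))
    (c : Fin 5 → Fin 11) :
    R.tri (Fin.append a d) (Fin.append d b) c =
      -32 * raise d * levi (Fin.append (Fin.append a b) c) := by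
  have h11 := R.gam_eleven (Fin.append (Fin.append a b) c)
  by_cases hw : Function.Injective (Fin.append (Fin.append a b) c)
  · have hd := R.gam_mul_self (injective_append hx).2
    have h2 : R.gam (Fin.append a d) * R.gam (Fin.append d b) =
        -raise d • (R.gam a * R.gam b) := by
      rw [gam_append hx, gam_append hy, mul_assoc, ← mul_assoc (R.gam d), hd, smul_mul_assoc, one_mul,
        mul_smul_comm]
      norm_num
    rw [gam_append hw, gam_append (injective_append hw).1] at h11
    rw [tri, h2, smul_mul_assoc, h11, smul_smul, Matrix.trace_smul, trace_one_32, smul_eq_mul]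
    ring
  · have hl : levi (Fin.append (Fin.append a b) c) = 0 := by
      rw [R.gam_of_not_injective hw] at h11
      have := congrArg Matrix.trace h11
      rw [Matrix.trace_smul, trace_one_32] at this
      simpa using this
    rw [hl, mul_zero]
    by_contra ht
    apply hw
    rw [Finite.injective_iff_surjective (α := Fin 11)]
    intro j
    rw [← mem_rng, rng_append, rng_append, Finset.mem_union, Finset.mem_union]
    have := mem_rng_of_tri_odd ht (by decide) j
    rw [rng_append, rng_append, Finset.mem_union, Finset.mem_union] at this
    tauto

theorem tri_two_one_one {a b : Fin 11} (h : a ≠ b) :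
    R.tri ![a] ![b] ![a, b] = -32 * (mink a * mink b) := by
  have h1 := R.gam_mul_self (injective_two.2 h)
  rw [tri, R.gam_one, R.gam_one]
  have h2 : R.Γ (![a] 0) * R.Γ (![b] 0) = R.gam ![a, b] := (gam_two h).symm
  rw [h2, h1, Matrix.trace_smul, trace_one_32, raise_two]
  norm_num
  ring

theorem tri_triangle {a b c : Fin 11} (hab : a ≠ b) (hbc : b ≠ c) (hca : c ≠ a) :
    R.tri ![a, b] ![b, c] ![c, a] = 32 * (mink a * mink b * mink c) := by
  have h : R.Γ a * R.Γ b * (R.Γ b * R.Γ c) * (R.Γ c * R.Γ a) =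
      R.Γ a * (R.Γ b * R.Γ b) * (R.Γ c * R.Γ c) * R.Γ a := by simp only [mul_assoc]
  rw [tri, gam_two hab, gam_two hbc, gam_two hca, h, R.Γ_sq, R.Γ_sq]
  simp only [mul_smul_comm, smul_mul_assoc, mul_one, R.Γ_sq, Matrix.trace_smul, trace_one_32,
    smul_eq_mul]
  ring

theorem tri_five_two_five {a : Fin 4 → Fin 11} {b c : Fin 11}
    (hx : Function.Injective (Fin.append a ![b])) (hy : b ≠ c)
    (hz : Function.Injective (Fin.append ![c] a)) :
    R.tri (Fin.append a ![b]) ![b, c] (Fin.append ![c] a) =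
      32 * (raise a * mink b * mink c) := by
  have ha := R.gam_mul_self (injective_append hx).1
  have h : R.gam a * R.Γ b * (R.Γ b * R.Γ c) * (R.Γ c * R.gam a) =
      R.gam a * (R.Γ b * R.Γ b) * (R.Γ c * R.Γ c) * R.gam a := by simp only [mul_assoc]
  rw [tri, gam_append hx, gam_append hz, gam_two hy, R.gam_one, R.gam_one]
  simp only [Matrix.cons_val_zero]
  rw [h, R.Γ_sq, R.Γ_sq]
  simp only [mul_smul_comm, smul_mul_assoc, mul_one, ha, Matrix.trace_smul, trace_one_32,
    smul_eq_mul]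
  norm_num
  ring

end MajoranaRep
end HiddenM

/-! ### The ansatz rewritten through trace invariants -/

namespace HiddenM

variable {R : MajoranaRep} {s : ℝ}

theorem form2_skew : IsSkew form2 := (skewExt_isSkew _).raise_smul
theorem form5_skew : IsSkew form5 := (skewExt_isSkew _).raise_smul

theorem e2_mem (x : Fin 2 → Fin 11) : e2 x ∈ bosonic :=
  skewExt_mem (fun _ => gen_mem_bosonic rfl) x

theorem e2_eq_zero {a b : Fin 11} (h : a = b) : e2 ![a, b] = 0 := by
  by_contra hn
  exact injective_two.1 ((skewExt_isSkew _).injective_of_ne_zero hn) h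

theorem e5_eq_zero {x : Fin 5 → Fin 11} (h : ¬ Function.Injective x) : e5 x = 0 := by
  by_contra hn
  exact h ((skewExt_isSkew _).injective_of_ne_zero hn)

/-- The factor is `2! * (-32)`: the orderings of the third multi-index times the trace
`tri_two_one_one`. -/
theorem sum_e2_e1_e1 : ∑ a₁, ∑ a₂, e2 ![a₁, a₂] * e1 a₁ * e1 a₂ =
    (-1 / 64 : ℝ) • cubic R form1 form1 form2 := by
  unfold cubic
  rw [sum_multi_one, Finset.smul_sum]
  refine Finset.sum_congr rfl fun a _ => ?_
  rw [sum_multi_one, Finset.smul_sum]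
  refine Finset.sum_congr rfl fun b _ => ?_
  rw [sum_tri_right _ _ form2_skew _ _ ![a, b]]
  · by_cases hab : a = b
    · simp [form2, e2_eq_zero hab]
    · have h : e1 a * (e1 b * e2 ![a, b]) = e2 ![a, b] * e1 a * e1 b := by
        rw [bosonic_mul_comm (e1_mem b) (e2_mem _), mul_neg, ← mul_assoc,
          bosonic_mul_comm (e1_mem a) (e2_mem _), neg_mul, neg_neg]
      have hf : ∀ c, form1 ![c] = e1 c := fun c => rfl
      rw [MajoranaRep.tri_two_one_one hab, form2, raise_two, hf, hf, mul_smul_comm, mul_smul_comm,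
        h, smul_smul, smul_smul, smul_smul]
      have hm : -1 / 64 * (((2 ! : ℕ) : ℝ) * (-32 * (mink a * mink b) * (mink a * mink b))) = 1 := by
        have ha := mink_mul_self a
        have hb := mink_mul_self b
        norm_num [Nat.factorial]
        linear_combination mink b * mink b * ha + hb
      simp only [mul_assoc] at hm ⊢
      rw [hm, one_smul]
  · intro z hz j hj
    have := (MajoranaRep.mem_rng_of_tri_even hz (by decide) j).1 hj
    rw [rng_one, rng_one, Finset.mem_singleton, Finset.mem_singleton] at this
    rw [rng_two, Finset.mem_insert, Finset.mem_singleton]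
    tauto

/-- Here 256 = (2 * 2) * 2! * 32: positions for the contracted index, orderings of the third
multi-index, and the trace `tri_triangle`. -/
theorem sum_e2_e2_e2 : ∑ a₁, ∑ a₂, ∑ a₃,
    (mink a₁ • e2 ![a₁, a₂]) * (mink a₂ • e2 ![a₂, a₃]) * (mink a₃ • e2 ![a₃, a₁]) =
    (1 / 256 : ℝ) • cubic R form2 form2 form2 := by
  have h := cubic_contract (R := R) (p := 1) (q := 1) (r := 2) 1 1 (X := form2) (Y := form2)
    form2_skew form2_skew form2 (fun x y z hz => by
      have := MajoranaRep.overlap_of_tri_even hz (by decide)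
      omega)
  rw [show Nat.descFactorial 1 1 = 1 from rfl, one_smul, ← Nat.cast_smul_eq_nsmul ℝ] at h
  rw [h, smul_smul, sum_multi_one, Finset.smul_sum]
  refine Finset.sum_congr rfl fun a _ => ?_
  rw [sum_multi_one, Finset.smul_sum]
  refine Finset.sum_congr rfl fun b _ => ?_
  rw [sum_multi_one, Finset.smul_sum]
  refine Finset.sum_congr rfl fun c _ => ?_
  rw [append_one_one, append_one_one, sum_tri_right _ _ form2_skew _ _ ![c, a]]
  · by_cases hab : a = b
    · simp [form2, e2_eq_zero hab]
    by_cases hbc : b = c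
    · simp [form2, e2_eq_zero hbc]
    by_cases hca : c = a
    · simp [form2, e2_eq_zero hca]
    rw [MajoranaRep.tri_triangle hab hbc hca]
    simp only [form2, raise_two, smul_mul_assoc, mul_smul_comm, smul_smul, mul_assoc]
    refine congrArg (fun t : ℝ => t • _) ?_
    norm_num [Nat.factorial, Nat.descFactorial]
    have ha := mink_mul_self a
    have hb := mink_mul_self b
    have hc := mink_mul_self c
    linear_combination (-(mink a * mink b * mink c) * mink b * mink b * mink c * mink c) * ha -
      (mink a * mink b * mink c) * mink c * mink c * hb - (mink a * mink b * mink c) * hc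
  · intro z hz j hj
    have hi := MajoranaRep.tri_injective hz
    have := (MajoranaRep.mem_rng_of_tri_even hz (by decide) j).1 hj
    simp only [rng_two, Finset.mem_insert, Finset.mem_singleton] at this ⊢
    clear hz hi hj h
    tauto

/-- Here 38400 = (5 * 2) * 5! * 32, counted as in the preceding case. -/
theorem sum_e5_e2_e5 : ∑ a : Fin 4 → Fin 11, ∑ b₁ : Fin 11, ∑ b₂ : Fin 11,
    (raise (Fin.append a ![b₁]) • e5 (Fin.append a ![b₁])) *
      (mink b₂ • e2 ![b₁, b₂]) * e5 (Fin.append ![b₂] a) =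
    (1 / 38400 : ℝ) • cubic R form5 form2 form5 := by
  have h := cubic_contract (R := R) (p := 4) (q := 1) (r := 5) 1 1 (X := form5) (Y := form2)
    form5_skew form2_skew form5 (fun x y z hz => by
      have := MajoranaRep.overlap_of_tri_even hz (by decide)
      omega)
  rw [show Nat.descFactorial 1 1 = 1 from rfl, one_smul, ← Nat.cast_smul_eq_nsmul ℝ] at h
  rw [h, smul_smul, Finset.smul_sum]
  refine Finset.sum_congr rfl fun a _ => ?_
  rw [sum_multi_one, Finset.smul_sum]
  refine Finset.sum_congr rfl fun b _ => ?_
  rw [sum_multi_one, Finset.smul_sum]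
  refine Finset.sum_congr rfl fun c _ => ?_
  rw [append_one_one, sum_tri_right _ _ form5_skew _ _ (Fin.append ![c] a : Fin (1 + 4) → Fin 11)]
  · by_cases hx : Function.Injective (Fin.append a ![b])
    swap
    · simp [form5, e5_eq_zero hx]
    by_cases hbc : b = c
    · simp [form2, e2_eq_zero hbc]
    by_cases hz : Function.Injective (Fin.append ![c] a)
    swap
    · simp [form5, e5_eq_zero hz]
    rw [MajoranaRep.tri_five_two_five hx hbc hz]
    simp only [form2, form5, raise_two, smul_mul_assoc, mul_smul_comm, smul_smul, mul_assoc,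
      raise_append, raise_one]
    refine congrArg (fun t : ℝ => t • _) ?_
    norm_num [Nat.factorial, Nat.descFactorial]
    have ha := raise_mul_self a
    have hb := mink_mul_self b
    have hc := mink_mul_self c
    linear_combination (-(raise a * mink b * mink c) * mink b * mink b * mink c * mink c) * ha -
      (raise a * mink b * mink c) * mink c * mink c * hb - (raise a * mink b * mink c) * hc
  · intro z hz j hj
    have hi := MajoranaRep.tri_injective hz
    have := (MajoranaRep.mem_rng_of_tri_even hz (by decide) j).1 hj
    rw [rng_append, rng_one, rng_two] at this
    rw [rng_append, rng_one]
    simp only [Finset.mem_union, Finset.mem_insert, Finset.mem_singleton] at this ⊢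
    clear hz hi hj h
    tauto

theorem sum_levi_e5_e5_e1 : ∑ a : Fin 5 → Fin 11, ∑ b : Fin 5 → Fin 11, ∑ c : Fin 11,
    levi (Fin.append (Fin.append a b) ![c]) • ((raise a • e5 a) * (raise b • e5 b) * e1 c) =
    (1 / 32 : ℝ) • cubic R form5 form5 form1 := by
  simp only [cubic, Finset.smul_sum]
  refine Finset.sum_congr rfl fun a _ => Finset.sum_congr rfl fun b _ => ?_
  rw [sum_multi_one]
  refine Finset.sum_congr rfl fun c _ => ?_
  rw [MajoranaRep.tri_eq_levi, smul_smul, ← mul_assoc (form5 a), ← mul_assoc (1 / 32 : ℝ),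
    show (1 / 32 : ℝ) * 32 = 1 by norm_num, one_mul]
  rfl

/-- The odd selection rule `15 = 11 + 2n` gives overlap 2. Contracting both common indices gives `20
* 20 / 2 = 200`, and the trace contributes -32. -/
theorem sum_levi_e5_e5_e5 : ∑ a : Fin 3 → Fin 11, ∑ b : Fin 3 → Fin 11, ∑ c : Fin 5 → Fin 11,
    ∑ d : Fin 2 → Fin 11, levi (Fin.append (Fin.append a b) c) •
      ((raise (Fin.append a d) • e5 (Fin.append a d)) *
        (raise b • e5 (Fin.append d b)) * (raise c • e5 c)) =
    (-1 / 6400 : ℝ) • cubic R form5 form5 form5 := by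
  have h := cubic_contract (R := R) (p := 3) (q := 3) (r := 5) 2 2 (X := form5) (Y := form5)
    form5_skew form5_skew form5 (fun x y z hz => by
      have := MajoranaRep.overlap_of_tri_odd hz (by decide)
      omega)
  rw [← Nat.cast_smul_eq_nsmul ℝ, ← Nat.cast_smul_eq_nsmul ℝ] at h
  have h2 : cubic R form5 form5 form5 = (200 : ℝ) • ∑ a : Fin 3 → Fin 11, ∑ d : Fin 2 → Fin 11,
      ∑ b : Fin 3 → Fin 11, ∑ z, R.tri (Fin.append a d) (Fin.append d b) z •
        (form5 (Fin.append a d) * (form5 (Fin.append d b) * form5 z)) := by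
    have h3 := congrArg (fun u => (1 / 2 : ℝ) • u) h
    simp only [smul_smul] at h3
    norm_num [Nat.descFactorial] at h3
    exact h3
  rw [h2, smul_smul]
  simp only [Finset.smul_sum]
  refine Finset.sum_congr rfl fun a _ => ?_
  conv_rhs => rw [sum_rotate]
  refine Finset.sum_congr rfl fun b _ => Finset.sum_congr rfl fun c _ =>
    Finset.sum_congr rfl fun d _ => ?_
  by_cases hx : Function.Injective (Fin.append a d)
  swap
  · simp [form5, e5_eq_zero hx]
  by_cases hy : Function.Injective (Fin.append d b)
  swap
  · simp [form5, e5_eq_zero hy]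
  rw [MajoranaRep.tri_eq_levi_of_common hx hy]
  simp only [form5, smul_mul_assoc, mul_smul_comm, smul_smul, mul_assoc, raise_append]
  refine congrArg (fun t : ℝ => t • _) ?_
  have hd := raise_mul_self d
  linear_combination (-(levi (Fin.append (Fin.append a b) c)) * raise a * raise d * raise b *
    raise c) * hd

theorem P3_eq (α₀ α₁ α₂ α₃ α₄ β₁ β₂ β₃ : ℝ) : P3 R α₀ α₁ α₂ α₃ α₄ β₁ β₂ β₃ =
    α₀ • (-1 / 64 : ℝ) • cubic R form1 form1 form2 +
    α₁ • (1 / 256 : ℝ) • cubic R form2 form2 form2 +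
    α₂ • (1 / 38400 : ℝ) • cubic R form5 form2 form5 +
    α₃ • (1 / 32 : ℝ) • cubic R form5 form5 form1 +
    α₄ • (-1 / 6400 : ℝ) • cubic R form5 form5 form5 +
    β₁ • mixed R form1 + β₂ • mixed R form2 + β₃ • mixed R form5 := by
  rw [P3, sum_e2_e1_e1 (R := R), sum_e2_e2_e2 (R := R), sum_e5_e2_e5 (R := R),
    sum_levi_e5_e5_e1 (R := R), sum_levi_e5_e5_e5 (R := R)]
  have h : ∑ a : Fin 11, R.pair psi (R.Γ a) phi * e1 a = mixed R form1 := by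
    rw [mixed, sum_multi_one]
    simp only [R.gam_one]
    rfl
  rw [h]
  rfl

end HiddenM

namespace HiddenM

/-! ## Linear independence by evaluation in a fermionic matrix algebra -/

/-- Two anticommuting nilpotents and the parity operator on a two-mode Fock space. -/
def fockA : Matrix (Fin 4) (Fin 4) ℝ := !![0, 0, 0, 0; 1, 0, 0, 0; 0, 0, 0, 0; 0, 0, 1, 0]
def fockB : Matrix (Fin 4) (Fin 4) ℝ := !![0, 0, 0, 0; 0, 0, 0, 0; 1, 0, 0, 0; 0, -1, 0, 0]
def fockJ : Matrix (Fin 4) (Fin 4) ℝ := !![1, 0, 0, 0; 0, -1, 0, 0; 0, 0, -1, 0; 0, 0, 0, 1]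

theorem fockA_sq : fockA * fockA = 0 := by
  ext i j; fin_cases i <;> fin_cases j <;> simp [fockA, Matrix.mul_apply, Fin.sum_univ_four]
theorem fockB_sq : fockB * fockB = 0 := by
  ext i j; fin_cases i <;> fin_cases j <;> simp [fockB, Matrix.mul_apply, Fin.sum_univ_four]
theorem fockJ_sq : fockJ * fockJ = 1 := by
  ext i j; fin_cases i <;> fin_cases j <;> simp [fockJ, Matrix.mul_apply, Fin.sum_univ_four]
theorem fockB_mul_fockA : fockB * fockA = -(fockA * fockB) := by
  ext i j
  fin_cases i <;> fin_cases j <;> simp [fockA, fockB, Matrix.mul_apply, Fin.sum_univ_four]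
theorem fockA_mul_fockJ : fockA * fockJ = -(fockJ * fockA) := by
  ext i j
  fin_cases i <;> fin_cases j <;> simp [fockA, fockJ, Matrix.mul_apply, Fin.sum_univ_four]
theorem fockB_mul_fockJ : fockB * fockJ = -(fockJ * fockB) := by
  ext i j
  fin_cases i <;> fin_cases j <;> simp [fockB, fockJ, Matrix.mul_apply, Fin.sum_univ_four]
theorem fockA_mul_fockB_ne_zero : fockA * fockB ≠ 0 := fun h => by
  have := congrFun (congrFun h 3) 0
  simp [fockA, fockB, Matrix.mul_apply, Fin.sum_univ_four] at this

/-- The images of the generators. -/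
noncomputable def evalGen (t u : Fin 32 → ℝ) (v w : HidGen → ℝ) : HidGen → Matrix (Fin 4) (Fin 4) ℝ
  | .psi α => t α • fockJ
  | .phi α => u α • fockJ
  | g => v g • fockA + w g • fockB

theorem fock_mul (a b c d : ℝ) :
    (a • fockA + b • fockB) * (c • fockA + d • fockB) = (a * d - b * c) • (fockA * fockB) := by
  simp only [add_mul, mul_add, smul_mul_smul_comm, fockA_sq, fockB_sq, fockB_mul_fockA]
  module

theorem fock_mul_J (a b c : ℝ) :
    (a • fockA + b • fockB) * (c • fockJ) = -((c • fockJ) * (a • fockA + b • fockB)) := by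
  simp only [add_mul, mul_add, smul_mul_smul_comm, fockA_mul_fockJ, fockB_mul_fockJ]
  module

theorem evalGen_rel (t u : Fin 32 → ℝ) (v w : HidGen → ℝ) (i j : HidGen) :
    evalGen t u v w i * evalGen t u v w j =
      koszulSign (1, hidParity i) (1, hidParity j) • (evalGen t u v w j * evalGen t u v w i) := by
  have h00 : koszulSign (1, 0) (1, 0) = -1 := by simp [koszulSign]
  have h01 : koszulSign (1, 0) (1, 1) = -1 := by simp [koszulSign]
  have h10 : koszulSign (1, 1) (1, 0) = -1 := by simp [koszulSign]
  have h11 : koszulSign (1, 1) (1, 1) = 1 := by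
    simp [koszulSign, show (1 : ZMod 2).val = 1 from rfl]
  have hbb : ∀ a b c d : ℝ, (a • fockA + b • fockB) * (c • fockA + d • fockB) =
      -((c • fockA + d • fockB) * (a • fockA + b • fockB)) := fun a b c d => by
    rw [fock_mul, fock_mul, ← neg_smul]; congr 1; ring
  have hJJ : ∀ a b : ℝ, (a • fockJ) * (b • fockJ) = (b • fockJ) * (a • fockJ) := fun a b => by
    rw [smul_mul_smul_comm, smul_mul_smul_comm, mul_comm]
  have hJb : ∀ a b c : ℝ, (c • fockJ) * (a • fockA + b • fockB) =
      -((a • fockA + b • fockB) * (c • fockJ)) := fun a b c => by rw [fock_mul_J, neg_neg]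
  cases i <;> cases j <;>
    simp only [evalGen, hidParity, h00, h01, h10, h11, neg_one_smul, one_smul] <;>
    first | exact hbb _ _ _ _ | exact hJJ _ _ | exact fock_mul_J _ _ _ | exact hJb _ _ _

/-- Evaluation of CE-elements at `ψ = t J`, `φ = u J` and two fermionic directions. -/
noncomputable def eval (t u : Fin 32 → ℝ) (v w : HidGen → ℝ) :
    CEHid →ₐ[ℝ] Matrix (Fin 4) (Fin 4) ℝ :=
  liftHom hidParity (evalGen t u v w) (evalGen_rel t u v w)

theorem eval_gen (t u : Fin 32 → ℝ) (v w : HidGen → ℝ) (i : HidGen) :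
    eval t u v w (gen hidParity i) = evalGen t u v w i := liftHom_gen _ _ _ i

variable (R : MajoranaRep)

/-- The bilinear form `(t̄ M u)` on real spinors. -/
noncomputable def realPair (t u : Fin 32 → ℝ) (M : Matrix (Fin 32) (Fin 32) ℝ) : ℝ :=
  ∑ α, ∑ β, (R.C * M) α β * (t α * u β)

theorem realPair_smul (t u : Fin 32 → ℝ) (c : ℝ) (M : Matrix (Fin 32) (Fin 32) ℝ) :
    realPair R t u (c • M) = c * realPair R t u M := by
  simp only [realPair, mul_smul_comm, Matrix.smul_apply, smul_eq_mul, Finset.mul_sum, mul_assoc]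

section
variable (t u : Fin 32 → ℝ) (v w : HidGen → ℝ)

theorem eval_bil (M : Matrix (Fin 32) (Fin 32) ℝ) :
    eval t u v w (R.bil M) = realPair R t t M • 1 := by
  have h : ∀ α, eval t u v w (psi α) = t α • fockJ := fun α => eval_gen t u v w (.psi α)
  simp only [R.bil_apply, R.pair_eq, map_sum, map_smul, map_mul, h, smul_mul_smul_comm, fockJ_sq,
    realPair, Finset.sum_smul, smul_smul]

theorem eval_pair (M : Matrix (Fin 32) (Fin 32) ℝ) :
    eval t u v w (R.pair psi M phi) = realPair R t u M • 1 := by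
  have h : ∀ α, eval t u v w (psi α) = t α • fockJ := fun α => eval_gen t u v w (.psi α)
  have h' : ∀ α, eval t u v w (phi α) = u α • fockJ := fun α => eval_gen t u v w (.phi α)
  simp only [R.pair_eq, map_sum, map_smul, map_mul, h, h', smul_mul_smul_comm, fockJ_sq,
    realPair, Finset.sum_smul, smul_smul]

/-- The component of degree `p` of `N` in the Clifford basis, paired with a real spinor. -/
noncomputable def component (p : ℕ) (N : Matrix (Fin 32) (Fin 32) ℝ) : ℝ :=
  ∑ x : Fin p → Fin 11, MajoranaRep.revSign p * raise x * (R.gam x * N).trace *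
    realPair R t t (R.gam x)

theorem component_smul (p : ℕ) (c : ℝ) (N : Matrix (Fin 32) (Fin 32) ℝ) :
    component R t p (c • N) = c * component R t p N := by
  simp only [component, mul_smul_comm, Matrix.trace_smul, smul_eq_mul, Finset.mul_sum]
  exact Finset.sum_congr rfl fun x _ => by ring

theorem component_sub (p : ℕ) (M N : Matrix (Fin 32) (Fin 32) ℝ) :
    component R t p (M - N) = component R t p M - component R t p N := by
  simp only [component, mul_sub, Matrix.trace_sub, sub_mul, Finset.sum_sub_distrib]

/-- The completeness relation for real spinors, obtained by evaluating the one in the CE-algebra at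
`ψ = t J`. -/
theorem realPair_eq_component (N : Matrix (Fin 32) (Fin 32) ℝ) :
    realPair R t t N = 1 / 32 * component R t 1 N + 1 / 64 * component R t 2 N +
      1 / 3840 * component R t 5 N := by
  -- The parameter is set to 0 because the differentials of the bosonic generators do not involve
  -- `s`.
  have h := congrArg (fun x => eval t 0 0 0 x 0 0) (bil_completeness (R := R) 0 N)
  simp only [map_add, map_smul, map_sum, (isForm_form1 R 0).diff, (isForm_form2 R 0).diff,
    (isForm_form5 R 0).diff, eval_bil, Matrix.add_apply, Matrix.smul_apply, Matrix.sum_apply,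
    Matrix.one_apply_eq, smul_eq_mul, mul_one] at h
  rw [h]
  simp only [component, Matrix.trace_mul_comm N]
  congr 1
  · congr 1
    · congr 1
      exact Finset.sum_congr rfl fun x _ => by ring
    · congr 1
      exact Finset.sum_congr rfl fun x _ => by ring
  · congr 1
    exact Finset.sum_congr rfl fun x _ => by ring

/-- The Clifford matrix contracted with the coefficients of a family of one-forms. -/
noncomputable def coeffMatrix {p : ℕ} (V : (Fin p → Fin 11) → ℝ) : Matrix (Fin 32) (Fin 32) ℝ :=
  ∑ x, V x • R.gam x

variable {R t u v w}

/-- Only mixed products of the two nilpotent directions survive, so the invariant becomes an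
antisymmetrised product of coefficient matrices, projected to degree `p`. -/
theorem eval_dcubic {s : ℝ} {p q r : ℕ} {X : (Fin p → Fin 11) → CEHid}
    {Y : (Fin q → Fin 11) → CEHid} {Z : (Fin r → Fin 11) → CEHid} (hX : IsForm R s X)
    {V W : (Fin q → Fin 11) → ℝ} {V' W' : (Fin r → Fin 11) → ℝ}
    (hY : ∀ y, eval t u v w (Y y) = V y • fockA + W y • fockB)
    (hZ : ∀ z, eval t u v w (Z z) = V' z • fockA + W' z • fockB) :
    eval t u v w (dcubic R s X Y Z) =
      component R t p (coeffMatrix R V * coeffMatrix R W' - coeffMatrix R W * coeffMatrix R V') •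
        (fockA * fockB) := by
  have h : ∀ x : Fin p → Fin 11, (R.gam x * (coeffMatrix R V * coeffMatrix R W' -
      coeffMatrix R W * coeffMatrix R V')).trace =
      ∑ y, ∑ z, R.tri x y z * (V y * W' z - W y * V' z) := by
    intro x
    simp only [coeffMatrix, Finset.sum_mul, Finset.mul_sum, mul_sub, Matrix.trace_sub,
      Matrix.trace_sum, smul_mul_assoc, mul_smul_comm, Matrix.trace_smul, ← mul_assoc,
      smul_eq_mul, Finset.sum_sub_distrib, MajoranaRep.tri]
    congr 1
    · rw [Finset.sum_comm]
      exact Finset.sum_congr rfl fun y _ => Finset.sum_congr rfl fun z _ => by ring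
    · rw [Finset.sum_comm]
      exact Finset.sum_congr rfl fun y _ => Finset.sum_congr rfl fun z _ => by ring
  simp only [dcubic, map_sum, map_smul, map_mul, hX.diff, eval_bil, hY, hZ, fock_mul, component, h,
    Finset.mul_sum, Finset.sum_mul, Finset.sum_smul, smul_mul_assoc, one_mul, smul_smul]
  refine Finset.sum_congr rfl fun x _ => Finset.sum_congr rfl fun y _ =>
    Finset.sum_congr rfl fun z _ => ?_
  refine congrArg (fun c : ℝ => c • (fockA * fockB)) ?_
  ring

end

/-- Each increasing multi-index is met `p!` times, the sign of the extension cancelling the sign of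
the Clifford product. -/
theorem sum_skewExt {p : ℕ} (f : (Fin p ↪o Fin 11) → ℝ) :
    coeffMatrix R (fun x => raise x * skewExt f x) =
      (p ! : ℝ) • ∑ b : Fin p ↪o Fin 11, (raise b * f b) • R.gam b := by
  simp only [coeffMatrix, skewExt, Finset.mul_sum, Finset.sum_smul]
  rw [sum_rotate]
  have h : ∀ τ : Equiv.Perm (Fin p), ∀ b : Fin p ↪o Fin 11, ∑ x : Fin p → Fin 11,
      (raise x * if x = b ∘ τ then ((Equiv.Perm.sign τ : ℤˣ) : ℤ) • f b else 0) • R.gam x =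
      (raise b * f b) • R.gam b := by
    intro τ b
    rw [Finset.sum_eq_single (b ∘ τ)]
    · rw [if_pos rfl, raise_comp, R.gam_comp_perm, smul_smul, ← Int.cast_smul_eq_zsmul ℝ, smul_eq_mul]
      congr 1
      linear_combination raise b * f b * sign_mul_self τ
    · intro x _ hx
      simp [hx]
    · simp
  simp only [h]
  rw [Finset.sum_const, Finset.card_univ, Fintype.card_perm, Fintype.card_fin,
    Nat.cast_smul_eq_nsmul]

open Classical in
/-- The indicator function of a generator. -/
noncomputable def indicator (i : HidGen) : HidGen → ℝ := fun g => if g = i then 1 else 0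

/-- Coefficient functions of the one-forms with upper indices. -/
noncomputable def coeff1 (v : HidGen → ℝ) (x : Fin 1 → Fin 11) : ℝ := v (.e1 (x 0))
noncomputable def coeff2 (v : HidGen → ℝ) (x : Fin 2 → Fin 11) : ℝ :=
  raise x * skewExt (fun b => v (.e2 b)) x
noncomputable def coeff5 (v : HidGen → ℝ) (x : Fin 5 → Fin 11) : ℝ :=
  raise x * skewExt (fun b => v (.e5 b)) x

section
variable {t u : Fin 32 → ℝ} {v w : HidGen → ℝ}

theorem eval_form1 (x : Fin 1 → Fin 11) :
    eval t u v w (form1 x) = coeff1 v x • fockA + coeff1 w x • fockB := eval_gen t u v w (.e1 (x 0))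

theorem skewExt_add {p : ℕ} {M : Type} [AddCommGroup M] (f g : (Fin p ↪o Fin 11) → M)
    (x : Fin p → Fin 11) : skewExt (fun b => f b + g b) x = skewExt f x + skewExt g x := by
  simp only [skewExt, ← Finset.sum_add_distrib]
  refine Finset.sum_congr rfl fun τ _ => Finset.sum_congr rfl fun b _ => ?_
  split_ifs <;> simp

theorem skewExt_smul_right {p : ℕ} (f : (Fin p ↪o Fin 11) → ℝ) (A : Matrix (Fin 4) (Fin 4) ℝ)
    (x : Fin p → Fin 11) : skewExt (fun b => f b • A) x = skewExt f x • A :=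
  (map_skewExt ((LinearMap.id : ℝ →ₗ[ℝ] ℝ).smulRight A) f x).symm

theorem eval_form2 (x : Fin 2 → Fin 11) :
    eval t u v w (form2 x) = coeff2 v x • fockA + coeff2 w x • fockB := by
  have h := map_skewExt (eval t u v w).toLinearMap (fun b => gen hidParity (.e2 b)) x
  simp only [AlgHom.toLinearMap_apply, eval_gen, evalGen, skewExt_add, skewExt_smul_right] at h
  rw [form2, map_smul, e2, h, smul_add, smul_smul, smul_smul]
  rfl

theorem eval_form5 (x : Fin 5 → Fin 11) :
    eval t u v w (form5 x) = coeff5 v x • fockA + coeff5 w x • fockB := by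
  have h := map_skewExt (eval t u v w).toLinearMap (fun b => gen hidParity (.e5 b)) x
  simp only [AlgHom.toLinearMap_apply, eval_gen, evalGen, skewExt_add, skewExt_smul_right] at h
  rw [form5, map_smul, e5, h, smul_add, smul_smul, smul_smul]
  rfl

end

theorem coeffMatrix_one (a : Fin 11) : coeffMatrix R (coeff1 (indicator (.e1 a))) = R.gam ![a] := by
  rw [coeffMatrix, sum_multi_one, Finset.sum_eq_single a]
  · simp [coeff1, indicator]
  · intro b _ hb
    simp [coeff1, indicator, hb]
  · simp

theorem coeffMatrix_two (b : Fin 2 ↪o Fin 11) :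
    coeffMatrix R (coeff2 (indicator (.e2 b))) = (2 * raise b) • R.gam b := by
  unfold coeff2
  rw [sum_skewExt, Finset.sum_eq_single b]
  · simp [indicator, smul_smul]
  · intro c _ hc
    simp [indicator, hc]
  · simp

theorem coeffMatrix_five (b : Fin 5 ↪o Fin 11) :
    coeffMatrix R (coeff5 (indicator (.e5 b))) = (120 * raise b) • R.gam b := by
  unfold coeff5
  rw [sum_skewExt, Finset.sum_eq_single b]
  · simp [indicator, smul_smul, Nat.factorial]
  · intro c _ hc
    simp [indicator, hc]
  · simp

theorem coeffMatrix_eq_zero {p : ℕ} {V : (Fin p → Fin 11) → ℝ} (h : ∀ x, V x = 0) :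
    coeffMatrix R V = 0 := by simp [coeffMatrix, h]

end HiddenM

namespace HiddenM

/-! ## Non-vanishing of the invariants -/

variable {R : MajoranaRep}

/-- Polarisation: a symmetric form vanishing on all vectors vanishes on all pairs of basis vectors.
-/
theorem exists_quadratic_ne_zero {n : ℕ} {S : Matrix (Fin n) (Fin n) ℝ} (hS : S.transpose = S)
    (h0 : S ≠ 0) : ∃ t : Fin n → ℝ, ∑ α, ∑ β, S α β * (t α * t β) ≠ 0 := by
  by_contra! h
  have hq : ∀ t : Fin n → ℝ, t ⬝ᵥ (S.mulVec t) = 0 := fun t => by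
    rw [← h t]
    simp only [dotProduct, Matrix.mulVec, Finset.mul_sum]
    exact Finset.sum_congr rfl fun α _ => Finset.sum_congr rfl fun β _ => by ring
  have hb : ∀ α β, Pi.single α (1 : ℝ) ⬝ᵥ S.mulVec (Pi.single β 1) = S α β := fun α β => by simp
  refine h0 (Matrix.ext fun α β => ?_)
  have h1 := hq (Pi.single α 1 + Pi.single β 1)
  rw [Matrix.mulVec_add, add_dotProduct, dotProduct_add, dotProduct_add, hq, hq, hb, hb] at h1
  have h2 : S β α = S α β := congrFun (congrFun hS α) β
  rw [h2] at h1
  rw [Matrix.zero_apply]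
  linarith

namespace MajoranaRep

theorem overlap_eq_card_filter {p q : ℕ} {x : Fin p → Fin 11} (hx : Function.Injective x)
    (y : Fin q → Fin 11) : overlap x y = (Finset.univ.filter fun i => x i ∈ rng y).card := by
  rw [overlap, ← Finset.card_image_of_injective _ hx]
  congr 1
  ext j
  simp only [Finset.mem_inter, Finset.mem_image, Finset.mem_filter, Finset.mem_univ, true_and, mem_rng]
  constructor
  · rintro ⟨⟨i, rfl⟩, h⟩
    exact ⟨i, h, rfl⟩
  · rintro ⟨i, h, rfl⟩
    exact ⟨⟨i, rfl⟩, h⟩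

/-- Each of the `p` generators in `x` passes `q` generators, with one sign fewer for each common
index. -/
theorem gam_mul_gam_comm {p q : ℕ} {x : Fin p → Fin 11} {y : Fin q → Fin 11}
    (hx : Function.Injective x) (hy : Function.Injective y) :
    R.gam x * R.gam y = (-1 : ℝ) ^ (p * q + overlap x y) • (R.gam y * R.gam x) := by
  have h : ∀ l : List (Fin 11), R.word l * R.gam y =
      (l.map fun j => (-1 : ℝ) ^ q * if j ∈ rng y then -1 else 1).prod • (R.gam y * R.word l) := by
    intro l
    induction l with
    | nil => simp
    | cons a l ih =>
      rw [word_cons, mul_assoc, ih, mul_smul_comm, ← mul_assoc, R.Γ_mul_gam a hy, smul_mul_assoc,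
        smul_smul, List.map_cons, List.prod_cons, mul_comm, mul_assoc, mul_assoc (R.gam y)]
  rw [R.gam_of_injective hx, h, List.map_ofFn, List.prod_ofFn]
  congr 1
  simp only [Function.comp, Finset.prod_mul_distrib, Finset.prod_const, Finset.card_univ,
    Fintype.card_fin]
  rw [← pow_mul, pow_add, mul_comm p q, Finset.prod_ite, Finset.prod_const, Finset.prod_const,
    one_pow, mul_one, overlap_eq_card_filter hx]

end MajoranaRep

/-- The parity condition makes the two products anticommute, hence `C Γ_x Γ_y` symmetric; it is
non-zero because each factor is invertible. -/
theorem exists_realPair_ne_zero {p q : ℕ} {x : Fin p → Fin 11} {y : Fin q → Fin 11}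
    (hp : MajoranaRep.SymDegree p) (hq : MajoranaRep.SymDegree q)
    (hx : Function.Injective x) (hy : Function.Injective y)
    (hxy : Odd (p * q + MajoranaRep.overlap x y)) :
    ∃ t, realPair R t t (R.gam x * R.gam y) ≠ 0 := by
  have h : ∀ {n : ℕ} (_ : MajoranaRep.SymDegree n) (w : Fin n → Fin 11),
      (R.gam w).transpose * R.C = -(R.C * R.gam w) := fun hn w => by
    rw [R.gam_transpose, hn.neg_one_pow, neg_one_smul]
  refine exists_quadratic_ne_zero ?_ ?_
  · rw [Matrix.transpose_mul, Matrix.transpose_mul, R.C_skew, mul_neg, mul_assoc, h hp, mul_neg,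
      neg_neg, ← mul_assoc, h hq, neg_mul, MajoranaRep.gam_mul_gam_comm hx hy, hxy.neg_one_pow,
      neg_one_smul, mul_neg, mul_assoc]
  · intro h0
    have h1 := Matrix.nonsing_inv_mul_cancel_left R.C (R.gam x * R.gam y) R.isUnit_C
    rw [h0, mul_zero] at h1
    have h2 := congrArg (fun M => R.gam x * M * R.gam y) h1
    simp only [mul_zero, zero_mul] at h2
    rw [← mul_assoc, mul_assoc _ _ (R.gam y), R.gam_mul_self hx, R.gam_mul_self hy] at h2
    have h3 := congrFun (congrFun h2 0) 0
    simp [raise_ne_zero] at h3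

theorem component_eq_zero (t : Fin 32 → ℝ) {p q r : ℕ} {x : Fin p → Fin 11} {y : Fin q → Fin 11}
    (he : Even (p + q + r) → r + 2 * MajoranaRep.overlap x y ≠ p + q)
    (ho : Odd (p + q + r) → p + q + r ≠ 11 + 2 * MajoranaRep.overlap x y) :
    component R t r (R.gam x * R.gam y) = 0 := by
  refine Finset.sum_eq_zero fun z _ => ?_
  have h : (R.gam z * (R.gam x * R.gam y)).trace = 0 := by
    rw [← mul_assoc]
    by_contra hn
    have ht : R.tri x y z ≠ 0 := by rwa [← MajoranaRep.tri_cyclic]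
    rcases Nat.even_or_odd (p + q + r) with hN | hN
    · exact he hN (MajoranaRep.overlap_of_tri_even ht hN)
    · exact ho hN (MajoranaRep.overlap_of_tri_odd ht hN)
  rw [h, mul_zero, zero_mul]

theorem realPair_eq_dotProduct (t u : Fin 32 → ℝ) (M : Matrix (Fin 32) (Fin 32) ℝ) :
    realPair R t u M = t ⬝ᵥ (R.C * M).mulVec u := by
  simp only [realPair, dotProduct, Matrix.mulVec, Finset.mul_sum]
  exact Finset.sum_congr rfl fun α _ => Finset.sum_congr rfl fun β _ => by ring

theorem C_mul_Γ_symm (a : Fin 11) : (R.C * R.Γ a).transpose = R.C * R.Γ a := by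
  rw [Matrix.transpose_mul, R.C_skew, mul_neg, R.adjoint, neg_neg]

theorem realPair_Γ_comm (a : Fin 11) (t u : Fin 32 → ℝ) :
    realPair R t u (R.Γ a) = realPair R u t (R.Γ a) := by
  rw [realPair_eq_dotProduct, realPair_eq_dotProduct, Matrix.dotProduct_mulVec,
    ← Matrix.mulVec_transpose, C_mul_Γ_symm, dotProduct_comm]

theorem trace_Γ_mul_Γ (a b : Fin 11) :
    (R.Γ a * R.Γ b).trace = if a = b then 32 * mink b else 0 := by
  split_ifs with h
  · rw [h, R.Γ_sq, Matrix.trace_smul, MajoranaRep.trace_one_32, smul_eq_mul, mul_comm]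
  · have h1 := congrArg Matrix.trace (R.Γ_anticomm h)
    rw [Matrix.trace_neg, Matrix.trace_mul_comm (R.Γ b)] at h1
    linarith

/-- This quartic is the value of `dmixed R s form1` at real spinors. If it vanished identically,
polarising and contracting two of the spinor slots would give `(32 - 18) (x̄ Γ_0 x) = 0` for all
`x`, although `C Γ_0` is symmetric and non-zero. -/
theorem exists_quartic_ne_zero :
    ∃ t u, ∑ a, mink a * realPair R t t (R.Γ a) * realPair R t u (R.Γ a) ≠ 0 := by
  by_contra! h
  have hadd : ∀ x y u a, realPair R (x + y) u (R.Γ a) =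
      realPair R x u (R.Γ a) + realPair R y u (R.Γ a) := fun x y u a => by
    simp only [realPair_eq_dotProduct, add_dotProduct]
  have hadd' : ∀ x y u a, realPair R u (x + y) (R.Γ a) =
      realPair R u x (R.Γ a) + realPair R u y (R.Γ a) := fun x y u a => by
    rw [realPair_Γ_comm, hadd, realPair_Γ_comm, realPair_Γ_comm a y]
  have hneg : ∀ x u a, realPair R (-x) u (R.Γ a) = -realPair R x u (R.Γ a) := fun x u a => by
    simp only [realPair_eq_dotProduct, neg_dotProduct]
  have hneg' : ∀ x u a, realPair R u (-x) (R.Γ a) = -realPair R u x (R.Γ a) := fun x u a => by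
    rw [realPair_Γ_comm, hneg, realPair_Γ_comm]
  -- The part of the identity quadratic in `x` and linear in `y`, extracted from the values at `x +
  -- y`, `x - y` and `y`.
  have hpol : ∀ x y u, ∑ a, mink a * (realPair R x x (R.Γ a) * realPair R y u (R.Γ a) +
      2 * (realPair R x y (R.Γ a) * realPair R x u (R.Γ a))) = 0 := by
    intro x y u
    have h1 := h (x + y) u
    have h2 := h (x + -y) u
    have h3 := h y u
    have h4 : ∑ a, mink a * (realPair R x x (R.Γ a) * realPair R y u (R.Γ a) +
        2 * (realPair R x y (R.Γ a) * realPair R x u (R.Γ a))) =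
        1 / 2 * ∑ a, mink a * realPair R (x + y) (x + y) (R.Γ a) * realPair R (x + y) u (R.Γ a) -
        1 / 2 * ∑ a, mink a * realPair R (x + -y) (x + -y) (R.Γ a) * realPair R (x + -y) u (R.Γ a) -
        ∑ a, mink a * realPair R y y (R.Γ a) * realPair R y u (R.Γ a) := by
      rw [Finset.mul_sum, Finset.mul_sum, ← Finset.sum_sub_distrib, ← Finset.sum_sub_distrib]
      refine Finset.sum_congr rfl fun a _ => ?_
      simp only [hadd, hadd', hneg, hneg', realPair_Γ_comm a y x]
      ring
    rw [h4, h1, h2, h3]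
    ring
  have hzero : ∀ x, realPair R x x (R.Γ 0) = 0 := by
    intro x
    -- Contracting the slots `y` and `u` against `P` turns the first polarised term into a trace and
    -- the second into a conjugation of `Γ_0`.
    set P : Matrix (Fin 32) (Fin 32) ℝ := R.Γ 0 * R.C⁻¹ with hP
    have h1 : ∀ a, ∑ β, realPair R (Pi.single β 1) (fun γ => P γ β) (R.Γ a) =
        (R.Γ a * R.Γ 0).trace := by
      intro a
      have : (R.C * R.Γ a * P).trace = (R.Γ a * R.Γ 0).trace := by
        rw [hP, mul_assoc, ← mul_assoc (R.Γ a), Matrix.trace_mul_comm,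
          Matrix.nonsing_inv_mul_cancel_right _ _ R.isUnit_C]
      rw [← this, Matrix.trace]
      refine Finset.sum_congr rfl fun β _ => ?_
      rw [realPair_eq_dotProduct, single_one_dotProduct, Matrix.diag_apply]
      rfl
    have h2 : ∀ a, ∑ β, realPair R x (Pi.single β 1) (R.Γ a) *
        realPair R x (fun γ => P γ β) (R.Γ a) = realPair R x x (R.Γ a * R.Γ 0 * R.Γ a) := by
      intro a
      have e1 : ∀ β, realPair R x (Pi.single β 1) (R.Γ a) = (R.C * R.Γ a).mulVec x β := fun β => by
        rw [realPair_Γ_comm, realPair_eq_dotProduct, single_one_dotProduct]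
      have e2 : ∀ β, realPair R x (fun γ => P γ β) (R.Γ a) =
          Matrix.vecMul x (R.C * R.Γ a * P) β := fun β => by
        rw [realPair_eq_dotProduct]
        rfl
      simp only [e1, e2]
      change (R.C * R.Γ a).mulVec x ⬝ᵥ Matrix.vecMul x (R.C * R.Γ a * P) = _
      rw [dotProduct_comm, ← Matrix.dotProduct_mulVec, Matrix.mulVec_mulVec, realPair_eq_dotProduct,
        hP]
      have e3 : R.C * R.Γ a * (R.Γ 0 * R.C⁻¹) * (R.C * R.Γ a) =
          R.C * R.Γ a * R.Γ 0 * (R.C⁻¹ * (R.C * R.Γ a)) := by simp only [mul_assoc]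
      rw [e3, Matrix.nonsing_inv_mul_cancel_left _ _ R.isUnit_C]
      simp only [mul_assoc]
    have h3 : ∑ β, ∑ a, mink a * (realPair R x x (R.Γ a) *
        realPair R (Pi.single β 1) (fun γ => P γ β) (R.Γ a) +
        2 * (realPair R x (Pi.single β 1) (R.Γ a) * realPair R x (fun γ => P γ β) (R.Γ a))) = 0 :=
      Finset.sum_eq_zero fun β _ => hpol _ _ _
    rw [Finset.sum_comm] at h3
    simp only [← Finset.mul_sum, Finset.sum_add_distrib, h1, h2, trace_Γ_mul_Γ] at h3
    have h4 := congrArg (realPair R x x) (R.sum_conj_gam ![0])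
    have h5 : realPair R x x (∑ a, mink a • (R.Γ a * R.Γ 0 * R.Γ a)) =
        ∑ a, mink a * realPair R x x (R.Γ a * R.Γ 0 * R.Γ a) := by
      simp only [realPair_eq_dotProduct, Matrix.mul_sum, Matrix.sum_mulVec, dotProduct_sum,
        mul_smul_comm, Matrix.smul_mulVec, dotProduct_smul, smul_eq_mul]
    simp only [R.gam_one, Matrix.cons_val_zero] at h4
    rw [h5, realPair_smul] at h4
    have h6 : ∑ a, mink a * (realPair R x x (R.Γ a) * (if a = 0 then 32 * mink 0 else 0) +
        2 * realPair R x x (R.Γ a * R.Γ 0 * R.Γ a)) =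
        32 * realPair R x x (R.Γ 0) +
          2 * ∑ a, mink a * realPair R x x (R.Γ a * R.Γ 0 * R.Γ a) := by
      simp only [mul_add, Finset.sum_add_distrib, Finset.mul_sum]
      congr 1
      · simp [mink]
        ring
      · exact Finset.sum_congr rfl fun a _ => by ring
    rw [h6, h4] at h3
    -- The trace term contributes 32 and the conjugation `2 * (-9)`, so the total 14 is non-zero.
    norm_num at h3
    linarith
  obtain ⟨t, ht⟩ := exists_quadratic_ne_zero (C_mul_Γ_symm (R := R) 0) (fun h0 => by
    have h1 := Matrix.nonsing_inv_mul_cancel_left R.C (R.Γ 0) R.isUnit_C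
    rw [h0, mul_zero] at h1
    have h2 := trace_Γ_mul_Γ (R := R) 0 0
    rw [← h1] at h2
    simp [mink] at h2)
  exact ht (hzero t)

end HiddenM

/-! ### Expansion of the equation in invariants -/

namespace HiddenM


section Expansion
variable (R : MajoranaRep) (s : ℝ)

/-- Of the three traces produced by completeness the selection rules leave one; the same happens in
the four statements that follow. -/
theorem quad_form1_form1 : quad R form1 form1 = (1 / 64 : ℝ) • dcubic R s form2 form1 form1 := by
  rw [quad_eq_dcubic R s, dcubic_eq_zero_of_odd (by decide) (by decide),
    dcubic_eq_zero_of_odd (p := 5) (by decide) (by decide)]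
  simp

theorem quad_form1_form2 : quad R form1 form2 = (1 / 32 : ℝ) • dcubic R s form1 form1 form2 := by
  rw [quad_eq_dcubic R s, dcubic_eq_zero_of_odd (p := 2) (by decide) (by decide),
    dcubic_eq_zero_of_lt (p := 5) (by decide) (by decide)]
  simp

theorem quad_form2_form2 : quad R form2 form2 = (1 / 64 : ℝ) • dcubic R s form2 form2 form2 := by
  rw [quad_eq_dcubic R s, dcubic_eq_zero_of_odd (p := 1) (by decide) (by decide),
    dcubic_eq_zero_of_odd (p := 5) (by decide) (by decide)]
  simp

theorem quad_form1_form5 : quad R form1 form5 = (1 / 3840 : ℝ) • dcubic R s form5 form1 form5 := by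
  have h : dcubic R s form2 form1 form5 = 0 := dcubic_eq_zero fun x y z => by
    by_contra h
    have := MajoranaRep.overlap_of_tri_even h (by decide)
    omega
  rw [quad_eq_dcubic R s, dcubic_eq_zero_of_odd (p := 1) (by decide) (by decide), h]
  simp

theorem quad_form2_form5 : quad R form2 form5 = (1 / 3840 : ℝ) • dcubic R s form5 form2 form5 := by
  have h : dcubic R s form1 form2 form5 = 0 := dcubic_eq_zero fun x y z => by
    by_contra h
    have := MajoranaRep.overlap_of_tri_even h (by decide)
    omega
  rw [quad_eq_dcubic R s, dcubic_eq_zero_of_odd (p := 2) (by decide) (by decide), h]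
  simp

/-- Expansion of `dP̂₃ - φ_ex^* G₄` in invariant two-forms. -/
theorem hidDiff_P3_sub (α₀ α₁ α₂ α₃ α₄ β₁ β₂ β₃ : ℝ) :
    hidDiff R s (P3 R α₀ α₁ α₂ α₃ α₄ β₁ β₂ β₃) - phiEx (G4 R) =
    (β₁ * delta s / 64 - α₀ / 64 - 1 / 128) • dcubic R s form2 form1 form1 +
    ((β₁ * gamma1 s + β₂ * delta s - α₀) / 32) • dcubic R s form1 form1 form2 +
    (β₂ * gamma1 s / 64 + 3 * α₁ / 256) • dcubic R s form2 form2 form2 +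
    ((β₃ * gamma2 s + α₃) / 32) • dcubic R s form1 form5 form5 +
    ((β₁ * gamma2 s + β₃ * delta s) / 3840 + α₃ / 16) • dcubic R s form5 form1 form5 +
    (β₃ * gamma2 s / 64 + α₂ / 38400) • dcubic R s form2 form5 form5 +
    ((β₂ * gamma2 s + β₃ * gamma1 s) / 3840 + α₂ / 19200) • dcubic R s form5 form2 form5 +
    (β₃ * gamma2 s / 3840 - 3 * α₄ / 6400) • dcubic R s form5 form5 form5 +
    (β₁ + 10 * β₂ - 720 * β₃) • dmixed R s form1 := by
  have f1 := isForm_form1 R s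
  have f2 := isForm_form2 R s
  have f5 := isForm_form5 R s
  rw [P3_eq, phiEx_G4]
  simp only [map_add, map_smul]
  -- The commutation lemmas bring equal invariants to a common order of arguments, so that the
  -- remaining identity is linear in them.
  rw [hidDiff_cubic f1 f1 f2, hidDiff_cubic f2 f2 f2, hidDiff_cubic f5 f2 f5,
    hidDiff_cubic f5 f5 f1, hidDiff_cubic f5 f5 f5, hidDiff_mixed f1.mem, hidDiff_mixed f2.mem,
    hidDiff_mixed f5.mem, dmixed_form2, dmixed_form5,
    dcubic_comm (X := form1) MajoranaRep.symDegree_one MajoranaRep.symDegree_one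
      MajoranaRep.symDegree_two f1 f2,
    dcubic_comm (X := form5) MajoranaRep.symDegree_five MajoranaRep.symDegree_two
      MajoranaRep.symDegree_five f2 f5,
    dcubic_comm (X := form5) MajoranaRep.symDegree_five MajoranaRep.symDegree_one
      MajoranaRep.symDegree_five f1 f5,
    quad_comm MajoranaRep.symDegree_one MajoranaRep.symDegree_two f1 f2,
    quad_comm MajoranaRep.symDegree_one MajoranaRep.symDegree_five f1 f5,
    quad_comm MajoranaRep.symDegree_two MajoranaRep.symDegree_five f2 f5,
    quad_form1_form1 R s, quad_form1_form2 R s,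
    quad_form2_form2 R s, quad_form1_form5 R s, quad_form2_form5 R s,
    quad_eq_dcubic R s form5 form5]
  module

end Expansion

/-! ### Evaluation of a relation between the invariants -/

section Independence
variable {R : MajoranaRep} {s : ℝ}

theorem skewExt_zero {p : ℕ} (x : Fin p → Fin 11) :
    skewExt (fun _ : Fin p ↪o Fin 11 => (0 : ℝ)) x = 0 := by simp [skewExt]

theorem coeffMatrix_anticomm {p : ℕ} {b c : Fin p ↪o Fin 11} (m : ℝ)
    (h : Odd (p * p + MajoranaRep.overlap b c)) :
    ((m * raise b) • R.gam b) * ((m * raise c) • R.gam c) -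
      ((m * raise c) • R.gam c) * ((m * raise b) • R.gam b) =
    (2 * (m * raise b) * (m * raise c)) • (R.gam b * R.gam c) := by
  have h1 := MajoranaRep.gam_mul_gam_comm (R := R) b.injective c.injective
  rw [h.neg_one_pow, neg_one_smul] at h1
  rw [smul_mul_smul_comm, smul_mul_smul_comm, h1]
  module

theorem exists_component_ne_zero {p q : ℕ} {x : Fin p → Fin 11} {y : Fin q → Fin 11}
    (hp : MajoranaRep.SymDegree p) (hq : MajoranaRep.SymDegree q)
    (hx : Function.Injective x) (hy : Function.Injective y)
    (hxy : Odd (p * q + MajoranaRep.overlap x y)) :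
    ∃ t, 1 / 32 * component R t 1 (R.gam x * R.gam y) + 1 / 64 * component R t 2 (R.gam x * R.gam y) +
      1 / 3840 * component R t 5 (R.gam x * R.gam y) ≠ 0 := by
  obtain ⟨t, ht⟩ := exists_realPair_ne_zero (R := R) hp hq hx hy hxy
  exact ⟨t, by rwa [← realPair_eq_component]⟩

variable {k₁ k₂ k₃ k₄ k₅ k₆ k₇ k₈ k₉ : ℝ}

/-- Sending all bosonic generators to zero kills every `dcubic` term but not `dmixed`, which
contains spinors only. -/
theorem coeff_dmixed_eq_zero
    (h : k₁ • dcubic R s form2 form1 form1 + k₂ • dcubic R s form1 form1 form2 +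
      k₃ • dcubic R s form2 form2 form2 + k₄ • dcubic R s form1 form5 form5 +
      k₅ • dcubic R s form5 form1 form5 + k₆ • dcubic R s form2 form5 form5 +
      k₇ • dcubic R s form5 form2 form5 + k₈ • dcubic R s form5 form5 form5 +
      k₉ • dmixed R s form1 = 0) : k₉ = 0 := by
  obtain ⟨t, u, htu⟩ := exists_quartic_ne_zero (R := R)
  have f1 : ∀ x, eval t u 0 0 (form1 x) = 0 := fun x => by simp [eval_form1, coeff1]
  have f2 : ∀ x, eval t u 0 0 (form2 x) = 0 := fun x => by
    simp [eval_form2, coeff2, skewExt_zero]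
  have f5 : ∀ x, eval t u 0 0 (form5 x) = 0 := fun x => by
    simp [eval_form5, coeff5, skewExt_zero]
  have hd : ∀ {p q r : ℕ} (X : (Fin p → Fin 11) → CEHid) (Y : (Fin q → Fin 11) → CEHid)
      (Z : (Fin r → Fin 11) → CEHid), (∀ z, eval t u 0 0 (Z z) = 0) →
      eval t u 0 0 (dcubic R s X Y Z) = 0 := fun X Y Z hZ => by
    simp [dcubic, hZ]
  have hm : eval t u 0 0 (dmixed R s form1) =
      (∑ a, mink a * realPair R t t (R.Γ a) * realPair R t u (R.Γ a)) • 1 := by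
    rw [dmixed, sum_multi_one, map_sum, Finset.sum_smul]
    refine Finset.sum_congr rfl fun a _ => ?_
    rw [map_mul, (isForm_form1 R s).diff, map_smul, eval_bil, eval_pair, R.gam_one, raise_one,
      mul_smul_comm, smul_mul_smul_comm, mul_one, smul_smul]
    congr 1
    simp [MajoranaRep.revSign]
    ring
  have h' := congrArg (eval t u 0 0) h
  simp only [map_add, map_smul, hd _ _ form1 f1, hd _ _ form2 f2, hd _ _ form5 f5, hm, smul_zero,
    zero_add, map_zero, smul_smul] at h'
  have h0 := congrFun (congrFun h' 0) 0
  simpa [htu] using h0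

theorem eval_relation
    (h : k₁ • dcubic R s form2 form1 form1 + k₂ • dcubic R s form1 form1 form2 +
      k₃ • dcubic R s form2 form2 form2 + k₄ • dcubic R s form1 form5 form5 +
      k₅ • dcubic R s form5 form1 form5 + k₆ • dcubic R s form2 form5 form5 +
      k₇ • dcubic R s form5 form2 form5 + k₈ • dcubic R s form5 form5 form5 = 0)
    (t : Fin 32 → ℝ) (v w : HidGen → ℝ) :
    k₁ * component R t 2 (coeffMatrix R (coeff1 v) * coeffMatrix R (coeff1 w) -
        coeffMatrix R (coeff1 w) * coeffMatrix R (coeff1 v)) +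
      k₂ * component R t 1 (coeffMatrix R (coeff1 v) * coeffMatrix R (coeff2 w) -
        coeffMatrix R (coeff1 w) * coeffMatrix R (coeff2 v)) +
      k₃ * component R t 2 (coeffMatrix R (coeff2 v) * coeffMatrix R (coeff2 w) -
        coeffMatrix R (coeff2 w) * coeffMatrix R (coeff2 v)) +
      k₄ * component R t 1 (coeffMatrix R (coeff5 v) * coeffMatrix R (coeff5 w) -
        coeffMatrix R (coeff5 w) * coeffMatrix R (coeff5 v)) +
      k₅ * component R t 5 (coeffMatrix R (coeff1 v) * coeffMatrix R (coeff5 w) -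
        coeffMatrix R (coeff1 w) * coeffMatrix R (coeff5 v)) +
      k₆ * component R t 2 (coeffMatrix R (coeff5 v) * coeffMatrix R (coeff5 w) -
        coeffMatrix R (coeff5 w) * coeffMatrix R (coeff5 v)) +
      k₇ * component R t 5 (coeffMatrix R (coeff2 v) * coeffMatrix R (coeff5 w) -
        coeffMatrix R (coeff2 w) * coeffMatrix R (coeff5 v)) +
      k₈ * component R t 5 (coeffMatrix R (coeff5 v) * coeffMatrix R (coeff5 w) -
        coeffMatrix R (coeff5 w) * coeffMatrix R (coeff5 v)) = 0 := by
  have f1 := isForm_form1 R s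
  have f2 := isForm_form2 R s
  have f5 := isForm_form5 R s
  have h' := congrArg (eval t 0 v w) h
  simp only [map_add, map_smul, eval_dcubic f2 eval_form1 eval_form1,
    eval_dcubic f1 eval_form1 eval_form2, eval_dcubic f2 eval_form2 eval_form2,
    eval_dcubic f1 eval_form5 eval_form5, eval_dcubic f5 eval_form1 eval_form5,
    eval_dcubic f2 eval_form5 eval_form5, eval_dcubic f5 eval_form2 eval_form5,
    eval_dcubic f5 eval_form5 eval_form5, map_zero, smul_smul, ← add_smul] at h'
  exact (smul_eq_zero.1 h').resolve_right fockA_mul_fockB_ne_zero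

theorem coeff2_e1 (a : Fin 11) : coeffMatrix R (coeff2 (indicator (.e1 a))) = 0 :=
  coeffMatrix_eq_zero R fun x => by simp [coeff2, indicator, skewExt_zero]
theorem coeff5_e1 (a : Fin 11) : coeffMatrix R (coeff5 (indicator (.e1 a))) = 0 :=
  coeffMatrix_eq_zero R fun x => by simp [coeff5, indicator, skewExt_zero]
theorem coeff1_e2 (b : Fin 2 ↪o Fin 11) : coeffMatrix R (coeff1 (indicator (.e2 b))) = 0 :=
  coeffMatrix_eq_zero R fun x => by simp [coeff1, indicator]
theorem coeff5_e2 (b : Fin 2 ↪o Fin 11) : coeffMatrix R (coeff5 (indicator (.e2 b))) = 0 :=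
  coeffMatrix_eq_zero R fun x => by simp [coeff5, indicator, skewExt_zero]
theorem coeff1_e5 (b : Fin 5 ↪o Fin 11) : coeffMatrix R (coeff1 (indicator (.e5 b))) = 0 :=
  coeffMatrix_eq_zero R fun x => by simp [coeff1, indicator]
theorem coeff2_e5 (b : Fin 5 ↪o Fin 11) : coeffMatrix R (coeff2 (indicator (.e5 b))) = 0 :=
  coeffMatrix_eq_zero R fun x => by simp [coeff2, indicator, skewExt_zero]

end Independence

end HiddenM

/-! ### Isolating the coefficients -/

namespace HiddenM


variable {R : MajoranaRep} {s : ℝ} {k₁ k₂ k₃ k₄ k₅ k₆ k₇ k₈ k₉ : ℝ}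

theorem component_zero (t : Fin 32 → ℝ) (p : ℕ) : component R t p 0 = 0 := by simp [component]

/-- With degrees (1,1), (1,2), (2,2) and overlaps 0, 1, 1 the product of the two Clifford elements
is pure of degree 2, 1, 2 respectively. The surviving component cannot vanish for every `t`, since
it is then the whole quadratic form. -/
theorem coeff_low_eq_zero
    (h : k₁ • dcubic R s form2 form1 form1 + k₂ • dcubic R s form1 form1 form2 +
      k₃ • dcubic R s form2 form2 form2 + k₄ • dcubic R s form1 form5 form5 +
      k₅ • dcubic R s form5 form1 form5 + k₆ • dcubic R s form2 form5 form5 +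
      k₇ • dcubic R s form5 form2 form5 + k₈ • dcubic R s form5 form5 form5 = 0) :
    k₁ = 0 ∧ k₂ = 0 ∧ k₃ = 0 := by
  have hev := eval_relation h
  have hinj : ∀ a : Fin 11, Function.Injective ![a] := fun a => Function.injective_of_subsingleton _
  let b : Fin 2 ↪o Fin 11 := OrderEmbedding.ofStrictMono ![1, 2] (by decide)
  let c : Fin 2 ↪o Fin 11 := OrderEmbedding.ofStrictMono ![1, 3] (by decide)
  have o₁ : MajoranaRep.overlap ![(1 : Fin 11)] ![(2 : Fin 11)] = 0 := by decide
  have o₂ : MajoranaRep.overlap ![(1 : Fin 11)] b = 1 := by decide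
  have o₃ : MajoranaRep.overlap b c = 1 := by decide
  have rb := raise_ne_zero b
  have rc := raise_ne_zero c
  refine ⟨?_, ?_, ?_⟩
  · obtain ⟨t, ht⟩ := exists_component_ne_zero MajoranaRep.symDegree_one MajoranaRep.symDegree_one
      (hinj 1) (hinj 2) (by rw [o₁]; decide)
    have hc := MajoranaRep.gam_mul_gam_comm (R := R) (hinj 1) (hinj 2)
    rw [o₁] at hc
    rw [component_eq_zero (r := 1) t (by rw [o₁]; decide) (by rw [o₁]; decide),
      component_eq_zero (r := 5) t (by rw [o₁]; decide) (by rw [o₁]; decide)] at ht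
    have := hev t (indicator (.e1 1)) (indicator (.e1 2))
    simp only [coeffMatrix_one, coeff2_e1, coeff5_e1, mul_zero, sub_zero] at this
    rw [show R.gam ![2] * R.gam ![1] = (-1 : ℝ) • (R.gam ![1] * R.gam ![2]) by
      rw [hc]; simp, component_sub, component_smul] at this
    simp only [component_zero, mul_zero, add_zero] at this
    refine (mul_eq_zero.1 this).resolve_right fun h => ht ?_
    linear_combination (1 / 128) * h
  · obtain ⟨t, ht⟩ := exists_component_ne_zero MajoranaRep.symDegree_one MajoranaRep.symDegree_two
      (hinj 1) b.injective (by rw [o₂]; decide)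
    rw [component_eq_zero (r := 2) t (by rw [o₂]; decide) (by rw [o₂]; decide),
      component_eq_zero (r := 5) t (by rw [o₂]; decide) (by rw [o₂]; decide)] at ht
    have := hev t (indicator (.e1 1)) (indicator (.e2 b))
    simp only [coeffMatrix_one, coeffMatrix_two, coeff2_e1, coeff5_e1, coeff1_e2, coeff5_e2, mul_zero,
      zero_mul, sub_zero, mul_smul_comm, component_smul, component_zero, zero_add, add_zero] at this
    refine (mul_eq_zero.1 this).resolve_right fun h => ht ?_
    have h2 := (mul_eq_zero.1 h).resolve_left (by simpa using rb)
    rw [h2]; ring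
  · obtain ⟨t, ht⟩ := exists_component_ne_zero MajoranaRep.symDegree_two MajoranaRep.symDegree_two
      b.injective c.injective (by rw [o₃]; decide)
    rw [component_eq_zero (r := 1) t (by rw [o₃]; decide) (by rw [o₃]; decide),
      component_eq_zero (r := 5) t (by rw [o₃]; decide) (by rw [o₃]; decide)] at ht
    have := hev t (indicator (.e2 b)) (indicator (.e2 c))
    simp only [coeffMatrix_two, coeff1_e2, coeff5_e2, mul_zero, zero_mul, sub_zero, component_zero,
      zero_add, add_zero] at this
    rw [coeffMatrix_anticomm 2 (by rw [o₃]; decide), component_smul] at this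
    refine (mul_eq_zero.1 this).resolve_right fun h => ht ?_
    have h2 := (mul_eq_zero.1 h).resolve_left (by simp [rb, rc])
    rw [h2]; ring

theorem coeff_dcubic_form5_form2_form5_eq_zero
    (h : k₁ • dcubic R s form2 form1 form1 + k₂ • dcubic R s form1 form1 form2 +
      k₃ • dcubic R s form2 form2 form2 + k₄ • dcubic R s form1 form5 form5 +
      k₅ • dcubic R s form5 form1 form5 + k₆ • dcubic R s form2 form5 form5 +
      k₇ • dcubic R s form5 form2 form5 + k₈ • dcubic R s form5 form5 form5 = 0) : k₇ = 0 := by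
  let b : Fin 2 ↪o Fin 11 := OrderEmbedding.ofStrictMono ![5, 6] (by decide)
  let c : Fin 5 ↪o Fin 11 := OrderEmbedding.ofStrictMono ![1, 2, 3, 4, 5] (by decide)
  have o : MajoranaRep.overlap b c = 1 := by decide
  have rb := raise_ne_zero b
  have rc := raise_ne_zero c
  obtain ⟨t, ht⟩ := exists_component_ne_zero MajoranaRep.symDegree_two MajoranaRep.symDegree_five
    b.injective c.injective (by rw [o]; decide)
  rw [component_eq_zero (r := 1) t (by rw [o]; decide) (by rw [o]; decide),
    component_eq_zero (r := 2) t (by rw [o]; decide) (by rw [o]; decide)] at ht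
  have := eval_relation h t (indicator (.e2 b)) (indicator (.e5 c))
  simp only [coeffMatrix_two, coeffMatrix_five, coeff1_e2, coeff5_e2, coeff1_e5, coeff2_e5, mul_zero,
    zero_mul, sub_zero, smul_mul_smul_comm, component_smul, component_zero, zero_add, add_zero] at this
  refine (mul_eq_zero.1 this).resolve_right fun h => ht ?_
  have h2 := (mul_eq_zero.1 h).resolve_left (by simp [rb, rc])
  rw [h2]; ring

theorem eval_relation_five
    (h : k₁ • dcubic R s form2 form1 form1 + k₂ • dcubic R s form1 form1 form2 +
      k₃ • dcubic R s form2 form2 form2 + k₄ • dcubic R s form1 form5 form5 +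
      k₅ • dcubic R s form5 form1 form5 + k₆ • dcubic R s form2 form5 form5 +
      k₇ • dcubic R s form5 form2 form5 + k₈ • dcubic R s form5 form5 form5 = 0)
    {c d : Fin 5 ↪o Fin 11}
    (o : Odd (5 * 5 + MajoranaRep.overlap c d)) (t : Fin 32 → ℝ) :
    k₄ * component R t 1 (R.gam c * R.gam d) + k₆ * component R t 2 (R.gam c * R.gam d) +
      k₈ * component R t 5 (R.gam c * R.gam d) = 0 := by
  have := eval_relation h t (indicator (.e5 c)) (indicator (.e5 d))
  simp only [coeffMatrix_five, coeff1_e5, coeff2_e5, mul_zero, zero_mul, sub_zero, component_zero,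
    zero_add, add_zero] at this
  rw [coeffMatrix_anticomm 120 o] at this
  simp only [component_smul] at this
  have hr : 2 * (120 * raise c) * (120 * raise d) ≠ 0 := by
    simp [raise_ne_zero]
  refine (mul_eq_zero.1 ?_).resolve_left hr
  linear_combination this

/-- Two products of degree 5 with overlap 0, 4 or 2 multiply to an element of degree 10, 2 or 6,
which by the volume relation counts as degree 1, 2 or 5. So each overlap isolates one of the three
coefficients. -/
theorem coeff_five_eq_zero
    (h : k₁ • dcubic R s form2 form1 form1 + k₂ • dcubic R s form1 form1 form2 +
      k₃ • dcubic R s form2 form2 form2 + k₄ • dcubic R s form1 form5 form5 +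
      k₅ • dcubic R s form5 form1 form5 + k₆ • dcubic R s form2 form5 form5 +
      k₇ • dcubic R s form5 form2 form5 + k₈ • dcubic R s form5 form5 form5 = 0) :
    k₄ = 0 ∧ k₆ = 0 ∧ k₈ = 0 := by
  let c : Fin 5 ↪o Fin 11 := OrderEmbedding.ofStrictMono ![1, 2, 3, 4, 5] (by decide)
  let d₀ : Fin 5 ↪o Fin 11 := OrderEmbedding.ofStrictMono ![6, 7, 8, 9, 10] (by decide)
  let d₂ : Fin 5 ↪o Fin 11 := OrderEmbedding.ofStrictMono ![4, 5, 6, 7, 8] (by decide)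
  let d₄ : Fin 5 ↪o Fin 11 := OrderEmbedding.ofStrictMono ![1, 2, 3, 4, 6] (by decide)
  have o₀ : MajoranaRep.overlap c d₀ = 0 := by decide
  have o₂ : MajoranaRep.overlap c d₂ = 2 := by decide
  have o₄ : MajoranaRep.overlap c d₄ = 4 := by decide
  refine ⟨?_, ?_, ?_⟩
  · have ho : Odd (5 * 5 + MajoranaRep.overlap c d₀) := by rw [o₀]; decide
    obtain ⟨t, ht⟩ := exists_component_ne_zero MajoranaRep.symDegree_five MajoranaRep.symDegree_five
      c.injective d₀.injective ho
    have := eval_relation_five h ho t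
    rw [component_eq_zero (r := 2) t (by rw [o₀]; decide) (by rw [o₀]; decide),
      component_eq_zero (r := 5) t (by rw [o₀]; decide) (by rw [o₀]; decide)] at ht this
    simp only [mul_zero, add_zero] at this
    refine (mul_eq_zero.1 this).resolve_right fun h => ht ?_
    rw [h]; ring
  · have ho : Odd (5 * 5 + MajoranaRep.overlap c d₄) := by rw [o₄]; decide
    obtain ⟨t, ht⟩ := exists_component_ne_zero MajoranaRep.symDegree_five MajoranaRep.symDegree_five
      c.injective d₄.injective ho
    have := eval_relation_five h ho t
    rw [component_eq_zero (r := 1) t (by rw [o₄]; decide) (by rw [o₄]; decide),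
      component_eq_zero (r := 5) t (by rw [o₄]; decide) (by rw [o₄]; decide)] at ht this
    simp only [mul_zero, zero_add, add_zero] at this
    refine (mul_eq_zero.1 this).resolve_right fun h => ht ?_
    rw [h]; ring
  · have ho : Odd (5 * 5 + MajoranaRep.overlap c d₂) := by rw [o₂]; decide
    obtain ⟨t, ht⟩ := exists_component_ne_zero MajoranaRep.symDegree_five MajoranaRep.symDegree_five
      c.injective d₂.injective ho
    have := eval_relation_five h ho t
    rw [component_eq_zero (r := 1) t (by rw [o₂]; decide) (by rw [o₂]; decide),
      component_eq_zero (r := 2) t (by rw [o₂]; decide) (by rw [o₂]; decide)] at ht this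
    simp only [mul_zero, zero_add, add_zero] at this
    refine (mul_eq_zero.1 this).resolve_right fun h => ht ?_
    rw [h]; ring

/-- The last condition is kept multiplied by its invariant: whether that invariant vanishes is
immaterial, because the other equations already determine all eight parameters. -/
theorem hidDiff_P3_eq_iff (R : MajoranaRep) (s α₀ α₁ α₂ α₃ α₄ β₁ β₂ β₃ : ℝ) :
    hidDiff R s (P3 R α₀ α₁ α₂ α₃ α₄ β₁ β₂ β₃) = phiEx (G4 R) ↔
    β₁ * delta s - α₀ = 1 / 2 ∧ β₁ * gamma1 s + β₂ * delta s = α₀ ∧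
      α₁ = -(4 / 3) * (β₂ * gamma1 s) ∧ α₃ = -(β₃ * gamma2 s) ∧ α₂ = -600 * (β₃ * gamma2 s) ∧
      β₂ * gamma2 s + β₃ * gamma1 s + α₂ / 5 = 0 ∧ α₄ = 5 / 9 * (β₃ * gamma2 s) ∧
      β₁ + 10 * β₂ - 720 * β₃ = 0 ∧
      (β₁ * gamma2 s + β₃ * delta s + 240 * α₃) • dcubic R s form5 form1 form5 = 0 := by
  rw [← sub_eq_zero, hidDiff_P3_sub]
  constructor
  · intro h
    have h9 := coeff_dmixed_eq_zero h
    rw [h9, zero_smul, add_zero] at h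
    obtain ⟨h1, h2, h3⟩ := coeff_low_eq_zero h
    have h7 := coeff_dcubic_form5_form2_form5_eq_zero h
    obtain ⟨h4, h6, h8⟩ := coeff_five_eq_zero h
    rw [h1, h2, h3, h4, h6, h7, h8] at h
    refine ⟨by linarith, by linarith, by linarith, by linarith, by linarith, by linarith, by linarith,
      h9, ?_⟩
    linear_combination (norm := module) (3840 : ℝ) • h
  · rintro ⟨h1, h2, h3, h4, h5, h6, h7, h8, h9⟩
    rw [show β₁ * delta s / 64 - α₀ / 64 - 1 / 128 = 0 by linarith,
      show (β₁ * gamma1 s + β₂ * delta s - α₀) / 32 = 0 by linarith,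
      show β₂ * gamma1 s / 64 + 3 * α₁ / 256 = 0 by linarith,
      show (β₃ * gamma2 s + α₃) / 32 = 0 by linarith,
      show β₃ * gamma2 s / 64 + α₂ / 38400 = 0 by linarith,
      show (β₂ * gamma2 s + β₃ * gamma1 s) / 3840 + α₂ / 19200 = 0 by linarith,
      show β₃ * gamma2 s / 3840 - 3 * α₄ / 6400 = 0 by linarith, h8]
    linear_combination (norm := module) (1 / 3840 : ℝ) • h9

end HiddenM

/-! ### Solution of the linear system -/

theorem mainTheorem2 (R : MajoranaRep) (s : ℝ) (hs : s ≠ 0)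
    (α₀ α₁ α₂ α₃ α₄ β₁ β₂ β₃ : ℝ) :
    hidDiff R s (P3 R α₀ α₁ α₂ α₃ α₄ β₁ β₂ β₃) = phiEx (G4 R) ↔
      (α₀ = (1 / 2) * (-1 / 5) * ((6 + 2 * s + s ^ 2) / s ^ 2) ∧
       α₁ = (1 / 2) * (1 / 15) * ((6 + 2 * s) / s ^ 2) ∧
       α₂ = (1 / 2) * (1 / ((6 ! : ℕ) : ℝ)) * ((6 + s) ^ 2 / s ^ 2) ∧
       α₃ = (1 / 2) * (1 / (5 * ((5 ! : ℕ) : ℝ) * ((6 ! : ℕ) : ℝ))) * ((6 + s) ^ 2 / s ^ 2) ∧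
       α₄ = (1 / 2) * (-1 / (9 * ((5 ! : ℕ) : ℝ) * ((6 ! : ℕ) : ℝ))) * ((6 + s) ^ 2 / s ^ 2) ∧
       β₁ = -1 * (1 / (10 * gamma1 s)) * ((3 - 2 * s) / s ^ 2) ∧
       β₂ = -1 * (1 / (20 * gamma1 s)) * ((3 + s) / s ^ 2) ∧
       β₃ = -1 * (3 / (10 * ((6 ! : ℕ) : ℝ) * gamma1 s)) * ((6 + s) / s ^ 2)) := by
  have hd : delta s = 2 * (1 + s) := rfl
  have h1 : gamma1 s = 1 := rfl
  have h5 : ((5 ! : ℕ) : ℝ) = 120 := by norm_num [Nat.factorial]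
  have h6 : ((6 ! : ℕ) : ℝ) = 720 := by norm_num [Nat.factorial]
  have h2 : gamma2 s = (6 + s) / 360 := by
    rw [gamma2, h5, h6]; ring
  have hs2 : s ^ 2 ≠ 0 := pow_ne_zero 2 hs
  rw [hidDiff_P3_eq_iff, hd, h1, h2, h5, h6]
  constructor
  · rintro ⟨e1, e2, e3, e4, e5, e6, e7, e8, -⟩
    have hb1 : β₁ = 720 * β₃ - 10 * β₂ := by linarith
    have hb6 : (6 + s) * β₂ = 120 * (3 + s) * β₃ := by
      rw [e5] at e6
      linear_combination 360 * e6
    have hb0 : 720 * (1 + 2 * s) * β₃ - (12 + 22 * s) * β₂ = 1 / 2 := by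
      rw [← e2, hb1] at e1
      linear_combination e1
    -- Cramer's rule for `hb6` and `hb0` as equations in `β₂` and `β₃`; their determinant is `-1200
    -- s²`.
    have hb3 : β₃ * s ^ 2 = -(6 + s) / 2400 := by
      linear_combination (-1 / 1200) * (6 + s) * hb0 - (1 / 1200) * (12 + 22 * s) * hb6
    have hb2 : β₂ * s ^ 2 = -(3 + s) / 20 := by
      linear_combination (-1 / 1200) * (120 * (3 + s)) * hb0 - (1 / 1200) * (720 * (1 + 2 * s)) * hb6
    have hβ₃ : β₃ = -(6 + s) / 2400 / s ^ 2 := by rw [eq_div_iff hs2, hb3]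
    have hβ₂ : β₂ = -(3 + s) / 20 / s ^ 2 := by rw [eq_div_iff hs2, hb2]
    have hβ₁ : β₁ = -(3 - 2 * s) / 10 / s ^ 2 := by
      rw [hb1, hβ₃, hβ₂]; ring
    rw [hβ₃] at e4 e5 e7
    rw [hβ₂] at e2 e3
    rw [hβ₁] at e2
    refine ⟨?_, ?_, ?_, ?_, ?_, ?_, ?_, ?_⟩
    · rw [← e2]; field_simp; ring
    · rw [e3]; ring
    · rw [e5]; ring
    · rw [e4]; ring
    · rw [e7]; ring
    · rw [hβ₁]; ring
    · rw [hβ₂]; ring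
    · rw [hβ₃]; ring
  · rintro ⟨rfl, rfl, rfl, rfl, rfl, rfl, rfl, rfl⟩
    refine ⟨?_, ?_, ?_, ?_, ?_, ?_, ?_, ?_, ?_⟩
    · field_simp; ring
    · field_simp; ring
    · ring
    · ring
    · ring
    · field_simp; ring
    · ring
    · field_simp; ring
    · convert zero_smul ℝ _ using 2
      field_simp
      ring
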